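/- **Setting.** A sender and a receiver have utilities $u_S(a,\theta)=-(a-(\theta+M_S))^2$ and $u_R(a,\theta)=-(a-(\theta+M_R))^2$ for the receiver's action $a\in\mathbb R$ in state $\theta\in\mathbb R$. The prior on $\theta$ is diffuse (Lebesgue measure). The sender observes $n$ anecdotes $x_i=\theta+\epsilon_i$, with $\epsilon_i$ i.i.d. from a distribution $F$ with density $f$, and independent side information: either $y=\theta+\gamma$ with $\gamma\sim G$ for a probability distribution $G$ on $\mathbb R$ (foresight is $G=\delta_0$), or none (no foresight, $G$ diffuse; then $y$ plays no role). Let $\theta_S(\vec x,y)$ be her posterior mean of $\theta$. A communication scheme is a measurable $\pi$ with $\pi(\vec x,y)\in\{x_1,\dots,x_n\}$; it is translation invariant if $\pi(\vec x+\delta,y+\delta)=\pi(\vec x,y)+\delta$ for all $\vec x,y,\delta$. All schemes below are translation invariant. For such $\pi$, the bias $\beta(\pi)=\mathbb E[\pi(\vec x,y)-\theta]$ and the signaling loss $\mathbb E[(\pi(\vec x,y)-\theta_S(\vec x,y)-\beta(\pi))^2]$ (expectations given $\theta$) do not depend on $\theta$; $\pi$ is unbiased if $\beta(\pi)=0$.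 Under commitment the receiver plays a best response $\alpha_\pi$ to $\pi$ (for each $s$, $\alpha_\pi(s)$ maximizes his expected utility under the posterior of $\theta$ given $\pi(\vec x,y)=s$), and the sender's expected utility is $\mathbb E[u_S(\alpha_\pi(\pi(\vec x,y)),\theta)]$. $F$ is *well-behaved* if $f$ is continuous, positive, symmetric about $0$, strictly decreasing on $[0,\infty)$ and of finite variance; $f$ and $g=f'/f$ are differentiable away from $0$ with $|g'(x)|\le c_1$ for all $x\ne0$ and some constant $c_1>0$; and there are $Q,c_3>0$ such that $1-F(x)\le c_3e^{-|x|}$ for $x>Q$ and $F(x)\le c_3e^{-|x|}$ for $x<-Q$. (The standard normal and the Laplace distribution are examples.) **Theorem.** Let $F$ be well-behaved. Let a *closest-anecdote scheme* be a translation-invariant communication scheme that always sends an anecdote closest to $\theta_S(\vec x,y)$. 1. For every $n\ge1$ closest-anecdote schemes exist. If $G$ is symmetric or diffuse, then one of them (for a suitable tie-breaking rule) is unbiased, and all of them are whenever the closest anecdote is almost surely unique. 2. For every $n\ge1$, every closest-anecdote scheme $\pi_0$ is optimal among all unbiased schemes: for every unbiased $\pi$, the signaling loss of $\pi_0$ is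 at most that of $\pi$, and for all $M_S,M_R$ the sender's expected utility under commitment from $\pi_0$ is at least that from $\pi$. 3. For every $\eta>0$ there is an $N$ (depending only on $\eta$, $F$, $G$) such that for all $n\ge N$ every closest-anecdote scheme $\pi_0$ strictly dominates every scheme $\pi$ with $|\beta(\pi)|\ge\eta$: the signaling loss of $\pi_0$ is strictly smaller than that of $\pi$, and for all $M_S,M_R$ the sender's expected utility under commitment from $\pi_0$ is strictly larger than that from $\pi$. In particular, for every $\delta\ne0$ and all sufficiently large $n$, the closest-anecdote scheme strictly dominates every scheme of bias $\delta$. -/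

import Mathlib

open MeasureTheory ProbabilityTheory

noncomputable section

namespace Anecdote

/-- The noise distribution `F` on the reals with density `f`. -/
def noise (f : ℝ → ℝ) : Measure ℝ :=
  volume.withDensity fun x => ENNReal.ofReal (f x)

/-- Well-behaved noise distributions, given by a density `f`.  A kink of `f` at its peak `0` is
allowed (as for the Laplace density), so derivatives are only required away from `0`. -/
structure WellBehaved (f : ℝ → ℝ) : Prop where
  isProbabilityMeasure : IsProbabilityMeasure (noise f)
  continuous : Continuous f
  pos : ∀ x, 0 < f x
  symmetric : ∀ x, f (-x) = f x
  single_peaked : StrictAntiOn f (Set.Ici 0)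
  finite_variance : Integrable fun x => x ^ 2 * f x
  differentiableAt : ∀ x, x ≠ 0 → DifferentiableAt ℝ f x
  log_derivative : ∃ c₁ : ℝ, 0 < c₁ ∧ ∀ x, x ≠ 0 →
    DifferentiableAt ℝ (fun t => deriv f t / f t) x ∧
      |deriv (fun t => deriv f t / f t) x| ≤ c₁
  exponential_tails : ∃ Q : ℝ, 0 < Q ∧ ∃ c₃ : ℝ, 0 < c₃ ∧
    (∀ x, Q < x → 1 - (noise f).real (Set.Iic x) ≤ c₃ * Real.exp (-|x|)) ∧
    (∀ x, x < -Q → (noise f).real (Set.Iic x) ≤ c₃ * Real.exp (-|x|))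

/-- The sender's side information: either a signal `y = θ + γ` with `γ ∼ G` (full foresight is the
case where `G` is the Dirac mass at `0`), or the diffuse case (no foresight), in which `y` carries
no information about `θ`. -/
inductive SideInfo where
  | signal (G : Measure ℝ)
  | diffuse

namespace SideInfo

def IsProper : SideInfo → Prop
  | signal G => IsProbabilityMeasure G
  | diffuse => True

def IsSymmetric : SideInfo → Prop
  | signal G => G.map (fun γ => -γ) = G
  | diffuse => True

/-- The law of `y` in state `θ`.  In the diffuse case there is no informative `y`; it is set to the
constant `0`, and communication schemes are not allowed to depend on it. -/
def law : SideInfo → ℝ → Measure ℝ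
  | signal G, θ => G.map (fun γ => θ + γ)
  | diffuse, _ => Measure.dirac 0

/-- The belief about `θ` given `y` alone, starting from the diffuse prior (Lebesgue measure):
the law of `y - γ`, respectively still Lebesgue measure if `y` is uninformative. -/
def belief : SideInfo → ℝ → Measure ℝ
  | signal G, y => G.map (fun γ => y - γ)
  | diffuse, _ => volume

end SideInfo

/-- The law of `(x, y)` in state `θ`: independent anecdotes `x i = θ + ε i` with `ε i ∼ F`, and
independent side information `y`. -/
def dataLaw (f : ℝ → ℝ) (S : SideInfo) (n : ℕ) (θ : ℝ) : Measure ((Fin n → ℝ) × ℝ) :=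
  (Measure.pi fun _ : Fin n => (noise f).map fun ε => θ + ε).prod (S.law θ)

/-- The sender's posterior mean `θ_S(x, y)` under the diffuse prior, by Bayes' rule. -/
def posteriorMean (f : ℝ → ℝ) (S : SideInfo) {n : ℕ} (x : Fin n → ℝ) (y : ℝ) : ℝ :=
  (∫ θ, θ * ∏ i, f (x i - θ) ∂(S.belief y)) / ∫ θ, ∏ i, f (x i - θ) ∂(S.belief y)

/-- Communication schemes: measurable selections of one of the `n` anecdotes.  Without foresight
the selection depends on the anecdotes only. -/
structure IsScheme (S : SideInfo) {n : ℕ} (π : (Fin n → ℝ) → ℝ → ℝ) : Prop where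
  measurable : Measurable fun ω : (Fin n → ℝ) × ℝ => π ω.1 ω.2
  selects : ∀ x y, ∃ i, π x y = x i
  no_foresight : S = SideInfo.diffuse → ∀ x y y', π x y = π x y'

def IsTranslationInvariant {n : ℕ} (π : (Fin n → ℝ) → ℝ → ℝ) : Prop :=
  ∀ x y δ, π (fun i => x i + δ) (y + δ) = π x y + δ

/-- `π` always sends an anecdote that is closest to `θ_S(x, y) + r`. -/
def IsTargeting (f : ℝ → ℝ) (S : SideInfo) (r : ℝ) {n : ℕ} (π : (Fin n → ℝ) → ℝ → ℝ) : Prop :=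
  ∀ x y, ∃ i, π x y = x i ∧
    ∀ j, |x i - (posteriorMean f S x y + r)| ≤ |x j - (posteriorMean f S x y + r)|

/-- Almost surely in state `θ`, the anecdote closest to the posterior mean is unique. -/
def NoTies (f : ℝ → ℝ) (S : SideInfo) (n : ℕ) (θ : ℝ) : Prop :=
  ∀ᵐ ω ∂(dataLaw f S n θ), ∀ i j,
    |ω.1 i - posteriorMean f S ω.1 ω.2| = |ω.1 j - posteriorMean f S ω.1 ω.2| → ω.1 i = ω.1 j

/-- The bias `E[π(x, y) - θ]` in state `θ` (the same in all states if `π` is translation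
invariant). -/
def bias (f : ℝ → ℝ) (S : SideInfo) {n : ℕ} (π : (Fin n → ℝ) → ℝ → ℝ) (θ : ℝ) : ℝ :=
  ∫ ω, (π ω.1 ω.2 - θ) ∂(dataLaw f S n θ)

/-- The signaling loss `E[(π(x, y) - (θ_S(x, y) + β(π)))²]` in state `θ`. -/
def signalingLoss (f : ℝ → ℝ) (S : SideInfo) {n : ℕ} (π : (Fin n → ℝ) → ℝ → ℝ) (θ : ℝ) : ℝ :=
  ∫ ω, (π ω.1 ω.2 - (posteriorMean f S ω.1 ω.2 + bias f S π θ)) ^ 2 ∂(dataLaw f S n θ)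

/-- The utility from action `a` in state `θ` of a player with personal preference `M`. -/
def utility (M a θ : ℝ) : ℝ := -(a - (θ + M)) ^ 2

/-- `B s` is the posterior distribution of `θ` given `π(x, y) = s` under the diffuse prior:
the (infinite) joint law `J` of `θ ∼ volume` and `s = π(x, y)` disintegrates as
`J(θ ∈ C, s ∈ A) = ∫ 1_A(s) B s C dJ`. -/
def IsRationalBelief (f : ℝ → ℝ) (S : SideInfo) {n : ℕ} (π : (Fin n → ℝ) → ℝ → ℝ)
    (B : Kernel ℝ ℝ) : Prop :=
  ∀ A C : Set ℝ, MeasurableSet A → MeasurableSet C →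
    ∫⁻ θ in C, dataLaw f S n θ {ω | π ω.1 ω.2 ∈ A} =
      ∫⁻ θ, ∫⁻ ω in {ω | π ω.1 ω.2 ∈ A}, B (π ω.1 ω.2) C ∂(dataLaw f S n θ)

/-- `α` is a best response to `π` of the receiver with personal preference `M`: every `α s`
maximizes the receiver's expected utility under the rational belief `B s`. -/
def IsBestResponse (f : ℝ → ℝ) (S : SideInfo) {n : ℕ} (π : (Fin n → ℝ) → ℝ → ℝ) (M : ℝ)
    (α : ℝ → ℝ) : Prop :=
  ∃ B : Kernel ℝ ℝ, IsMarkovKernel B ∧ IsRationalBelief f S π B ∧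
    ∀ s a, ∫ θ, utility M a θ ∂(B s) ≤ ∫ θ, utility M (α s) θ ∂(B s)

/-- The expected utility in state `θ` of the sender with personal preference `M` who is committed
to `π`, if the receiver uses the action rule `α`. -/
def senderUtility (f : ℝ → ℝ) (S : SideInfo) {n : ℕ} (π : (Fin n → ℝ) → ℝ → ℝ) (M : ℝ)
    (α : ℝ → ℝ) (θ : ℝ) : ℝ :=
  ∫ ω, utility M (α (π ω.1 ω.2)) θ ∂(dataLaw f S n θ)

end Anecdote

end

/-! Everything reduces to squared distances. Under the diffuse prior, the data paired with the true
state and the data paired with a posterior draw have the same law up to translation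
(`lintegral_posterior_zeroLaw`). Hence the mean squared error of a scheme is its mean squared
distance to the posterior mean θ_S plus a posterior variance common to all schemes. Consequently the
signaling loss equals E(π - θ_S)² - β² (`signalingLoss_eq_sub_sq`). A best response is almost
everywhere the message minus its bias plus M_R, so the sender's utility is a constant, the same for
all schemes, minus the signaling loss (`senderUtility_eq`). Optimality among unbiased schemes is
then a pointwise comparison of distances to θ_S, and unbiasedness under symmetry follows by
reflecting the data.

For large n, near a point of density λ the anecdotes look like a Poisson process of intensity nλ: n
times the distance to the closest one is nearly exponential with rate 2λ and has second moment near
2/(2λ)². The target θ_S is near the true state, where λ = f(0). A scheme of bias β with |β| ≥ η must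
approach θ_S + β, where λ is at most about f(η) < f(0). This makes its loss strictly larger at scale
1/n².

The obstacle is that the target depends on the anecdotes. Write n = L^12. The sample mean deviates
from the state at scale L^-6, and the invariance identity transfers this to the posterior, which is
concentrated at scale L^-5 for every G. A cell of half-width L^-11 holds about L anecdotes; moving
them inside the cell tilts the log-likelihood by O(L^-9), and hence moves θ_S by only O(L^-14), far
less than the spacing L^-12 (`WellBehaved.exists_abs_posteriorMean_sub_le`). Resampling the
positions inside a cell therefore leaves the target essentially fixed, and elementary independence
estimates apply. Conditioning on the target being near a center c is undone by averaging over c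
(`measure_le_of_forall_center`, `WellBehaved.exists_window_le`). The results are an upper bound on
the chance of missing θ_S and an upper bound on the chance of hitting θ_S + β, both integrated by
the layer cake formula. -/

open Filter Topology

noncomputable section

namespace Anecdote

/-! ### Tails, smoothness and moment generating function of the noise. -/

section Density

variable {f : ℝ → ℝ}

lemma WellBehaved.apply_abs (hf : WellBehaved f) (x : ℝ) : f |x| = f x := by
  rcases abs_cases x with ⟨h, _⟩ | ⟨h, _⟩ <;> simp [h, hf.symmetric]

lemma WellBehaved.le_of_abs_le (hf : WellBehaved f) {x y : ℝ} (h : |x| ≤ |y|) : f y ≤ f x := by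
  rw [← hf.apply_abs x, ← hf.apply_abs y]
  exact hf.single_peaked.antitoneOn (abs_nonneg x) (abs_nonneg y) h

lemma WellBehaved.lt_of_abs_lt (hf : WellBehaved f) {x y : ℝ} (h : |x| < |y|) : f y < f x := by
  rw [← hf.apply_abs x, ← hf.apply_abs y]
  exact hf.single_peaked (abs_nonneg x) (abs_nonneg y) h

lemma WellBehaved.le_zero (hf : WellBehaved f) (x : ℝ) : f x ≤ f 0 :=
  hf.le_of_abs_le (by simp)

lemma WellBehaved.measurable (hf : WellBehaved f) : Measurable f := hf.continuous.measurable

lemma WellBehaved.lintegral_eq_one (hf : WellBehaved f) : ∫⁻ x, ENNReal.ofReal (f x) = 1 := by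
  have := hf.isProbabilityMeasure.measure_univ
  rwa [noise, withDensity_apply _ MeasurableSet.univ, Measure.restrict_univ] at this

lemma WellBehaved.integrable (hf : WellBehaved f) : Integrable f := by
  refine ⟨hf.continuous.aestronglyMeasurable, ?_⟩
  rw [hasFiniteIntegral_iff_ofReal (ae_of_all _ fun x => (hf.pos x).le), hf.lintegral_eq_one]
  simp

lemma noise_real_apply (hf : WellBehaved f) {s : Set ℝ} (hs : MeasurableSet s) :
    (noise f).real s = ∫ x in s, f x := by
  rw [Measure.real, noise, withDensity_apply _ hs,
    integral_eq_lintegral_of_nonneg_ae (ae_of_all _ fun x => (hf.pos x).le)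
      hf.continuous.aestronglyMeasurable]

lemma integral_noise (hf : WellBehaved f) (g : ℝ → ℝ) :
    ∫ x, g x ∂(noise f) = ∫ x, f x * g x := by
  rw [noise, integral_withDensity_eq_integral_toReal_smul hf.measurable.ennreal_ofReal
    (ae_of_all _ fun _ => ENNReal.ofReal_lt_top)]
  simp [ENNReal.toReal_ofReal (hf.pos _).le]

lemma integrable_noise_iff (hf : WellBehaved f) (g : ℝ → ℝ) :
    Integrable g (noise f) ↔ Integrable fun x => f x * g x := by
  rw [noise, integrable_withDensity_iff_integrable_smul' hf.measurable.ennreal_ofReal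
    (ae_of_all _ fun _ => ENNReal.ofReal_lt_top)]
  simp [ENNReal.toReal_ofReal (hf.pos _).le]

/-- Exponential decay of the density. -/
lemma WellBehaved.exists_le_exp (hf : WellBehaved f) :
    ∃ C : ℝ, 0 < C ∧ ∀ x, f x ≤ C * Real.exp (-|x|) := by
  have := hf.isProbabilityMeasure
  obtain ⟨Q, hQ, c, hc, htail, -⟩ := hf.exponential_tails
  refine ⟨f 0 * Real.exp (Q + 1) + c * Real.exp 1, by have := hf.pos 0; positivity, fun x => ?_⟩
  rw [← hf.apply_abs x]
  have ht := abs_nonneg x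
  generalize |x| = t at *
  have h0 := hf.pos 0
  by_cases h : t ≤ Q + 1
  · calc f t ≤ f 0 * 1 := by simpa using hf.le_zero t
      _ ≤ f 0 * (Real.exp (Q + 1) * Real.exp (-t)) := by
        gcongr; rw [← Real.exp_add]; exact Real.one_le_exp (by linarith)
      _ ≤ _ := by have : 0 ≤ c * Real.exp 1 * Real.exp (-t) := by positivity
                  linear_combination this
  · push Not at h
    -- Monotonicity turns the tail bound into a density bound: f t is at most the mass of (t - 1,
    -- t], which is at most the tail beyond t - 1. The shift by one costs a factor e.
    have h1 : f t ≤ (noise f).real (Set.Ioc (t - 1) t) := by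
      rw [noise_real_apply hf measurableSet_Ioc]
      calc f t = ∫ x in Set.Ioc (t - 1) t, f t := by simp
        _ ≤ _ := by
          refine setIntegral_mono_on (by simp) hf.integrable.integrableOn measurableSet_Ioc ?_
          intro x hx
          exact hf.le_of_abs_le (by rw [abs_of_nonneg ht, abs_of_nonneg] <;> linarith [hx.1, hx.2])
    have h2 : (noise f).real (Set.Ioc (t - 1) t) ≤ 1 - (noise f).real (Set.Iic (t - 1)) := by
      rw [← probReal_compl_eq_one_sub measurableSet_Iic]
      refine measureReal_mono (fun x hx => ?_)
      simpa using hx.1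
    have h3 := htail (t - 1) (by linarith)
    rw [abs_of_nonneg (by linarith : 0 ≤ t - 1)] at h3
    have h4 : Real.exp (-(t - 1)) = Real.exp 1 * Real.exp (-t) := by rw [← Real.exp_add]; ring_nf
    rw [h4] at h3
    have : 0 ≤ f 0 * Real.exp (Q + 1) * Real.exp (-t) := by positivity
    linear_combination h1 + h2 + h3 + this

/-- Local Lipschitz bound for the log-density. -/
lemma WellBehaved.exists_log_lipschitz (hf : WellBehaved f) :
    ∃ A : ℝ, 0 < A ∧ ∀ x y B : ℝ, |x| ≤ B → |y| ≤ B →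
      |Real.log (f x) - Real.log (f y)| ≤ A * (1 + B) * |x - y| := by
  obtain ⟨c, hc, hder⟩ := hf.log_derivative
  set g : ℝ → ℝ := fun t => deriv f t / f t with hg
  -- A bounded derivative makes g = f'/f grow at most linearly. The reference point 1 stays away
  -- from a possible kink at 0.
  have hgb : ∀ x, 0 < x → |g x| ≤ (|g 1| + c) * (1 + x) := by
    intro x hx
    have := Convex.norm_image_sub_le_of_norm_deriv_le (f := g) (s := Set.Ioi 0) (x := 1) (y := x)
      (C := c) (fun t ht => (hder t (ne_of_gt ht)).1)
      (fun t ht => (hder t (ne_of_gt ht)).2) (convex_Ioi 0) (by simp) hx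
    rw [Real.norm_eq_abs, Real.norm_eq_abs] at this
    have h1 : |g x| ≤ |g 1| + c * |x - 1| := by
      have := abs_sub_abs_le_abs_sub (g x) (g 1); linarith
    have h2 : |x - 1| ≤ 1 + x := by rw [abs_le]; constructor <;> linarith
    nlinarith [abs_nonneg (g 1)]
  -- The mean value theorem uses only interior points of [x, y], so the kink at 0 is harmless when x
  -- ≥ 0. Other signs reduce to this case because f is even.
  have key : ∀ x y B : ℝ, 0 ≤ x → x < y → y ≤ B →
      |Real.log (f x) - Real.log (f y)| ≤ (|g 1| + c) * (1 + B) * |x - y| := by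
    intro x y B hx hxy hy
    obtain ⟨t, ht, hts⟩ := exists_deriv_eq_slope (fun x => Real.log (f x)) hxy
      (Continuous.continuousOn (hf.continuous.log fun x => (hf.pos x).ne'))
      (fun t ht => ((hf.differentiableAt t (by linarith [ht.1])).log
        (hf.pos t).ne').differentiableWithinAt)
    have ht0 : 0 < t := by linarith [ht.1]
    rw [deriv.log (hf.differentiableAt t ht0.ne') (hf.pos t).ne', eq_div_iff (by linarith)] at hts
    rw [abs_sub_comm, ← hts, abs_mul, abs_sub_comm x y]
    gcongr
    refine (hgb t ht0).trans ?_
    gcongr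
    linarith [ht.2]
  refine ⟨|g 1| + c, by positivity, fun x y B hx hy => ?_⟩
  rw [← hf.apply_abs x, ← hf.apply_abs y]
  have hB : 0 ≤ B := (abs_nonneg x).trans hx
  refine le_trans ?_ (mul_le_mul_of_nonneg_left (abs_abs_sub_abs_le_abs_sub x y) (by positivity))
  rcases lt_trichotomy |x| |y| with h | h | h
  · exact key _ _ _ (abs_nonneg _) h hy
  · rw [h]; simp
  · rw [abs_sub_comm, abs_sub_comm |x|]; exact key _ _ _ (abs_nonneg _) h hx

lemma integrable_exp_neg_mul_abs {b : ℝ} (hb : 0 < b) :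
    Integrable fun x : ℝ => Real.exp (-(b * |x|)) := by
  have h1 : IntegrableOn (fun x : ℝ => Real.exp (-(b * |x|))) (Set.Ioi 0) :=
    (exp_neg_integrableOn_Ioi 0 hb).congr_fun
      (fun x hx => by simp [abs_of_pos (Set.mem_Ioi.1 hx)]) measurableSet_Ioi
  have h2 : IntegrableOn (fun x : ℝ => Real.exp (-(b * |x|))) (Set.Iic 0) := by
    rw [integrableOn_Iic_iff_integrableOn_Iio]
    have := h1.comp_neg
    simpa using this
  rw [← integrableOn_univ, ← Set.Iic_union_Ioi (a := (0 : ℝ))]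
  exact h2.union h1

lemma WellBehaved.integrable_noise_of_le (hf : WellBehaved f) {g : ℝ → ℝ} {K b : ℝ} (hb : b < 1)
    (hg : Measurable g) (h : ∀ x, |g x| ≤ K * Real.exp (b * |x|)) : Integrable g (noise f) := by
  obtain ⟨C, hC, hCf⟩ := hf.exists_le_exp
  rw [integrable_noise_iff hf]
  refine ((integrable_exp_neg_mul_abs (sub_pos.2 hb)).const_mul (C * K)).mono'
    (hf.measurable.mul hg).aestronglyMeasurable (ae_of_all _ fun x => ?_)
  rw [Real.norm_eq_abs, abs_mul, abs_of_pos (hf.pos x)]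
  calc f x * |g x| ≤ (C * Real.exp (-|x|)) * (K * Real.exp (b * |x|)) :=
        mul_le_mul (hCf x) (h x) (abs_nonneg _) (by positivity)
    _ = C * K * (Real.exp (-|x|) * Real.exp (b * |x|)) := by ring
    _ = _ := by rw [← Real.exp_add]; ring_nf

lemma integral_noise_neg (hf : WellBehaved f) (g : ℝ → ℝ) :
    ∫ x, g (-x) ∂(noise f) = ∫ x, g x ∂(noise f) := by
  rw [integral_noise hf, integral_noise hf, ← integral_neg_eq_self]
  simp [hf.symmetric]

lemma exp_le_one_add_add_sq (u : ℝ) : Real.exp u ≤ 1 + u + u ^ 2 * Real.exp |u| := by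
  have h := Complex.norm_exp_sub_sum_le_norm_mul_exp (u : ℂ) 2
  simp only [Finset.sum_range_succ, Finset.sum_range_zero, Complex.norm_real,
    Real.norm_eq_abs, sq_abs] at h
  norm_num at h
  rw [← Complex.ofReal_exp, ← Complex.ofReal_one, ← Complex.ofReal_add, ← Complex.ofReal_sub,
    Complex.norm_real, Real.norm_eq_abs] at h
  linarith [le_abs_self (Real.exp u - (1 + u))]

lemma sq_le_exp_quarter (x : ℝ) : x ^ 2 ≤ 32 * Real.exp (1 / 4 * |x|) := by
  have := Real.quadratic_le_exp_of_nonneg (x := 1 / 4 * |x|) (by positivity)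
  nlinarith [abs_nonneg x, sq_abs x]

/-- The moment generating function of the noise is subgaussian near the origin. -/
lemma WellBehaved.exists_mgf_le (hf : WellBehaved f) :
    ∃ C : ℝ, 0 < C ∧ ∀ l : ℝ, |l| ≤ 1 / 2 →
      Integrable (fun x => Real.exp (l * x)) (noise f) ∧
      ∫ x, Real.exp (l * x) ∂(noise f) ≤ Real.exp (C * l ^ 2) := by
  have := hf.isProbabilityMeasure
  have i2 : Integrable (fun x : ℝ => x ^ 2 * Real.exp (1 / 2 * |x|)) (noise f) := by
    refine hf.integrable_noise_of_le (K := 32) (b := 3 / 4) (by norm_num) (by fun_prop) fun x => ?_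
    rw [abs_of_nonneg (by positivity)]
    calc x ^ 2 * Real.exp (1 / 2 * |x|)
        ≤ 32 * Real.exp (1 / 4 * |x|) * Real.exp (1 / 2 * |x|) := by
          gcongr; exact sq_le_exp_quarter x
      _ = _ := by rw [mul_assoc, ← Real.exp_add]; ring_nf
  have i1 : Integrable (fun x : ℝ => x) (noise f) := by
    refine hf.integrable_noise_of_le (K := 2) (b := 1 / 2) (by norm_num) (by fun_prop) fun x => ?_
    linarith [Real.add_one_le_exp (1 / 2 * |x|)]
  -- Symmetry removes the linear term of the expansion, which leaves the quadratic exponent.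
  have m1 : ∫ x : ℝ, x ∂(noise f) = 0 := by
    have := integral_noise_neg hf fun x => x
    rw [integral_neg] at this
    linarith
  refine ⟨(∫ x : ℝ, x ^ 2 * Real.exp (1 / 2 * |x|) ∂(noise f)) + 1,
    add_pos_of_nonneg_of_pos (integral_nonneg fun x => by positivity) one_pos, fun l hl => ?_⟩
  have i0 : Integrable (fun x => Real.exp (l * x)) (noise f) := by
    refine hf.integrable_noise_of_le (K := 1) (b := 1 / 2) (by norm_num) (by fun_prop) fun x => ?_
    rw [Real.abs_exp, one_mul]
    refine Real.exp_le_exp.2 ((le_abs_self _).trans ?_)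
    rw [abs_mul]; gcongr
  refine ⟨i0, ?_⟩
  have j1 : Integrable (fun x : ℝ => 1 + l * x) (noise f) :=
    (integrable_const _).add (i1.const_mul _)
  calc ∫ x, Real.exp (l * x) ∂(noise f)
      ≤ ∫ x, ((1 + l * x) + l ^ 2 * (x ^ 2 * Real.exp (1 / 2 * |x|))) ∂(noise f) := by
        refine integral_mono i0 (j1.add (i2.const_mul _)) fun x => ?_
        refine (exp_le_one_add_add_sq _).trans ?_
        have : Real.exp |l * x| ≤ Real.exp (1 / 2 * |x|) := by
          rw [abs_mul]; gcongr
        have h2 := mul_le_mul_of_nonneg_left this (sq_nonneg (l * x))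
        nlinarith
    _ = 1 + l ^ 2 * ∫ x : ℝ, x ^ 2 * Real.exp (1 / 2 * |x|) ∂(noise f) := by
        rw [integral_add j1 (i2.const_mul _), integral_add (integrable_const _) (i1.const_mul _), integral_const_mul,
          integral_const_mul, m1]
        simp
    _ ≤ Real.exp (((∫ x : ℝ, x ^ 2 * Real.exp (1 / 2 * |x|) ∂(noise f)) + 1) * l ^ 2) := by
        refine le_trans ?_ (Real.add_one_le_exp _)
        nlinarith [sq_nonneg l]

end Density

/-! ### The sender's posterior: integrability, measurability, translation. -/

section Posterior

variable {f : ℝ → ℝ} {S : SideInfo} {n : ℕ}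

/-- The likelihood of the state `θ` given the anecdotes `x`. -/
def likelihood (f : ℝ → ℝ) {n : ℕ} (x : Fin n → ℝ) (θ : ℝ) : ℝ := ∏ i, f (x i - θ)

/-- The sender's posterior distribution. -/
def posterior (f : ℝ → ℝ) (S : SideInfo) {n : ℕ} (x : Fin n → ℝ) (y : ℝ) : Measure ℝ :=
  (∫⁻ θ, ENNReal.ofReal (likelihood f x θ) ∂(S.belief y))⁻¹ •
    (S.belief y).withDensity fun θ => ENNReal.ofReal (likelihood f x θ)

/-- The base measure of the side information. -/
def SideInfo.base : SideInfo → Measure ℝ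
  | signal G => G
  | diffuse => volume

lemma SideInfo.belief_eq (S : SideInfo) (y : ℝ) : S.belief y = S.base.map fun γ => y - γ := by
  cases S with
  | signal G => rfl
  | diffuse => exact (Measure.measurePreserving_sub_left volume y).map_eq.symm

lemma SideInfo.IsProper.sfinite_base (hS : S.IsProper) : SFinite S.base := by
  cases S with
  | signal G => have : IsProbabilityMeasure G := hS; exact inferInstanceAs (SFinite G)
  | diffuse => exact inferInstanceAs (SFinite (volume : Measure ℝ))

lemma SideInfo.IsProper.belief_ne_zero (hS : S.IsProper) (y : ℝ) : S.belief y ≠ 0 := by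
  cases S with
  | signal G =>
    have : IsProbabilityMeasure G := hS
    have : IsProbabilityMeasure (G.map fun γ => y - γ) :=
      Measure.isProbabilityMeasure_map (by fun_prop)
    exact IsProbabilityMeasure.ne_zero (G.map fun γ => y - γ)
  | diffuse => exact NeZero.ne (volume : Measure ℝ)

lemma SideInfo.IsProper.isProbabilityMeasure_law (hS : S.IsProper) (θ : ℝ) :
    IsProbabilityMeasure (S.law θ) := by
  cases S with
  | signal G =>
    have : IsProbabilityMeasure G := hS
    exact Measure.isProbabilityMeasure_map (by fun_prop)
  | diffuse => exact inferInstanceAs (IsProbabilityMeasure (Measure.dirac (0 : ℝ)))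

lemma likelihood_pos (hf : WellBehaved f) (x : Fin n → ℝ) (θ : ℝ) : 0 < likelihood f x θ :=
  Finset.prod_pos fun _ _ => hf.pos _

lemma measurable_likelihood (hf : WellBehaved f) :
    Measurable fun p : (Fin n → ℝ) × ℝ => likelihood f p.1 p.2 := by
  have := hf.measurable
  unfold likelihood
  fun_prop

lemma continuous_likelihood (hf : WellBehaved f) (x : Fin n → ℝ) : Continuous (likelihood f x) := by
  have := hf.continuous
  unfold likelihood
  fun_prop

lemma likelihood_add (x : Fin n → ℝ) (δ θ : ℝ) :
    likelihood f (fun i => x i + δ) (θ + δ) = likelihood f x θ := by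
  simp [likelihood]

/-- One factor supplies the exponential decay and the others are at most f 0. Thus a single anecdote
already makes the posterior proper and gives it exponential moments of every order below one,
whatever the side information. -/
lemma exists_likelihood_le (hf : WellBehaved f) (hn : 1 ≤ n) (x : Fin n → ℝ) :
    ∃ C : ℝ, 0 < C ∧ ∀ θ, likelihood f x θ ≤ C * Real.exp (-|θ|) := by
  obtain ⟨C, hC, hCf⟩ := hf.exists_le_exp
  have h0 := hf.pos 0
  let i₀ : Fin n := ⟨0, hn⟩
  refine ⟨C * Real.exp |x i₀| * f 0 ^ (n - 1), by positivity, fun θ => ?_⟩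
  rw [likelihood, ← Finset.mul_prod_erase _ _ (Finset.mem_univ i₀)]
  have h1 : f (x i₀ - θ) ≤ C * Real.exp |x i₀| * Real.exp (-|θ|) := by
    refine (hCf _).trans ?_
    rw [mul_assoc, ← Real.exp_add]
    gcongr
    have := abs_sub_abs_le_abs_sub θ (x i₀)
    rw [abs_sub_comm] at this; linarith
  have h2 : ∏ i ∈ Finset.univ.erase i₀, f (x i - θ) ≤ f 0 ^ (n - 1) := by
    refine (Finset.prod_le_prod (fun i _ => (hf.pos _).le) fun i _ => hf.le_zero _).trans
      (le_of_eq ?_)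
    simp
  calc _ ≤ (C * Real.exp |x i₀| * Real.exp (-|θ|)) * f 0 ^ (n - 1) :=
        mul_le_mul h1 h2 (Finset.prod_nonneg fun i _ => (hf.pos _).le) (by positivity)
    _ = _ := by ring

lemma SideInfo.IsProper.integrable_belief_of_le (hS : S.IsProper) (y : ℝ) {g : ℝ → ℝ} {K b : ℝ}
    (hb : 0 < b) (hg : Measurable g) (h : ∀ x, |g x| ≤ K * Real.exp (-(b * |x|))) :
    Integrable g (S.belief y) := by
  have hK : 0 ≤ K := by simpa using (abs_nonneg _).trans (h 0)
  cases S with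
  | signal G =>
    have : IsProbabilityMeasure G := hS
    have : IsProbabilityMeasure (G.map fun γ => y - γ) :=
      Measure.isProbabilityMeasure_map (by fun_prop)
    refine (integrable_const (μ := G.map fun γ => y - γ) K).mono' hg.aestronglyMeasurable
      (ae_of_all _ fun x => (h x).trans ?_)
    have : Real.exp (-(b * |x|)) ≤ 1 := Real.exp_le_one_iff.2 (by simp; positivity)
    nlinarith
  | diffuse =>
    exact ((integrable_exp_neg_mul_abs hb).const_mul K).mono' hg.aestronglyMeasurable
      (ae_of_all _ h)

lemma integrable_mul_likelihood (hf : WellBehaved f) (hS : S.IsProper) (hn : 1 ≤ n)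
    (x : Fin n → ℝ) (y : ℝ) {g : ℝ → ℝ} {K b : ℝ} (hb : b < 1) (hg : Measurable g)
    (h : ∀ θ, |g θ| ≤ K * Real.exp (b * |θ|)) :
    Integrable (fun θ => g θ * likelihood f x θ) (S.belief y) := by
  obtain ⟨C, hC, hle⟩ := exists_likelihood_le hf hn x
  refine hS.integrable_belief_of_le y (K := K * C) (sub_pos.2 hb)
    (hg.mul (continuous_likelihood hf x).measurable) fun θ => ?_
  rw [abs_mul, abs_of_pos (likelihood_pos hf x θ)]
  calc _ ≤ (K * Real.exp (b * |θ|)) * (C * Real.exp (-|θ|)) :=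
        mul_le_mul (h θ) (hle θ) (likelihood_pos hf x θ).le ((abs_nonneg _).trans (h θ))
    _ = K * C * (Real.exp (b * |θ|) * Real.exp (-|θ|)) := by ring
    _ = _ := by rw [← Real.exp_add]; ring_nf

lemma lintegral_likelihood_ne_zero (hf : WellBehaved f) (hS : S.IsProper) (x : Fin n → ℝ) (y : ℝ) :
    ∫⁻ θ, ENNReal.ofReal (likelihood f x θ) ∂(S.belief y) ≠ 0 := by
  rw [Ne, lintegral_eq_zero_iff (continuous_likelihood hf x).measurable.ennreal_ofReal]
  intro h
  have : NeZero (S.belief y) := ⟨hS.belief_ne_zero y⟩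
  obtain ⟨θ, hθ⟩ := h.exists
  simp only [Pi.zero_apply, ENNReal.ofReal_eq_zero] at hθ
  exact absurd (likelihood_pos hf x θ) (not_lt.2 hθ)

lemma lintegral_likelihood_ne_top (hf : WellBehaved f) (hS : S.IsProper) (hn : 1 ≤ n)
    (x : Fin n → ℝ) (y : ℝ) :
    ∫⁻ θ, ENNReal.ofReal (likelihood f x θ) ∂(S.belief y) ≠ ⊤ := by
  have := integrable_mul_likelihood hf hS hn x y (g := fun _ => 1) (K := 1) (b := 0) (by norm_num)
    (by fun_prop) (by simp)
  simp only [one_mul] at this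
  exact ((hasFiniteIntegral_iff_ofReal
    (ae_of_all _ fun θ => (likelihood_pos hf x θ).le)).1 this.2).ne

lemma isProbabilityMeasure_posterior (hf : WellBehaved f) (hS : S.IsProper) (hn : 1 ≤ n)
    (x : Fin n → ℝ) (y : ℝ) : IsProbabilityMeasure (posterior f S x y) := by
  constructor
  rw [posterior, Measure.smul_apply, withDensity_apply _ MeasurableSet.univ, Measure.restrict_univ,
    smul_eq_mul]
  exact ENNReal.inv_mul_cancel (lintegral_likelihood_ne_zero hf hS x y)
    (lintegral_likelihood_ne_top hf hS hn x y)

lemma lintegral_posterior (hf : WellBehaved f) (x : Fin n → ℝ) (y : ℝ) {g : ℝ → ENNReal}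
    (hg : Measurable g) :
    ∫⁻ θ, g θ ∂(posterior f S x y) =
      (∫⁻ θ, ENNReal.ofReal (likelihood f x θ) ∂(S.belief y))⁻¹ *
        ∫⁻ θ, ENNReal.ofReal (likelihood f x θ) * g θ ∂(S.belief y) := by
  rw [posterior, lintegral_smul_measure, lintegral_withDensity_eq_lintegral_mul _
    (continuous_likelihood hf x).measurable.ennreal_ofReal hg]
  rfl

lemma integral_likelihood_pos (hf : WellBehaved f) (hS : S.IsProper) (hn : 1 ≤ n)
    (x : Fin n → ℝ) (y : ℝ) : 0 < ∫ θ, likelihood f x θ ∂(S.belief y) := by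
  rw [integral_eq_lintegral_of_nonneg_ae (ae_of_all _ fun θ => (likelihood_pos hf x θ).le)
    (continuous_likelihood hf x).aestronglyMeasurable]
  exact ENNReal.toReal_pos (lintegral_likelihood_ne_zero hf hS x y)
    (lintegral_likelihood_ne_top hf hS hn x y)

lemma integral_posterior (hf : WellBehaved f) (x : Fin n → ℝ) (y : ℝ) (g : ℝ → ℝ) :
    ∫ θ, g θ ∂(posterior f S x y) =
      (∫ θ, g θ * likelihood f x θ ∂(S.belief y)) / ∫ θ, likelihood f x θ ∂(S.belief y) := by
  rw [posterior, integral_smul_measure, integral_withDensity_eq_integral_toReal_smul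
    (continuous_likelihood hf x).measurable.ennreal_ofReal
    (ae_of_all _ fun _ => ENNReal.ofReal_lt_top), ENNReal.toReal_inv,
    ← integral_eq_lintegral_of_nonneg_ae (ae_of_all _ fun θ => (likelihood_pos hf x θ).le)
    (continuous_likelihood hf x).aestronglyMeasurable, smul_eq_mul, div_eq_inv_mul]
  simp [ENNReal.toReal_ofReal (likelihood_pos hf x _).le, mul_comm]

lemma integrable_posterior_iff (hf : WellBehaved f) (hS : S.IsProper) (hn : 1 ≤ n)
    (x : Fin n → ℝ) (y : ℝ) (g : ℝ → ℝ) :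
    Integrable g (posterior f S x y) ↔
      Integrable (fun θ => g θ * likelihood f x θ) (S.belief y) := by
  rw [posterior, integrable_smul_measure
    (ENNReal.inv_ne_zero.2 (lintegral_likelihood_ne_top hf hS hn x y))
    (ENNReal.inv_ne_top.2 (lintegral_likelihood_ne_zero hf hS x y)),
    integrable_withDensity_iff_integrable_smul'
    (continuous_likelihood hf x).measurable.ennreal_ofReal
    (ae_of_all _ fun _ => ENNReal.ofReal_lt_top)]
  simp [ENNReal.toReal_ofReal (likelihood_pos hf x _).le, mul_comm]

lemma integrable_posterior_of_le (hf : WellBehaved f) (hS : S.IsProper) (hn : 1 ≤ n)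
    (x : Fin n → ℝ) (y : ℝ) {g : ℝ → ℝ} {K b : ℝ} (hb : b < 1) (hg : Measurable g)
    (h : ∀ θ, |g θ| ≤ K * Real.exp (b * |θ|)) : Integrable g (posterior f S x y) :=
  (integrable_posterior_iff hf hS hn x y g).2 (integrable_mul_likelihood hf hS hn x y hb hg h)

lemma posteriorMean_eq (hf : WellBehaved f) (x : Fin n → ℝ) (y : ℝ) :
    posteriorMean f S x y = ∫ θ, θ ∂(posterior f S x y) :=
  (integral_posterior hf x y fun θ => θ).symm

lemma integrable_id_posterior (hf : WellBehaved f) (hS : S.IsProper) (hn : 1 ≤ n)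
    (x : Fin n → ℝ) (y : ℝ) : Integrable (fun θ => θ) (posterior f S x y) :=
  integrable_posterior_of_le hf hS hn x y (K := 2) (b := 1 / 2) (by norm_num) (by fun_prop)
    fun θ => by linarith [Real.add_one_le_exp (1 / 2 * |θ|)]

lemma integrable_sq_posterior (hf : WellBehaved f) (hS : S.IsProper) (hn : 1 ≤ n)
    (x : Fin n → ℝ) (y : ℝ) : Integrable (fun θ => θ ^ 2) (posterior f S x y) :=
  integrable_posterior_of_le hf hS hn x y (K := 32) (b := 1 / 4) (by norm_num) (by fun_prop)
    fun θ => by rw [abs_of_nonneg (sq_nonneg θ)]; exact sq_le_exp_quarter θ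

/-- Bias-variance decomposition under the posterior. -/
lemma lintegral_sq_sub_posterior (hf : WellBehaved f) (hS : S.IsProper) (hn : 1 ≤ n)
    (x : Fin n → ℝ) (y k : ℝ) :
    ∫⁻ θ, ENNReal.ofReal ((k - θ) ^ 2) ∂(posterior f S x y) =
      ENNReal.ofReal ((k - posteriorMean f S x y) ^ 2) +
        ∫⁻ θ, ENNReal.ofReal ((posteriorMean f S x y - θ) ^ 2) ∂(posterior f S x y) := by
  have := isProbabilityMeasure_posterior hf hS hn x y
  have i1 := integrable_id_posterior hf hS hn x y
  have i2 := integrable_sq_posterior hf hS hn x y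
  have hint : ∀ k : ℝ, Integrable (fun θ => (k - θ) ^ 2) (posterior f S x y) := fun k => by
    have : (fun θ : ℝ => (k - θ) ^ 2) = fun θ => k ^ 2 - 2 * k * θ + θ ^ 2 := by ext θ; ring
    rw [this]
    exact ((integrable_const _).sub (i1.const_mul _)).add i2
  have hval : ∀ k : ℝ, ∫ θ, (k - θ) ^ 2 ∂(posterior f S x y) =
      k ^ 2 - 2 * k * posteriorMean f S x y + ∫ θ, θ ^ 2 ∂(posterior f S x y) := fun k => by
    have : (fun θ : ℝ => (k - θ) ^ 2) = fun θ => k ^ 2 - 2 * k * θ + θ ^ 2 := by ext θ; ring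
    have i3 : Integrable (fun θ : ℝ => k ^ 2 - 2 * k * θ) (posterior f S x y) :=
      (integrable_const _).sub (i1.const_mul _)
    rw [this, integral_add i3 i2, integral_sub (integrable_const _) (i1.const_mul _),
      integral_const_mul, ← posteriorMean_eq hf]
    simp
  rw [← ofReal_integral_eq_lintegral_ofReal (hint k) (ae_of_all _ fun θ => sq_nonneg _),
    ← ofReal_integral_eq_lintegral_ofReal (hint _) (ae_of_all _ fun θ => sq_nonneg _),
    ← ENNReal.ofReal_add (sq_nonneg _) (integral_nonneg fun θ => sq_nonneg _), hval, hval]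
  ring_nf

lemma SideInfo.belief_add (S : SideInfo) (y δ : ℝ) :
    S.belief (y + δ) = (S.belief y).map fun θ => θ + δ := by
  rw [S.belief_eq, S.belief_eq, Measure.map_map (by fun_prop) (by fun_prop)]
  congr 1; ext γ; simp; ring

lemma posteriorMean_add (hf : WellBehaved f) (hS : S.IsProper) (hn : 1 ≤ n)
    (x : Fin n → ℝ) (y δ : ℝ) :
    posteriorMean f S (fun i => x i + δ) (y + δ) = posteriorMean f S x y + δ := by
  have he : MeasurableEmbedding fun θ : ℝ => θ + δ := measurableEmbedding_addRight δ
  have h1 := integrable_mul_likelihood hf hS hn x y (g := fun θ => θ) (K := 2) (b := 1 / 2)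
    (by norm_num) (by fun_prop) fun θ => by linarith [Real.add_one_le_exp (1 / 2 * |θ|)]
  have h2 := integrable_mul_likelihood hf hS hn x y (g := fun θ => 1) (K := 1) (b := 0)
    (by norm_num) (by fun_prop) (by simp)
  simp only [one_mul] at h2
  have h3 := (integral_likelihood_pos hf hS hn x y).ne'
  change (∫ θ, θ * likelihood f _ θ ∂_) / (∫ θ, likelihood f _ θ ∂_) =
    (∫ θ, θ * likelihood f _ θ ∂_) / (∫ θ, likelihood f _ θ ∂_) + δ
  rw [S.belief_add, he.integral_map, he.integral_map]
  simp only [likelihood_add, add_mul]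
  rw [integral_add h1 (h2.const_mul δ), integral_const_mul]
  field_simp

lemma posteriorMean_diffuse (f : ℝ → ℝ) (x : Fin n → ℝ) (y y' : ℝ) :
    posteriorMean f .diffuse x y = posteriorMean f .diffuse x y' := rfl

/-- Writing the belief as the image of a fixed base measure moves the dependence on y into the
integrand, where Fubini-type measurability applies. -/
lemma measurable_lintegral_belief (hS : S.IsProper) {g : ((Fin n → ℝ) × ℝ) → ℝ → ENNReal}
    (hg : Measurable (Function.uncurry g)) :
    Measurable fun ω : (Fin n → ℝ) × ℝ => ∫⁻ θ, g ω θ ∂(S.belief ω.2) := by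
  have := hS.sfinite_base
  have h : ∀ ω : (Fin n → ℝ) × ℝ, ∫⁻ θ, g ω θ ∂(S.belief ω.2) = ∫⁻ γ, g ω (ω.2 - γ) ∂S.base := by
    intro ω
    have h1 : Measurable (g ω) := hg.comp measurable_prodMk_left
    rw [S.belief_eq, lintegral_map h1 (by fun_prop)]
  simp_rw [h]
  refine Measurable.lintegral_prod_right' (f := fun p : ((Fin n → ℝ) × ℝ) × ℝ =>
    g p.1 (p.1.2 - p.2)) ?_
  exact hg.comp (f := fun p : ((Fin n → ℝ) × ℝ) × ℝ => (p.1, p.1.2 - p.2)) (by fun_prop)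

lemma measurable_lintegral_posterior (hf : WellBehaved f) (hS : S.IsProper)
    {g : ((Fin n → ℝ) × ℝ) → ℝ → ENNReal} (hg : Measurable (Function.uncurry g)) :
    Measurable fun ω : (Fin n → ℝ) × ℝ => ∫⁻ θ, g ω θ ∂(posterior f S ω.1 ω.2) := by
  have hl := (measurable_likelihood (n := n) hf).ennreal_ofReal
  have hl' : Measurable fun p : ((Fin n → ℝ) × ℝ) × ℝ =>
    ENNReal.ofReal (likelihood f p.1.1 p.2) :=
    hl.comp (f := fun p : ((Fin n → ℝ) × ℝ) × ℝ => (p.1.1, p.2)) (by fun_prop)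
  have h : ∀ ω : (Fin n → ℝ) × ℝ, ∫⁻ θ, g ω θ ∂(posterior f S ω.1 ω.2) = _ := fun ω =>
    lintegral_posterior hf ω.1 ω.2 (g := g ω) (hg.comp measurable_prodMk_left)
  simp_rw [h]
  exact (measurable_lintegral_belief hS (g := fun ω θ => ENNReal.ofReal (likelihood f ω.1 θ))
    hl').inv.mul (measurable_lintegral_belief hS
      (g := fun ω θ => ENNReal.ofReal (likelihood f ω.1 θ) * g ω θ) (hl'.mul hg))

lemma measurable_posteriorMean (hf : WellBehaved f) (hS : S.IsProper) :
    Measurable fun ω : (Fin n → ℝ) × ℝ => posteriorMean f S ω.1 ω.2 := by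
  have := hS.sfinite_base
  have h : ∀ {g : ℝ → ℝ}, Measurable g → Measurable fun ω : (Fin n → ℝ) × ℝ =>
      ∫ θ, g θ * likelihood f ω.1 θ ∂(S.belief ω.2) := by
    intro g hg
    have h1 : ∀ ω : (Fin n → ℝ) × ℝ, ∫ θ, g θ * likelihood f ω.1 θ ∂(S.belief ω.2) =
        ∫ γ, g (ω.2 - γ) * likelihood f ω.1 (ω.2 - γ) ∂S.base := by
      intro ω
      rw [S.belief_eq, integral_map (by fun_prop)]
      exact (hg.mul (continuous_likelihood hf ω.1).measurable).aestronglyMeasurable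
    simp_rw [h1]
    refine (StronglyMeasurable.integral_prod_right' (f := fun p : ((Fin n → ℝ) × ℝ) × ℝ =>
      g (p.1.2 - p.2) * likelihood f p.1.1 (p.1.2 - p.2)) ?_).measurable
    refine Measurable.stronglyMeasurable ((hg.comp (by fun_prop)).mul ?_)
    exact (measurable_likelihood hf).comp
      (f := fun p : ((Fin n → ℝ) × ℝ) × ℝ => (p.1.1, p.1.2 - p.2)) (by fun_prop)
  have h2 := (h measurable_id).div (h (g := fun _ => 1) measurable_const)
  simp only [one_mul] at h2
  exact h2

end Posterior

/-! ### Exchanging the true state with a posterior draw. -/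

section Invariance

variable {f : ℝ → ℝ} {S : SideInfo} {n : ℕ}

/-- The law of the data in state `0`. -/
def zeroLaw (f : ℝ → ℝ) (S : SideInfo) (n : ℕ) : Measure ((Fin n → ℝ) × ℝ) :=
  (Measure.pi fun _ : Fin n => noise f).prod (S.law 0)

/-- The effect of a change of the state on the side information. -/
def SideInfo.shift : SideInfo → ℝ → ℝ → ℝ
  | signal _, θ, y => y + θ
  | diffuse, _, y => y

lemma SideInfo.measurable_shift (S : SideInfo) (θ : ℝ) : Measurable (S.shift θ) := by
  cases S with
  | signal G => exact measurable_id.add_const θ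
  | diffuse => exact measurable_id

lemma SideInfo.law_eq_map (S : SideInfo) (θ : ℝ) : S.law θ = (S.law 0).map (S.shift θ) := by
  cases S with
  | signal G =>
    change G.map _ = (G.map _).map (fun y => y + θ)
    rw [Measure.map_map (by fun_prop) (by fun_prop)]
    congr 1; ext γ; simp [add_comm]
  | diffuse =>
    change Measure.dirac 0 = (Measure.dirac 0).map id
    simp

/-- The data in state `θ` as a function of the data in state `0`. -/
def dataShift (S : SideInfo) {n : ℕ} (θ : ℝ) (ω : (Fin n → ℝ) × ℝ) : (Fin n → ℝ) × ℝ :=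
  (fun i => ω.1 i + θ, S.shift θ ω.2)

lemma measurable_dataShift (S : SideInfo) (θ : ℝ) : Measurable (dataShift S (n := n) θ) := by
  have := S.measurable_shift θ
  unfold dataShift
  fun_prop

lemma SideInfo.IsProper.isProbabilityMeasure_zeroLaw (hf : WellBehaved f) (hS : S.IsProper) :
    IsProbabilityMeasure (zeroLaw f S n) := by
  have := hf.isProbabilityMeasure
  have := hS.isProbabilityMeasure_law 0
  unfold zeroLaw; infer_instance

lemma dataLaw_eq_map (hf : WellBehaved f) (hS : S.IsProper) (θ : ℝ) :
    dataLaw f S n θ = (zeroLaw f S n).map (dataShift S θ) := by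
  have := hf.isProbabilityMeasure
  have := hS.isProbabilityMeasure_law 0
  have h1 : (Measure.pi fun _ : Fin n => (noise f).map fun ε => θ + ε) =
      (Measure.pi fun _ : Fin n => noise f).map fun x i => x i + θ := by
    have : IsProbabilityMeasure ((noise f).map fun ε => θ + ε) :=
      Measure.isProbabilityMeasure_map (by fun_prop)
    rw [← Measure.pi_map_pi (f := fun _ ε => θ + ε) fun _ => by fun_prop]
    simp_rw [add_comm θ]
  rw [dataLaw, h1, S.law_eq_map, Measure.map_prod_map _ _ (by fun_prop) (S.measurable_shift θ)]
  rfl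

/-- The sample is given a Lebesgue density so that translations of the whole sample can be carried
out as changes of variables. -/
lemma pi_noise (hf : WellBehaved f) :
    (Measure.pi fun _ : Fin n => noise f) =
      (volume : Measure (Fin n → ℝ)).withDensity fun x => ENNReal.ofReal (likelihood f x 0) := by
  have := hf.isProbabilityMeasure
  refine Measure.pi_eq fun s hs => ?_
  have hint : ∀ i, Integrable ((s i).indicator f) := fun i => hf.integrable.indicator (hs i)
  have hnn : ∀ i x, 0 ≤ (s i).indicator f x := fun i x =>
    Set.indicator_nonneg (fun x _ => (hf.pos x).le) x
  have h1 : ∀ x : Fin n → ℝ, (Set.univ.pi s).indicator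
      (fun x => ENNReal.ofReal (likelihood f x 0)) x =
      ENNReal.ofReal (∏ i, (s i).indicator f (x i)) := by
    intro x
    by_cases hx : x ∈ Set.univ.pi s
    · rw [Set.indicator_of_mem hx]
      congr 1
      refine Finset.prod_congr rfl fun i _ => ?_
      rw [Set.indicator_of_mem (hx i (Set.mem_univ i)), sub_zero]
    · rw [Set.indicator_of_notMem hx]
      simp only [Set.mem_pi, Set.mem_univ, true_implies, not_forall] at hx
      obtain ⟨i, hi⟩ := hx
      rw [Finset.prod_eq_zero (Finset.mem_univ i) (Set.indicator_of_notMem hi f)]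
      simp
  rw [withDensity_apply _ (MeasurableSet.univ_pi hs), ← lintegral_indicator (.univ_pi hs)]
  simp_rw [h1]
  rw [volume_pi, ← ofReal_integral_eq_lintegral_ofReal
    (Integrable.fintype_prod (f := fun i => (s i).indicator f) hint)
    (ae_of_all _ fun x => Finset.prod_nonneg fun i _ => hnn i _),
    integral_fintype_prod_eq_prod (fun i => (s i).indicator f),
    ENNReal.ofReal_prod_of_nonneg fun i _ => integral_nonneg (hnn i)]
  refine Finset.prod_congr rfl fun i _ => ?_
  rw [noise, withDensity_apply _ (hs i), ← lintegral_indicator (hs i),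
    ofReal_integral_eq_lintegral_ofReal (hint i) (ae_of_all _ (hnn i))]
  congr 1; ext x
  by_cases hx : x ∈ s i <;> simp [hx]

lemma lintegral_zeroLaw (hf : WellBehaved f) (hS : S.IsProper)
    {g : (Fin n → ℝ) × ℝ → ENNReal} (hg : Measurable g) :
    ∫⁻ ω, g ω ∂(zeroLaw f S n) =
      ∫⁻ y, (∫⁻ x : Fin n → ℝ, ENNReal.ofReal (likelihood f x 0) * g (x, y)) ∂(S.law 0) := by
  have := hf.isProbabilityMeasure
  have := hS.isProbabilityMeasure_law 0
  have hl : Measurable fun x : Fin n → ℝ => ENNReal.ofReal (likelihood f x 0) :=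
    ((measurable_likelihood hf).comp (f := fun x : Fin n → ℝ => (x, (0 : ℝ)))
      (by fun_prop)).ennreal_ofReal
  rw [zeroLaw, lintegral_prod_symm _ hg.aemeasurable]
  refine lintegral_congr fun y => ?_
  have hg' : Measurable fun x => g (x, y) := hg.comp measurable_prodMk_right
  rw [pi_noise hf, lintegral_withDensity_eq_lintegral_mul _ hl hg']
  rfl

/-- Under the diffuse prior the true state and a draw from the posterior have the same joint law
with the data, up to translation. -/
theorem lintegral_posterior_zeroLaw (hf : WellBehaved f) (hS : S.IsProper) (hn : 1 ≤ n)
    {h : (Fin n → ℝ) → ℝ → ℝ → ENNReal}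
    (hm : Measurable fun p : ((Fin n → ℝ) × ℝ) × ℝ => h p.1.1 p.1.2 p.2)
    (hinv : ∀ x y t δ, h (fun i => x i + δ) (y + δ) (t + δ) = h x y t)
    (hd : S = .diffuse → ∀ x y y' t, h x y t = h x y' t) :
    ∫⁻ ω, ∫⁻ t, h ω.1 ω.2 t ∂(posterior f S ω.1 ω.2) ∂(zeroLaw f S n) =
      ∫⁻ ω, h ω.1 ω.2 0 ∂(zeroLaw f S n) := by
  have hmeas := measurable_lintegral_posterior (g := fun ω t => h ω.1 ω.2 t) hf hS hm
  have hm0 : Measurable fun ω : (Fin n → ℝ) × ℝ => h ω.1 ω.2 0 :=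
    hm.comp (f := fun ω : (Fin n → ℝ) × ℝ => (ω, (0 : ℝ))) (by fun_prop)
  rw [lintegral_zeroLaw hf hS hmeas, lintegral_zeroLaw hf hS hm0]
  set w : (Fin n → ℝ) → ℝ → ENNReal := fun x t => ENNReal.ofReal (likelihood f x t) with hw
  set Z : (Fin n → ℝ) → ℝ → ENNReal := fun x y => ∫⁻ t, w x t ∂(S.belief y) with hZ
  have mw : Measurable fun p : (Fin n → ℝ) × ℝ => w p.1 p.2 :=
    (measurable_likelihood hf).ennreal_ofReal
  have mZ : Measurable fun p : (Fin n → ℝ) × ℝ => Z p.1 p.2 :=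
    measurable_lintegral_belief hS (g := fun ω t => w ω.1 t)
      (mw.comp (f := fun p : ((Fin n → ℝ) × ℝ) × ℝ => (p.1.1, p.2)) (by fun_prop))
  have hwadd : ∀ x t δ, w (fun i => x i + δ) (t + δ) = w x t := fun x t δ => by
    simp only [hw, likelihood_add]
  have hwadd0 : ∀ x t, w (fun i => x i + t) 0 = w x (-t) := fun x t => by
    rw [← hwadd x (-t) t]; simp
  have hZ0 : ∀ x y, Z x y ≠ 0 := fun x y => lintegral_likelihood_ne_zero hf hS x y
  have hZt : ∀ x y, Z x y ≠ ⊤ := fun x y => lintegral_likelihood_ne_top hf hS hn x y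
  have hmx : ∀ x y, Measurable (h x y) := fun x y =>
    hm.comp (f := fun t : ℝ => ((x, y), t)) (by fun_prop)
  have hmw : ∀ x, Measurable (w x) := fun x => mw.comp measurable_prodMk_left
  simp_rw [fun x y => lintegral_posterior hf (S := S) x y (hmx x y)]
  change ∫⁻ y, (∫⁻ x, w x 0 * ((Z x y)⁻¹ * ∫⁻ t, w x t * h x y t ∂(S.belief y))) ∂(S.law 0) =
    ∫⁻ y, (∫⁻ x, w x 0 * h x y 0) ∂(S.law 0)
  cases S with
  | signal G =>
    have : IsProbabilityMeasure G := hS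
    have hlaw : (SideInfo.signal G).law 0 = G := by simp [SideInfo.law]
    have hbel : ∀ {g : ℝ → ENNReal}, Measurable g → ∀ y,
        ∫⁻ t, g t ∂((SideInfo.signal G).belief y) = ∫⁻ γ, g (y - γ) ∂G := fun hg y => by
      rw [SideInfo.belief, lintegral_map hg (by fun_prop)]
    have hZadd : ∀ x γ y, Z (fun i => x i + (y - γ)) y = Z x γ := fun x γ y => by
      simp only [hZ]
      rw [hbel (hmw _), hbel (hmw _)]
      refine lintegral_congr fun γ' => ?_
      rw [← hwadd x (γ - γ') (y - γ)]
      congr 1; ring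
    rw [hlaw]
    -- The joint integrand before and after the translation by `y - γ`.
    have step1 : ∀ y, ∫⁻ x, w x 0 * ((Z x y)⁻¹ * ∫⁻ t, w x t * h x y t
        ∂((SideInfo.signal G).belief y)) =
        ∫⁻ γ, (∫⁻ x, w x (γ - y) * ((Z x γ)⁻¹ * (w x 0 * h x γ 0))) ∂G := by
      intro y
      have m1 : Measurable fun p : (Fin n → ℝ) × ℝ =>
          w p.1 0 * ((Z p.1 y)⁻¹ * (w p.1 (y - p.2) * h p.1 y (y - p.2))) := by
        refine (mw.comp (f := fun p : (Fin n → ℝ) × ℝ => (p.1, (0 : ℝ))) (by fun_prop)).mul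
          ((mZ.comp (f := fun p : (Fin n → ℝ) × ℝ => (p.1, y)) (by fun_prop)).inv.mul
          ((mw.comp (f := fun p : (Fin n → ℝ) × ℝ => (p.1, y - p.2)) (by fun_prop)).mul
          (hm.comp (f := fun p : (Fin n → ℝ) × ℝ => ((p.1, y), y - p.2)) (by fun_prop))))
      calc _ = ∫⁻ x, ∫⁻ γ, w x 0 * ((Z x y)⁻¹ * (w x (y - γ) * h x y (y - γ))) ∂G := by
            refine lintegral_congr fun x => ?_
            have m2 : Measurable fun γ => w x (y - γ) * h x y (y - γ) :=
              ((hmw x).comp (by fun_prop)).mul ((hmx x y).comp (by fun_prop))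
            have m5 : Measurable fun t => w x t * h x y t := (hmw x).mul (hmx x y)
            rw [hbel m5, lintegral_const_mul _ (m2.const_mul _),
              lintegral_const_mul _ m2]
        _ = ∫⁻ γ, (∫⁻ x, w x 0 * ((Z x y)⁻¹ * (w x (y - γ) * h x y (y - γ)))) ∂G :=
            lintegral_lintegral_swap m1.aemeasurable
        _ = _ := by
            refine lintegral_congr fun γ => ?_
            rw [← lintegral_add_right_eq_self _ (fun _ => y - γ)]
            refine lintegral_congr fun x => ?_
            change w (fun i => x i + (y - γ)) 0 * ((Z (fun i => x i + (y - γ)) y)⁻¹ *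
              (w (fun i => x i + (y - γ)) (y - γ) * h (fun i => x i + (y - γ)) y (y - γ))) = _
            have e1 := hwadd x 0 (y - γ)
            have e2 := hinv x γ 0 (y - γ)
            rw [zero_add] at e1 e2
            rw [add_sub_cancel] at e2
            rw [hwadd0, hZadd, e1, e2, neg_sub]
    simp_rw [step1]
    have m3 : Measurable fun p : ℝ × ℝ =>
        ∫⁻ x, w x (p.2 - p.1) * ((Z x p.2)⁻¹ * (w x 0 * h x p.2 0)) := by
      refine Measurable.lintegral_prod_right' (f := fun q : (ℝ × ℝ) × (Fin n → ℝ) =>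
        w q.2 (q.1.2 - q.1.1) * ((Z q.2 q.1.2)⁻¹ * (w q.2 0 * h q.2 q.1.2 0))) ?_
      exact (mw.comp (f := fun q : (ℝ × ℝ) × (Fin n → ℝ) => (q.2, q.1.2 - q.1.1))
        (by fun_prop)).mul ((mZ.comp (f := fun q : (ℝ × ℝ) × (Fin n → ℝ) => (q.2, q.1.2))
        (by fun_prop)).inv.mul ((mw.comp (f := fun q : (ℝ × ℝ) × (Fin n → ℝ) => (q.2, (0 : ℝ)))
        (by fun_prop)).mul (hm.comp (f := fun q : (ℝ × ℝ) × (Fin n → ℝ) =>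
          ((q.2, q.1.2), (0 : ℝ))) (by fun_prop))))
    -- After the translation, y survives only in w x (γ - y). Its G-integral is the normalizing
    -- constant Z x γ, which cancels. This works because G is both the law of y in state 0 and the
    -- noise in the belief given y.
    rw [lintegral_lintegral_swap m3.aemeasurable]
    refine lintegral_congr fun γ => ?_
    have m4 : Measurable fun p : ℝ × (Fin n → ℝ) =>
        w p.2 (γ - p.1) * ((Z p.2 γ)⁻¹ * (w p.2 0 * h p.2 γ 0)) :=
      (mw.comp (f := fun q : ℝ × (Fin n → ℝ) => (q.2, γ - q.1)) (by fun_prop)).mul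
        ((mZ.comp (f := fun q : ℝ × (Fin n → ℝ) => (q.2, γ)) (by fun_prop)).inv.mul
        ((mw.comp (f := fun q : ℝ × (Fin n → ℝ) => (q.2, (0 : ℝ))) (by fun_prop)).mul
        (hm.comp (f := fun q : ℝ × (Fin n → ℝ) => ((q.2, γ), (0 : ℝ))) (by fun_prop))))
    rw [lintegral_lintegral_swap m4.aemeasurable]
    refine lintegral_congr fun x => ?_
    have m6 : Measurable fun y => w x (γ - y) := (hmw x).comp (by fun_prop)
    rw [lintegral_mul_const _ m6, ← hbel (hmw x) γ]
    change Z x γ * _ = _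
    rw [← mul_assoc, ENNReal.mul_inv_cancel (hZ0 x γ) (hZt x γ), one_mul]
  | diffuse =>
    have hd := hd rfl
    have hZadd : ∀ x t, Z (fun i => x i + t) 0 = Z x 0 := fun x t => by
      change ∫⁻ s, w (fun i => x i + t) s = ∫⁻ s, w x s
      rw [← lintegral_add_right_eq_self (fun s => w (fun i => x i + t) s) t]
      simp_rw [hwadd]
    change ∫⁻ y, (∫⁻ x, w x 0 * ((Z x y)⁻¹ * ∫⁻ t, w x t * h x y t)) ∂(Measure.dirac 0) =
      ∫⁻ y, (∫⁻ x, w x 0 * h x y 0) ∂(Measure.dirac 0)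
    have hmeas' : Measurable fun y : ℝ => ∫⁻ x, w x 0 * ((Z x y)⁻¹ * ∫⁻ t, w x t * h x y t) := by
      have : (fun y : ℝ => ∫⁻ x, w x 0 * ((Z x y)⁻¹ * ∫⁻ t, w x t * h x y t)) =
          fun _ => ∫⁻ x, w x 0 * ((Z x 0)⁻¹ * ∫⁻ t, w x t * h x 0 t) := by
        ext y
        simp_rw [fun x t => hd x y 0 t]
        rfl
      rw [this]; exact measurable_const
    have hmeas'' : Measurable fun y : ℝ => ∫⁻ x, w x 0 * h x y 0 := by
      simp_rw [fun x y => hd x y 0 0]; exact measurable_const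
    rw [lintegral_dirac' _ hmeas', lintegral_dirac' _ hmeas'']
    have m1 : Measurable fun p : (Fin n → ℝ) × ℝ =>
        w p.1 0 * ((Z p.1 0)⁻¹ * (w p.1 p.2 * h p.1 0 p.2)) :=
      (mw.comp (f := fun p : (Fin n → ℝ) × ℝ => (p.1, (0 : ℝ))) (by fun_prop)).mul
        ((mZ.comp (f := fun p : (Fin n → ℝ) × ℝ => (p.1, (0 : ℝ))) (by fun_prop)).inv.mul
        (mw.mul (hm.comp (f := fun p : (Fin n → ℝ) × ℝ => ((p.1, (0 : ℝ)), p.2)) (by fun_prop))))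
    calc _ = ∫⁻ x, ∫⁻ t, w x 0 * ((Z x 0)⁻¹ * (w x t * h x 0 t)) := by
          refine lintegral_congr fun x => ?_
          have m2 : Measurable fun t => w x t * h x 0 t := (hmw x).mul (hmx x 0)
          rw [lintegral_const_mul _ (m2.const_mul _), lintegral_const_mul _ m2]
      _ = ∫⁻ t, ∫⁻ x, w x 0 * ((Z x 0)⁻¹ * (w x t * h x 0 t)) :=
          lintegral_lintegral_swap m1.aemeasurable
      -- Translating the sample by t sends the draw t to state 0 and leaves t only in w x (-t),
      -- whose Lebesgue integral is the normalizing constant.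
      _ = ∫⁻ t, ∫⁻ x, w x (-t) * ((Z x 0)⁻¹ * (w x 0 * h x 0 0)) := by
          refine lintegral_congr fun t => ?_
          rw [← lintegral_add_right_eq_self _ (fun _ => t)]
          refine lintegral_congr fun x => ?_
          change w (fun i => x i + t) 0 * ((Z (fun i => x i + t) 0)⁻¹ *
              (w (fun i => x i + t) t * h (fun i => x i + t) 0 t)) = _
          have e1 := hwadd x 0 t
          have e2 := hinv x 0 0 t
          rw [zero_add] at e1 e2
          rw [hwadd0, hZadd, e1, hd _ 0 t, e2]
      _ = ∫⁻ x, ∫⁻ t, w x (-t) * ((Z x 0)⁻¹ * (w x 0 * h x 0 0)) := by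
          refine lintegral_lintegral_swap (Measurable.aemeasurable ?_)
          exact (mw.comp (f := fun q : ℝ × (Fin n → ℝ) => (q.2, -q.1)) (by fun_prop)).mul
            ((mZ.comp (f := fun q : ℝ × (Fin n → ℝ) => (q.2, (0 : ℝ))) (by fun_prop)).inv.mul
            ((mw.comp (f := fun q : ℝ × (Fin n → ℝ) => (q.2, (0 : ℝ))) (by fun_prop)).mul
            (hm.comp (f := fun q : ℝ × (Fin n → ℝ) => ((q.2, (0 : ℝ)), (0 : ℝ))) (by fun_prop))))
      _ = _ := by
          refine lintegral_congr fun x => ?_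
          have m6 : Measurable fun t => w x (-t) := (hmw x).comp measurable_neg
          rw [lintegral_mul_const _ m6, lintegral_neg_eq_self (w x)]
          change Z x 0 * _ = _
          rw [← mul_assoc, ENNReal.mul_inv_cancel (hZ0 x 0) (hZt x 0), one_mul]

end Invariance

/-! ### Bias, signaling loss, best responses and the sender's utility. -/

section Schemes

variable {f : ℝ → ℝ} {S : SideInfo} {n : ℕ} {π : (Fin n → ℝ) → ℝ → ℝ}

lemma IsScheme.apply_dataShift (hπ : IsScheme S π) (ht : IsTranslationInvariant π) (θ : ℝ)
    (ω : (Fin n → ℝ) × ℝ) :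
    π (dataShift S θ ω).1 (dataShift S θ ω).2 = π ω.1 ω.2 + θ := by
  cases S with
  | signal G => exact ht _ _ _
  -- Without foresight the shift leaves y at its dummy value. Since π ignores y, it may be replaced
  -- by a translated value before invariance is applied.
  | diffuse => rw [hπ.no_foresight rfl _ _ ((dataShift .diffuse θ ω).2 + θ)]; exact ht _ _ _

lemma posteriorMean_dataShift (hf : WellBehaved f) (hS : S.IsProper) (hn : 1 ≤ n) (θ : ℝ)
    (ω : (Fin n → ℝ) × ℝ) :
    posteriorMean f S (dataShift S θ ω).1 (dataShift S θ ω).2 = posteriorMean f S ω.1 ω.2 + θ := by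
  cases S with
  | signal G => exact posteriorMean_add hf hS hn _ _ _
  | diffuse =>
    rw [posteriorMean_diffuse f _ _ ((dataShift .diffuse θ ω).2 + θ)]
    exact posteriorMean_add hf hS hn _ _ _

lemma measurePreserving_apply (hf : WellBehaved f) (hS : S.IsProper) (i : Fin n) :
    MeasurePreserving (fun ω : (Fin n → ℝ) × ℝ => ω.1 i) (zeroLaw f S n) (noise f) := by
  have := hf.isProbabilityMeasure
  have := hS.isProbabilityMeasure_law 0
  exact (measurePreserving_eval (fun _ : Fin n => noise f) i).comp measurePreserving_fst

lemma bias_eq (hf : WellBehaved f) (hS : S.IsProper) (hπ : IsScheme S π)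
    (ht : IsTranslationInvariant π) (θ : ℝ) :
    bias f S π θ = ∫ ω, π ω.1 ω.2 ∂(zeroLaw f S n) := by
  rw [bias, dataLaw_eq_map hf hS, integral_map (measurable_dataShift S θ).aemeasurable
    (hπ.measurable.sub_const θ).aestronglyMeasurable]
  simp [hπ.apply_dataShift ht]

lemma signalingLoss_eq (hf : WellBehaved f) (hS : S.IsProper) (hn : 1 ≤ n) (hπ : IsScheme S π)
    (ht : IsTranslationInvariant π) (θ : ℝ) :
    signalingLoss f S π θ =
      ∫ ω, (π ω.1 ω.2 - posteriorMean f S ω.1 ω.2 - bias f S π θ) ^ 2 ∂(zeroLaw f S n) := by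
  have hm : Measurable fun ω : (Fin n → ℝ) × ℝ =>
      (π ω.1 ω.2 - (posteriorMean f S ω.1 ω.2 + bias f S π θ)) ^ 2 :=
    (hπ.measurable.sub ((measurable_posteriorMean hf hS).add_const _)).pow_const 2
  rw [signalingLoss, dataLaw_eq_map hf hS, integral_map (measurable_dataShift S θ).aemeasurable
    hm.aestronglyMeasurable]
  simp only [hπ.apply_dataShift ht, posteriorMean_dataShift hf hS hn]
  congr 1; ext ω; ring

lemma integrable_sq_apply (hf : WellBehaved f) (hS : S.IsProper) (i : Fin n) :
    Integrable (fun ω : (Fin n → ℝ) × ℝ => ω.1 i ^ 2) (zeroLaw f S n) := by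
  refine (measurePreserving_apply hf hS i).integrable_comp_of_integrable (g := fun x => x ^ 2) ?_
  refine hf.integrable_noise_of_le (K := 32) (b := 1 / 4) (by norm_num) (by fun_prop) fun x => ?_
  rw [abs_of_nonneg (sq_nonneg _)]; exact sq_le_exp_quarter x

lemma IsScheme.memLp (hf : WellBehaved f) (hS : S.IsProper) (hπ : IsScheme S π) :
    MemLp (fun ω : (Fin n → ℝ) × ℝ => π ω.1 ω.2) 2 (zeroLaw f S n) := by
  rw [memLp_two_iff_integrable_sq hπ.measurable.aestronglyMeasurable]
  refine (integrable_finsetSum Finset.univ fun i _ => integrable_sq_apply hf hS i).mono'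
    (hπ.measurable.pow_const 2).aestronglyMeasurable (ae_of_all _ fun ω => ?_)
  obtain ⟨i, hi⟩ := hπ.selects ω.1 ω.2
  rw [Real.norm_eq_abs, abs_of_nonneg (sq_nonneg _), hi]
  exact Finset.single_le_sum (f := fun i => ω.1 i ^ 2) (fun i _ => sq_nonneg _) (Finset.mem_univ i)

/-- The expected posterior variance. -/
def posteriorVariance (f : ℝ → ℝ) (S : SideInfo) (n : ℕ) : ENNReal :=
  ∫⁻ ω, ∫⁻ t, ENNReal.ofReal ((posteriorMean f S ω.1 ω.2 - t) ^ 2) ∂(posterior f S ω.1 ω.2)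
    ∂(zeroLaw f S n)

/-- For fixed data this is the bias-variance decomposition under the posterior; the invariance
identity then replaces the posterior draw by the state 0. The constant k allows messages corrected
for their bias. Working with extended nonnegative integrals avoids presupposing that the posterior
variance is finite. -/
lemma lintegral_sq_add (hf : WellBehaved f) (hS : S.IsProper) (hn : 1 ≤ n) (hπ : IsScheme S π)
    (ht : IsTranslationInvariant π) (k : ℝ) :
    ∫⁻ ω, ENNReal.ofReal ((π ω.1 ω.2 + k) ^ 2) ∂(zeroLaw f S n) =
      ∫⁻ ω, ENNReal.ofReal ((π ω.1 ω.2 + k - posteriorMean f S ω.1 ω.2) ^ 2) ∂(zeroLaw f S n) +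
        posteriorVariance f S n := by
  have h1 : Measurable fun p : ((Fin n → ℝ) × ℝ) × ℝ => π p.1.1 p.1.2 :=
    hπ.measurable.comp measurable_fst
  have h := lintegral_posterior_zeroLaw hf hS hn
    (h := fun x y t => ENNReal.ofReal ((π x y + k - t) ^ 2))
    (((h1.add_const k).sub measurable_snd).pow_const 2).ennreal_ofReal
    (fun x y t δ => by simp only [ht x y δ]; congr 2; ring)
    (fun hd x y y' t => by simp only [hπ.no_foresight hd x y y'])
  simp only [sub_zero] at h
  have hm : Measurable fun ω : (Fin n → ℝ) × ℝ =>
      ENNReal.ofReal ((π ω.1 ω.2 + k - posteriorMean f S ω.1 ω.2) ^ 2) :=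
    (((hπ.measurable.add_const k).sub (measurable_posteriorMean hf hS)).pow_const 2).ennreal_ofReal
  rw [← h, posteriorVariance, ← lintegral_add_left hm]
  exact lintegral_congr fun ω => lintegral_sq_sub_posterior hf hS hn ω.1 ω.2 (π ω.1 ω.2 + k)

lemma isScheme_first (S : SideInfo) (hn : 1 ≤ n) :
    IsScheme S (fun (x : Fin n → ℝ) (_ : ℝ) => x ⟨0, hn⟩) :=
  ⟨by fun_prop, fun _ _ => ⟨_, rfl⟩, fun _ _ _ _ => rfl⟩

lemma lintegral_sq_ne_top (hf : WellBehaved f) (hS : S.IsProper) (hπ : IsScheme S π) (k : ℝ) :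
    ∫⁻ ω, ENNReal.ofReal ((π ω.1 ω.2 + k) ^ 2) ∂(zeroLaw f S n) ≠ ⊤ := by
  have := hS.isProbabilityMeasure_zeroLaw (n := n) hf
  have h := ((hπ.memLp hf hS).add (memLp_const k)).integrable_sq
  exact ((hasFiniteIntegral_iff_ofReal (ae_of_all _ fun _ => sq_nonneg _)).1 h.2).ne

/-- The decomposition is applied to the scheme that always sends the first anecdote, whose mean
squared error is finite. -/
lemma posteriorVariance_ne_top (hf : WellBehaved f) (hS : S.IsProper) (hn : 1 ≤ n) :
    posteriorVariance f S n ≠ ⊤ := by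
  have h := lintegral_sq_add hf hS hn (isScheme_first S hn) (fun x y δ => rfl) 0
  exact ne_top_of_le_ne_top (h ▸ lintegral_sq_ne_top hf hS (isScheme_first S hn) 0) le_add_self

lemma integrable_sq_sub_posteriorMean (hf : WellBehaved f) (hS : S.IsProper) (hn : 1 ≤ n)
    (hπ : IsScheme S π) (ht : IsTranslationInvariant π) (k : ℝ) :
    Integrable (fun ω => (π ω.1 ω.2 + k - posteriorMean f S ω.1 ω.2) ^ 2) (zeroLaw f S n) := by
  have hm := measurable_posteriorMean (n := n) hf hS
  refine ⟨(((hπ.measurable.add_const k).sub hm).pow_const 2).aestronglyMeasurable, ?_⟩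
  rw [hasFiniteIntegral_iff_ofReal (ae_of_all _ fun _ => sq_nonneg _)]
  have h := lintegral_sq_add hf hS hn hπ ht k
  exact (ne_top_of_le_ne_top (h ▸ lintegral_sq_ne_top hf hS hπ k) le_self_add).lt_top

/-- The mean squared error of a scheme decomposes into its distance to the posterior mean and the
posterior variance. -/
lemma integral_sq_add (hf : WellBehaved f) (hS : S.IsProper) (hn : 1 ≤ n) (hπ : IsScheme S π)
    (ht : IsTranslationInvariant π) (k : ℝ) :
    ∫ ω, (π ω.1 ω.2 + k) ^ 2 ∂(zeroLaw f S n) =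
      ∫ ω, (π ω.1 ω.2 + k - posteriorMean f S ω.1 ω.2) ^ 2 ∂(zeroLaw f S n) +
        (posteriorVariance f S n).toReal := by
  have hm : Measurable fun ω : (Fin n → ℝ) × ℝ =>
      (π ω.1 ω.2 + k - posteriorMean f S ω.1 ω.2) ^ 2 :=
    ((hπ.measurable.add_const k).sub (measurable_posteriorMean hf hS)).pow_const 2
  have h := lintegral_sq_add hf hS hn hπ ht k
  rw [integral_eq_lintegral_of_nonneg_ae (ae_of_all _ fun _ => sq_nonneg _)
    ((hπ.measurable.add_const k).pow_const 2).aestronglyMeasurable,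
    integral_eq_lintegral_of_nonneg_ae (ae_of_all _ fun _ => sq_nonneg _)
    hm.aestronglyMeasurable, h,
    ENNReal.toReal_add (ne_top_of_le_ne_top (h ▸ lintegral_sq_ne_top hf hS hπ k) le_self_add)
    (posteriorVariance_ne_top hf hS hn)]

lemma integral_sq_sub_integral {Ω : Type*} [MeasurableSpace Ω] {μ : Measure Ω}
    [IsProbabilityMeasure μ] {X : Ω → ℝ} (hX : MemLp X 2 μ) (k : ℝ) :
    ∫ ω, (X ω - ∫ ω', X ω' ∂μ + k) ^ 2 ∂μ = ∫ ω, X ω ^ 2 ∂μ - (∫ ω, X ω ∂μ) ^ 2 + k ^ 2 := by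
  have i1 : Integrable X μ := hX.integrable (by norm_num)
  have i2 := hX.integrable_sq
  set b := ∫ ω, X ω ∂μ with hb
  have : (fun ω => (X ω - b + k) ^ 2) = fun ω => X ω ^ 2 + (2 * (k - b) * X ω + (k - b) ^ 2) := by
    ext ω; ring
  have i3 : Integrable (fun ω => 2 * (k - b) * X ω + (k - b) ^ 2) μ :=
    (i1.const_mul _).add (integrable_const _)
  rw [this, integral_add i2 i3,
    integral_add (i1.const_mul _) (integrable_const _), integral_const_mul, ← hb]
  simp; ring

/-- The mean squared error decomposition is compared for k = 0 and k = -β. The posterior variance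
cancels, so the mean of θ_S never has to be computed. -/
lemma signalingLoss_eq_sub_sq (hf : WellBehaved f) (hS : S.IsProper) (hn : 1 ≤ n)
    (hπ : IsScheme S π) (ht : IsTranslationInvariant π) (θ : ℝ) :
    signalingLoss f S π θ =
      ∫ ω, (π ω.1 ω.2 - posteriorMean f S ω.1 ω.2) ^ 2 ∂(zeroLaw f S n) - bias f S π θ ^ 2 := by
  have := hS.isProbabilityMeasure_zeroLaw (n := n) hf
  have h0 := integral_sq_add hf hS hn hπ ht 0
  have h1 := integral_sq_add hf hS hn hπ ht (-bias f S π θ)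
  have h2 := integral_sq_sub_integral (hπ.memLp hf hS) 0
  rw [← bias_eq hf hS hπ ht θ] at h2
  simp only [add_zero, ← sub_eq_add_neg] at h0 h1 h2
  rw [signalingLoss_eq hf hS hn hπ ht]
  have h3 : ∀ ω : (Fin n → ℝ) × ℝ, (π ω.1 ω.2 - bias f S π θ - posteriorMean f S ω.1 ω.2) ^ 2 =
    (π ω.1 ω.2 - posteriorMean f S ω.1 ω.2 - bias f S π θ) ^ 2 := fun ω => by ring
  simp only [h3] at h1
  linarith

/-- The closest anecdote minimizes the signaling loss among unbiased schemes. -/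
lemma signalingLoss_le_of_isTargeting (hf : WellBehaved f) (hS : S.IsProper) (hn : 1 ≤ n)
    {π₀ : (Fin n → ℝ) → ℝ → ℝ} (hπ₀ : IsScheme S π₀) (ht₀ : IsTranslationInvariant π₀)
    (hc : IsTargeting f S 0 π₀) (hπ : IsScheme S π) (ht : IsTranslationInvariant π) (θ : ℝ)
    (hb : bias f S π θ = 0) : signalingLoss f S π₀ θ ≤ signalingLoss f S π θ := by
  rw [signalingLoss_eq_sub_sq hf hS hn hπ₀ ht₀, signalingLoss_eq_sub_sq hf hS hn hπ ht, hb]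
  have h : ∫ ω, (π₀ ω.1 ω.2 - posteriorMean f S ω.1 ω.2) ^ 2 ∂(zeroLaw f S n) ≤
      ∫ ω, (π ω.1 ω.2 - posteriorMean f S ω.1 ω.2) ^ 2 ∂(zeroLaw f S n) := by
    have i1 := integrable_sq_sub_posteriorMean hf hS hn hπ₀ ht₀ 0
    have i2 := integrable_sq_sub_posteriorMean hf hS hn hπ ht 0
    simp only [add_zero] at i1 i2
    refine integral_mono i1 i2 fun ω => ?_
    obtain ⟨i, hi, hle⟩ := hc ω.1 ω.2
    obtain ⟨j, hj⟩ := hπ.selects ω.1 ω.2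
    simp only [hi, hj]
    exact sq_le_sq.2 (by simpa using hle j)
  -- A bias of π₀ only lowers its own loss, so π₀ itself need not be unbiased.
  nlinarith [sq_nonneg (bias f S π₀ θ)]

/-- The law of the sent anecdote in state `0`. -/
def messageLaw (f : ℝ → ℝ) (S : SideInfo) {n : ℕ} (π : (Fin n → ℝ) → ℝ → ℝ) : Measure ℝ :=
  (zeroLaw f S n).map fun ω => π ω.1 ω.2

lemma lintegral_dataLaw_scheme (hf : WellBehaved f) (hS : S.IsProper) (hπ : IsScheme S π)
    (ht : IsTranslationInvariant π) (θ : ℝ) {g : ℝ → ENNReal} (hg : Measurable g) :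
    ∫⁻ ω, g (π ω.1 ω.2) ∂(dataLaw f S n θ) = ∫⁻ u, g (u + θ) ∂(messageLaw f S π) := by
  have h1 : Measurable fun ω : (Fin n → ℝ) × ℝ => g (π ω.1 ω.2) := hg.comp hπ.measurable
  have h2 : Measurable fun u => g (u + θ) := hg.comp (by fun_prop)
  rw [dataLaw_eq_map hf hS, messageLaw, lintegral_map h1 (measurable_dataShift S θ),
    lintegral_map h2 hπ.measurable]
  simp [hπ.apply_dataShift ht]

lemma isProbabilityMeasure_messageLaw (hf : WellBehaved f) (hS : S.IsProper)
    (hπ : IsScheme S π) : IsProbabilityMeasure (messageLaw f S π) := by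
  have := hS.isProbabilityMeasure_zeroLaw (n := n) hf
  exact Measure.isProbabilityMeasure_map hπ.measurable.aemeasurable

lemma noise_absolutelyContinuous (f : ℝ → ℝ) : noise f ≪ volume :=
  withDensity_absolutelyContinuous _ _

/-- The message is always one of finitely many anecdotes, each with a density. Identities for almost
every message therefore hold almost surely along the scheme. -/
lemma messageLaw_absolutelyContinuous (hf : WellBehaved f) (hS : S.IsProper)
    (hπ : IsScheme S π) : messageLaw f S π ≪ volume := by
  refine Measure.AbsolutelyContinuous.mk fun s hs h0 => ?_
  rw [messageLaw, Measure.map_apply hπ.measurable hs]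
  refine measure_mono_null (t := ⋃ i : Fin n, (fun ω : (Fin n → ℝ) × ℝ => ω.1 i) ⁻¹' s) ?_ ?_
  · intro ω hω
    obtain ⟨i, hi⟩ := hπ.selects ω.1 ω.2
    exact Set.mem_iUnion.2 ⟨i, by simpa [← hi] using hω⟩
  · refine measure_iUnion_null fun i => ?_
    rw [(measurePreserving_apply hf hS i).measure_preimage hs.nullMeasurableSet]
    exact noise_absolutelyContinuous f h0

/-- The belief `s - u` with `u` distributed like the message in state `0`. -/
def messageKernel (Q : Measure ℝ) [SFinite Q] : Kernel ℝ ℝ :=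
  (Kernel.id ×ₖ Kernel.const ℝ Q).map fun p : ℝ × ℝ => p.1 - p.2

lemma messageKernel_apply (Q : Measure ℝ) [SFinite Q] (s : ℝ) :
    messageKernel Q s = Q.map fun u => s - u := by
  rw [messageKernel, Kernel.map_apply _ (by fun_prop), Kernel.prod_apply, Kernel.id_apply,
    Kernel.const_apply, Measure.dirac_prod, Measure.map_map (by fun_prop) (by fun_prop)]
  rfl

/-- Rational beliefs after a message are unique almost everywhere. -/
lemma IsRationalBelief.ae_eq (hf : WellBehaved f) (hS : S.IsProper) (hπ : IsScheme S π)
    (ht : IsTranslationInvariant π) {B : Kernel ℝ ℝ} [IsMarkovKernel B]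
    (hB : IsRationalBelief f S π B) :
    ∀ᵐ s, B s = (messageLaw f S π).map fun u => s - u := by
  have hQ := isProbabilityMeasure_messageLaw hf hS hπ
  set Q := messageLaw f S π with hQdef
  have hmarkov : IsMarkovKernel (messageKernel Q) := by
    unfold messageKernel; exact Kernel.IsMarkovKernel.map _ (by fun_prop)
  -- With θ Lebesgue distributed and u an independent message from state 0, the message s = u + θ is
  -- again Lebesgue distributed, and θ = s - u with u independent of s. Both sides are reduced to
  -- this by Fubini and translation.
  have key : ∀ A C : Set ℝ, MeasurableSet A → MeasurableSet C →
      ∫⁻ s in A, B s C = ∫⁻ s in A, messageKernel Q s C := by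
    intro A C hA hC
    have mB : Measurable fun s => B s C := B.measurable_coe hC
    have mA : Measurable (A.indicator fun s => B s C) := mB.indicator hA
    have m1 : Measurable (A.indicator (1 : ℝ → ENNReal)) := measurable_one.indicator hA
    have m2 : Measurable (C.indicator (1 : ℝ → ENNReal)) := measurable_one.indicator hC
    have h := hB A C hA hC
    have mπ : MeasurableSet {ω : (Fin n → ℝ) × ℝ | π ω.1 ω.2 ∈ A} := hπ.measurable hA
    have e1 : ∀ θ, dataLaw f S n θ {ω | π ω.1 ω.2 ∈ A} = ∫⁻ u, A.indicator 1 (u + θ) ∂Q := by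
      intro θ
      rw [← lintegral_dataLaw_scheme hf hS hπ ht θ m1, ← lintegral_indicator_one mπ]
      rfl
    have e2 : ∀ θ, ∫⁻ ω in {ω | π ω.1 ω.2 ∈ A}, B (π ω.1 ω.2) C ∂(dataLaw f S n θ) =
        ∫⁻ u, A.indicator (fun s => B s C) (u + θ) ∂Q := by
      intro θ
      rw [← lintegral_dataLaw_scheme hf hS hπ ht θ mA, ← lintegral_indicator mπ]
      rfl
    simp_rw [e1, e2] at h
    calc ∫⁻ s in A, B s C
        = ∫⁻ u, (∫⁻ s, A.indicator (fun s => B s C) (u + s)) ∂Q := by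
          simp_rw [lintegral_add_left_eq_self (A.indicator fun s => B s C)]
          rw [lintegral_indicator hA]; simp
      _ = ∫⁻ θ, ∫⁻ u, A.indicator (fun s => B s C) (u + θ) ∂Q := by
          refine lintegral_lintegral_swap (Measurable.aemeasurable ?_)
          exact mA.comp (f := fun p : ℝ × ℝ => p.1 + p.2) (by fun_prop)
      _ = ∫⁻ θ, ∫⁻ u, C.indicator 1 θ * A.indicator 1 (u + θ) ∂Q := by
          rw [← h, ← lintegral_indicator hC]
          refine lintegral_congr fun θ => ?_
          have m4 : Measurable fun u => A.indicator (1 : ℝ → ENNReal) (u + θ) :=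
            m1.comp (by fun_prop : Measurable fun u : ℝ => u + θ)
          rw [lintegral_const_mul _ m4]
          by_cases hθ : θ ∈ C <;> simp [hθ]
      _ = ∫⁻ u, (∫⁻ θ, C.indicator 1 θ * A.indicator 1 (u + θ)) ∂Q := by
          refine lintegral_lintegral_swap (Measurable.aemeasurable ?_)
          exact (m2.comp measurable_fst).mul
            (m1.comp (f := fun p : ℝ × ℝ => p.2 + p.1) (by fun_prop))
      _ = ∫⁻ u, (∫⁻ s, A.indicator 1 s * C.indicator 1 (s - u)) ∂Q := by
          refine lintegral_congr fun u => ?_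
          rw [← lintegral_add_left_eq_self
            (fun s => A.indicator (1 : ℝ → ENNReal) s * C.indicator 1 (s - u)) u]
          simp [mul_comm]
      _ = ∫⁻ s, ∫⁻ u, A.indicator 1 s * C.indicator 1 (s - u) ∂Q := by
          refine lintegral_lintegral_swap (Measurable.aemeasurable ?_)
          exact (m1.comp measurable_snd).mul
            (m2.comp (f := fun p : ℝ × ℝ => p.2 - p.1) (by fun_prop))
      _ = ∫⁻ s in A, messageKernel Q s C := by
          rw [← lintegral_indicator hA]
          refine lintegral_congr fun s => ?_
          have m3 : Measurable fun u : ℝ => s - u := by fun_prop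
          have m4 : Measurable fun u => C.indicator (1 : ℝ → ENNReal) (s - u) := m2.comp m3
          rw [lintegral_const_mul _ m4]
          by_cases hs : s ∈ A
          · simp only [hs, Set.indicator_of_mem, Pi.one_apply, one_mul]
            rw [messageKernel_apply, Measure.map_apply m3 hC, ← lintegral_indicator_one (m3 hC)]
            rfl
          · simp [hs]
  -- Equality on rectangles determines a finite measure, so the uniqueness of disintegrations is
  -- used on the intervals [-k, k].
  have hk : ∀ k : ℕ, ∀ᵐ s, s ∈ Set.Icc (-(k : ℝ)) k → B s = messageKernel Q s := by
    intro k
    rw [← ae_restrict_iff' measurableSet_Icc]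
    refine Kernel.ae_eq_of_compProd_eq (Measure.ext_prod fun {s t} hs ht => ?_)
    rw [Measure.compProd_apply_prod hs ht, Measure.compProd_apply_prod hs ht,
      Measure.restrict_restrict hs]
    exact key _ _ (hs.inter measurableSet_Icc) ht
  filter_upwards [ae_all_iff.2 hk] with s hs
  obtain ⟨k, hk⟩ := exists_nat_ge |s|
  rw [hs k (abs_le.1 hk), messageKernel_apply]

/-- Best responses correct the message for the bias, almost everywhere. -/
lemma IsBestResponse.ae_eq (hf : WellBehaved f) (hS : S.IsProper) (hπ : IsScheme S π)
    (ht : IsTranslationInvariant π) {M : ℝ} {α : ℝ → ℝ} (hα : IsBestResponse f S π M α) :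
    ∀ᵐ s, α s = s - (∫ ω, π ω.1 ω.2 ∂(zeroLaw f S n)) + M := by
  have hP := hS.isProbabilityMeasure_zeroLaw (n := n) hf
  obtain ⟨B, hBm, hB, hopt⟩ := hα
  filter_upwards [hB.ae_eq hf hS hπ ht] with s hs
  set b := ∫ ω, π ω.1 ω.2 ∂(zeroLaw f S n) with hb
  -- The receiver's payoff is a concave quadratic in a, with unique maximizer s - b + M.
  have hval : ∀ a, ∫ θ, utility M a θ ∂(B s) = -(∫ ω, π ω.1 ω.2 ^ 2 ∂(zeroLaw f S n) - b ^ 2 +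
      (a - s - M + b) ^ 2) := by
    intro a
    have hu : Measurable (utility M a) := by unfold utility; fun_prop
    rw [hs, messageLaw, Measure.map_map (by fun_prop) hπ.measurable, integral_map
      ((by fun_prop : Measurable fun u : ℝ => s - u).comp hπ.measurable).aemeasurable
      hu.aestronglyMeasurable]
    have h := integral_sq_sub_integral (hπ.memLp hf hS) (a - s - M + b)
    rw [← h, ← integral_neg]
    refine integral_congr_ae (ae_of_all _ fun ω => ?_)
    simp only [utility, Function.comp, ← hb]
    ring
  have h := hopt s (s - b + M)
  rw [hval, hval] at h
  have : (α s - s - M + b) ^ 2 ≤ 0 := by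
    have e : (s - b + M - s - M + b) = 0 := by ring
    rw [e] at h; linarith
  have h0 : α s - s - M + b = 0 := by
    by_contra hne
    exact absurd this (not_le.2 (by positivity))
  linarith

/-- Under commitment the sender's expected utility is determined by the signaling loss. -/
lemma senderUtility_eq (hf : WellBehaved f) (hS : S.IsProper) (hn : 1 ≤ n) (hπ : IsScheme S π)
    (ht : IsTranslationInvariant π) {M_S M_R : ℝ} {α : ℝ → ℝ}
    (hα : IsBestResponse f S π M_R α) (θ : ℝ) :
    senderUtility f S π M_S α θ =
      -(signalingLoss f S π θ + (posteriorVariance f S n).toReal + (M_R - M_S) ^ 2) := by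
  have hP := hS.isProbabilityMeasure_zeroLaw (n := n) hf
  set b := ∫ ω, π ω.1 ω.2 ∂(zeroLaw f S n) with hb
  have hae : ∀ᵐ ω ∂(dataLaw f S n θ), α (π ω.1 ω.2) = π ω.1 ω.2 - b + M_R := by
    rw [dataLaw_eq_map hf hS]
    have h1 : ∀ᵐ u, α (u + θ) = u + θ - b + M_R :=
      (measurePreserving_add_right volume θ).quasiMeasurePreserving.ae (hα.ae_eq hf hS hπ ht)
    have h2 := ae_of_ae_map hπ.measurable.aemeasurable
      ((messageLaw_absolutelyContinuous hf hS hπ).ae_le h1)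
    -- The action rule α is an arbitrary function, so its exceptional set is enlarged to a
    -- measurable null set before it is pulled back.
    obtain ⟨N, hN, hNm, hN0⟩ := exists_measurable_superset_of_null
      (ae_iff.1 (hα.ae_eq hf hS hπ ht))
    refine ae_iff.2 (measure_mono_null (t := (fun ω : (Fin n → ℝ) × ℝ => π ω.1 ω.2) ⁻¹' N)
      (fun ω hω => hN hω) ?_)
    rw [Measure.map_apply (measurable_dataShift S θ) (hπ.measurable hNm)]
    have h3 : volume ((fun u : ℝ => u + θ) ⁻¹' N) = 0 := by
      rw [measure_preimage_add_right]; exact hN0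
    have h4 := messageLaw_absolutelyContinuous hf hS hπ h3
    rw [messageLaw, Measure.map_apply hπ.measurable (hNm.preimage (by fun_prop))] at h4
    convert h4 using 2
    ext ω
    simp [hπ.apply_dataShift ht]
  have h1 : senderUtility f S π M_S α θ =
      ∫ ω, -(π ω.1 ω.2 - b + M_R - (θ + M_S)) ^ 2 ∂(dataLaw f S n θ) := by
    refine integral_congr_ae ?_
    filter_upwards [hae] with ω hω
    simp only [hω, utility]
  have hm : Measurable fun ω : (Fin n → ℝ) × ℝ => -(π ω.1 ω.2 - b + M_R - (θ + M_S)) ^ 2 :=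
    ((((hπ.measurable.sub_const _).add_const _).sub_const _).pow_const 2).neg
  have h2 := integral_sq_sub_integral (hπ.memLp hf hS) (M_R - M_S)
  have h3 := integral_sq_add hf hS hn hπ ht 0
  simp only [add_zero] at h3
  rw [h1, dataLaw_eq_map hf hS, integral_map (measurable_dataShift S θ).aemeasurable
    hm.aestronglyMeasurable, integral_neg]
  simp only [hπ.apply_dataShift ht]
  have e : ∀ ω : (Fin n → ℝ) × ℝ, (π ω.1 ω.2 + θ - b + M_R - (θ + M_S)) ^ 2 =
      (π ω.1 ω.2 - b + (M_R - M_S)) ^ 2 := fun ω => by ring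
  simp only [e]
  rw [h2, h3, signalingLoss_eq_sub_sq hf hS hn hπ ht, bias_eq hf hS hπ ht, ← hb]
  ring

end Schemes

/-! ### Existence and unbiasedness of closest-anecdote schemes. -/

section Existence

variable {f : ℝ → ℝ} {S : SideInfo} {n : ℕ}

/-- Anecdote `i` is closest to the posterior mean. -/
def IsNearest (f : ℝ → ℝ) (S : SideInfo) {n : ℕ} (x : Fin n → ℝ) (y : ℝ) (i : Fin n) : Prop :=
  ∀ j, |x i - posteriorMean f S x y| ≤ |x j - posteriorMean f S x y|

lemma exists_isNearest (f : ℝ → ℝ) (S : SideInfo) (hn : 1 ≤ n) (x : Fin n → ℝ) (y : ℝ) :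
    ∃ i, IsNearest f S x y i := by
  have : Nonempty (Fin n) := ⟨⟨0, hn⟩⟩
  exact Finite.exists_min fun i => |x i - posteriorMean f S x y|

open Classical in
/-- The least index of an anecdote closest to the posterior mean. -/
def nearestIndex (f : ℝ → ℝ) (S : SideInfo) (hn : 1 ≤ n) (x : Fin n → ℝ) (y : ℝ) : Fin n :=
  (Finset.univ.filter (IsNearest f S x y)).min' (by
    obtain ⟨i, hi⟩ := exists_isNearest f S hn x y
    exact ⟨i, by simpa using hi⟩)

/-- The closest-anecdote scheme that resolves ties in favor of the least index. -/
def nearestScheme (f : ℝ → ℝ) (S : SideInfo) (hn : 1 ≤ n) (x : Fin n → ℝ) (y : ℝ) : ℝ :=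
  x (nearestIndex f S hn x y)

lemma isNearest_nearestIndex (f : ℝ → ℝ) (S : SideInfo) (hn : 1 ≤ n) (x : Fin n → ℝ) (y : ℝ) :
    IsNearest f S x y (nearestIndex f S hn x y) := by
  classical
  have := Finset.min'_mem (Finset.univ.filter (IsNearest f S x y))
    (by obtain ⟨i, hi⟩ := exists_isNearest f S hn x y; exact ⟨i, by simpa using hi⟩)
  exact (Finset.mem_filter.1 this).2

lemma nearestIndex_eq_iff (f : ℝ → ℝ) (S : SideInfo) (hn : 1 ≤ n) (x : Fin n → ℝ) (y : ℝ)
    (i : Fin n) :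
    nearestIndex f S hn x y = i ↔ IsNearest f S x y i ∧ ∀ j < i, ¬ IsNearest f S x y j := by
  classical
  rw [nearestIndex, Finset.min'_eq_iff]
  simp only [Finset.mem_filter, Finset.mem_univ, true_and]
  refine and_congr_right fun _ => forall_congr' fun j => ?_
  rw [← not_lt]; tauto

/-- The least index depends only on the set of nearest anecdotes, which neither translation nor
reflection of the data changes. Breaking ties by position on the line would be destroyed by
reflection; breaking them by index is what gives an unbiased scheme. -/
lemma nearestIndex_congr {hn : 1 ≤ n} {x x' : Fin n → ℝ} {y y' : ℝ}
    (h : ∀ i, IsNearest f S x y i ↔ IsNearest f S x' y' i) :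
    nearestIndex f S hn x y = nearestIndex f S hn x' y' := by
  rw [nearestIndex_eq_iff]
  simp only [h]
  exact (nearestIndex_eq_iff f S hn x' y' _).1 rfl

lemma measurable_nearestScheme (hf : WellBehaved f) (hS : S.IsProper) (hn : 1 ≤ n) :
    Measurable fun ω : (Fin n → ℝ) × ℝ => nearestScheme f S hn ω.1 ω.2 := by
  have hT := measurable_posteriorMean (n := n) hf hS
  have hi : ∀ i : Fin n, Measurable fun ω : (Fin n → ℝ) × ℝ => |ω.1 i - posteriorMean f S ω.1 ω.2| :=
    fun i => (((measurable_pi_apply i).comp measurable_fst).sub hT).abs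
  have h1 : ∀ i, MeasurableSet {ω : (Fin n → ℝ) × ℝ | IsNearest f S ω.1 ω.2 i} := fun i => by
    simp only [IsNearest, Set.ofPred_forall]
    exact MeasurableSet.iInter fun j => measurableSet_le (hi i) (hi j)
  have h2 : ∀ i, MeasurableSet {ω : (Fin n → ℝ) × ℝ | nearestIndex f S hn ω.1 ω.2 = i} := fun i => by
    simp only [nearestIndex_eq_iff, Set.ofPred_and, Set.ofPred_forall]
    exact (h1 i).inter (MeasurableSet.iInter fun j => MeasurableSet.iInter fun _ => (h1 j).compl)
  have h3 : (fun ω : (Fin n → ℝ) × ℝ => nearestScheme f S hn ω.1 ω.2) =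
      fun ω => ∑ i, {ω : (Fin n → ℝ) × ℝ | nearestIndex f S hn ω.1 ω.2 = i}.indicator
        (fun ω => ω.1 i) ω := by
    ext ω
    simp [nearestScheme, Set.indicator_apply]
  rw [h3]
  exact Finset.measurable_sum _ fun i _ =>
    ((measurable_pi_apply i).comp measurable_fst).indicator (h2 i)

lemma isScheme_nearestScheme (hf : WellBehaved f) (hS : S.IsProper) (hn : 1 ≤ n) :
    IsScheme S (nearestScheme f S hn) := by
  refine ⟨measurable_nearestScheme hf hS hn, fun x y => ⟨_, rfl⟩, ?_⟩
  rintro rfl x y y'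
  rfl

lemma isTranslationInvariant_nearestScheme (hf : WellBehaved f) (hS : S.IsProper) (hn : 1 ≤ n) :
    IsTranslationInvariant (nearestScheme f S hn) := by
  intro x y δ
  rw [nearestScheme, nearestScheme, nearestIndex_congr (x' := x) (y' := y)]
  intro i
  simp [IsNearest, posteriorMean_add hf hS hn]

lemma isTargeting_nearestScheme (f : ℝ → ℝ) (S : SideInfo) (hn : 1 ≤ n) :
    IsTargeting f S 0 (nearestScheme f S hn) := fun x y =>
  ⟨_, rfl, fun j => by simpa using isNearest_nearestIndex f S hn x y j⟩

lemma SideInfo.IsSymmetric.belief_neg (hs : S.IsSymmetric) (y : ℝ) :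
    S.belief (-y) = (S.belief y).map fun θ => -θ := by
  cases S with
  | signal G =>
    have hs : G.map (fun γ => -γ) = G := hs
    change G.map _ = (G.map _).map _
    conv_lhs => rw [← hs]
    rw [Measure.map_map (by fun_prop) (by fun_prop), Measure.map_map (by fun_prop) (by fun_prop)]
    congr 1; ext γ; simp; ring
  | diffuse => exact (Measure.map_neg_eq_self (volume : Measure ℝ)).symm

lemma SideInfo.IsSymmetric.law_zero_neg (hs : S.IsSymmetric) :
    (S.law 0).map (fun y => -y) = S.law 0 := by
  cases S with
  | signal G =>
    have hs : G.map (fun γ => -γ) = G := hs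
    simpa [SideInfo.law] using hs
  | diffuse => simp [SideInfo.law, Measure.map_dirac]

lemma likelihood_neg (hf : WellBehaved f) (x : Fin n → ℝ) (θ : ℝ) :
    likelihood f (fun i => -x i) (-θ) = likelihood f x θ := by
  refine Finset.prod_congr rfl fun i _ => ?_
  rw [← hf.symmetric]; congr 1; ring

lemma posteriorMean_neg (hf : WellBehaved f) (hs : S.IsSymmetric) (x : Fin n → ℝ) (y : ℝ) :
    posteriorMean f S (fun i => -x i) (-y) = -posteriorMean f S x y := by
  have he : MeasurableEmbedding fun θ : ℝ => -θ := (MeasurableEquiv.neg ℝ).measurableEmbedding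
  change (∫ θ, θ * likelihood f _ θ ∂_) / (∫ θ, likelihood f _ θ ∂_) =
    -((∫ θ, θ * likelihood f _ θ ∂_) / (∫ θ, likelihood f _ θ ∂_))
  rw [hs.belief_neg, he.integral_map, he.integral_map]
  simp only [likelihood_neg hf, neg_mul]
  rw [integral_neg, neg_div]

lemma noise_map_neg (hf : WellBehaved f) : (noise f).map (fun x => -x) = noise f := by
  ext s hs
  have hm : MeasurableSet ((fun x : ℝ => -x) ⁻¹' s) := hs.preimage measurable_neg
  rw [Measure.map_apply measurable_neg hs, noise, withDensity_apply _ hm, withDensity_apply _ hs,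
    ← lintegral_indicator hm, ← lintegral_indicator hs, ← lintegral_neg_eq_self]
  refine lintegral_congr fun x => ?_
  by_cases h : x ∈ s <;> simp [Set.indicator, h, hf.symmetric]

lemma measurePreserving_neg_zeroLaw (hf : WellBehaved f) (hS : S.IsProper) (hs : S.IsSymmetric) :
    MeasurePreserving (fun ω : (Fin n → ℝ) × ℝ => ((fun i => -ω.1 i), -ω.2)) (zeroLaw f S n)
      (zeroLaw f S n) := by
  have := hf.isProbabilityMeasure
  have := hS.isProbabilityMeasure_law 0
  refine ⟨by fun_prop, ?_⟩
  have h1 : (Measure.pi fun _ : Fin n => noise f).map (fun x i => -x i) =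
      Measure.pi fun _ : Fin n => noise f := by
    have h := Measure.pi_map_pi (μ := fun _ : Fin n => noise f) (f := fun _ x => -x)
      (hμ := fun _ => by rw [noise_map_neg hf]; infer_instance) fun _ => by fun_prop
    rw [h, noise_map_neg hf]
  have h2 := Measure.map_prod_map (Measure.pi fun _ : Fin n => noise f) (S.law 0)
    (f := fun x i => -x i) (g := fun y => -y) (by fun_prop) (by fun_prop)
  rw [h1, hs.law_zero_neg] at h2
  exact h2.symm

lemma bias_nearestScheme (hf : WellBehaved f) (hS : S.IsProper) (hn : 1 ≤ n) (hs : S.IsSymmetric)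
    (θ : ℝ) : bias f S (nearestScheme f S hn) θ = 0 := by
  have hsch := isScheme_nearestScheme hf hS hn
  rw [bias_eq hf hS hsch (isTranslationInvariant_nearestScheme hf hS hn)]
  have hneg : ∀ (x : Fin n → ℝ) y,
      nearestScheme f S hn (fun i => -x i) (-y) = -nearestScheme f S hn x y := by
    intro x y
    rw [nearestScheme, nearestScheme, nearestIndex_congr (x' := x) (y' := y)]
    intro i
    simp only [IsNearest, posteriorMean_neg hf hs, ← neg_sub', abs_neg]
  have h := (measurePreserving_neg_zeroLaw (n := n) hf hS hs).map_eq
  have h2 : ∫ ω, nearestScheme f S hn ω.1 ω.2 ∂(zeroLaw f S n) =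
      -∫ ω, nearestScheme f S hn ω.1 ω.2 ∂(zeroLaw f S n) := by
    conv_lhs => rw [← h]
    rw [integral_map (by fun_prop) hsch.measurable.aestronglyMeasurable, ← integral_neg]
    simp only [hneg]
  linarith

/-- Without ties all closest-anecdote schemes are unbiased. -/
lemma bias_eq_zero_of_noTies (hf : WellBehaved f) (hS : S.IsProper) (hn : 1 ≤ n)
    {π : (Fin n → ℝ) → ℝ → ℝ} (hc : IsTargeting f S 0 π) (hs : S.IsSymmetric) (θ : ℝ)
    (h : NoTies f S n θ) : bias f S π θ = 0 := by
  rw [← bias_nearestScheme hf hS hn hs θ]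
  refine integral_congr_ae ?_
  filter_upwards [h] with ω hω
  obtain ⟨i, hi, hle⟩ := hc ω.1 ω.2
  simp only [add_zero] at hle
  rw [hi, nearestScheme, hω i _ (le_antisymm (hle _) (isNearest_nearestIndex f S hn ω.1 ω.2 i))]

end Existence

/-! ### Concentration of the sample mean and of the posterior; tilted means. -/

section Concentration

variable {f : ℝ → ℝ} {S : SideInfo} {n : ℕ}

/-- The sample mean. -/
def sampleMean {n : ℕ} (x : Fin n → ℝ) : ℝ := (∑ i, x i) / n

lemma measurable_sampleMean : Measurable (sampleMean : (Fin n → ℝ) → ℝ) := by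
  unfold sampleMean; fun_prop

lemma sampleMean_add (hn : 1 ≤ n) (x : Fin n → ℝ) (δ : ℝ) :
    sampleMean (fun i => x i + δ) = sampleMean x + δ := by
  have : (n : ℝ) ≠ 0 := by positivity
  simp only [sampleMean, Finset.sum_add_distrib, Finset.sum_const, Finset.card_univ,
    Fintype.card_fin, nsmul_eq_mul]
  field_simp

lemma lintegral_exp_sum_le (hf : WellBehaved f) (hS : S.IsProper) {C l : ℝ}
    (hC : ∀ l : ℝ, |l| ≤ 1 / 2 → Integrable (fun x => Real.exp (l * x)) (noise f) ∧
      ∫ x, Real.exp (l * x) ∂(noise f) ≤ Real.exp (C * l ^ 2)) (hl : |l| ≤ 1 / 2) :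
    ∫⁻ ω, ENNReal.ofReal (Real.exp (l * ∑ i, ω.1 i)) ∂(zeroLaw f S n) ≤
      ENNReal.ofReal (Real.exp (n * (C * l ^ 2))) := by
  have := hf.isProbabilityMeasure
  have := hS.isProbabilityMeasure_law 0
  obtain ⟨hi, hle⟩ := hC l hl
  have hm : Measurable fun x : Fin n → ℝ => ENNReal.ofReal (Real.exp (l * ∑ i, x i)) := by
    fun_prop
  have h1 : ∫⁻ ω, ENNReal.ofReal (Real.exp (l * ∑ i, ω.1 i)) ∂(zeroLaw f S n) =
      ∫⁻ x, ENNReal.ofReal (Real.exp (l * ∑ i, x i)) ∂(Measure.pi fun _ : Fin n => noise f) :=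
    measurePreserving_fst.lintegral_comp hm
  have h2 : ∀ x : Fin n → ℝ, Real.exp (l * ∑ i, x i) = ∏ i, Real.exp (l * x i) := fun x => by
    rw [Finset.mul_sum, Real.exp_sum]
  rw [h1]
  simp_rw [h2]
  rw [← ofReal_integral_eq_lintegral_ofReal
    (Integrable.fintype_prod (f := fun _ x => Real.exp (l * x)) fun _ => hi)
    (ae_of_all _ fun x => Finset.prod_nonneg fun i _ => (Real.exp_pos _).le),
    integral_fintype_prod_eq_prod (fun _ x => Real.exp (l * x))]
  refine ENNReal.ofReal_le_ofReal ?_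
  rw [Finset.prod_const, Finset.card_univ, Fintype.card_fin, Real.exp_nat_mul]
  exact pow_le_pow_left₀ (integral_nonneg fun x => (Real.exp_pos _).le) hle n

/-- The sample mean concentrates at scale `1 / √n`. -/
lemma WellBehaved.exists_lintegral_exp_sampleMean_le (hf : WellBehaved f) :
    ∃ C : ℝ, 0 < C ∧ ∀ (S : SideInfo) (n : ℕ) (a : ℝ), S.IsProper → 1 ≤ n → 0 ≤ a →
      a ^ 2 ≤ n / 4 →
      ∫⁻ ω, ENNReal.ofReal (Real.exp (a * |sampleMean ω.1|)) ∂(zeroLaw f S n) ≤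
        ENNReal.ofReal C := by
  obtain ⟨C, hC, hle⟩ := hf.exists_mgf_le
  refine ⟨2 * Real.exp (C / 4), by positivity, fun S n a hS hn ha han => ?_⟩
  have hn' : (1 : ℝ) ≤ n := by exact_mod_cast hn
  -- The assumption a ≤ √n / 2 keeps the parameter a / n in the range of the moment generating bound
  -- and makes the total exponent n C (a / n)² at most C / 4.
  have hl : a / n ≤ 1 / 2 := by
    rw [div_le_iff₀ (by linarith)]
    nlinarith
  have key : ∀ l : ℝ, |l| = a / n →
      ∫⁻ ω, ENNReal.ofReal (Real.exp (l * ∑ i, ω.1 i)) ∂(zeroLaw f S n) ≤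
      ENNReal.ofReal (Real.exp (C / 4)) := by
    intro l hla
    refine (lintegral_exp_sum_le hf hS hle (hla ▸ hl)).trans
      (ENNReal.ofReal_le_ofReal (Real.exp_le_exp.2 ?_))
    rw [← sq_abs, hla]
    have : (n : ℝ) * (C * (a / n) ^ 2) = C * (a ^ 2 / n) := by field_simp
    rw [this]
    have : a ^ 2 / n ≤ 1 / 4 := by rw [div_le_iff₀ (by linarith)]; linarith
    nlinarith
  have hm : Measurable fun ω : (Fin n → ℝ) × ℝ =>
    ENNReal.ofReal (Real.exp (a / n * ∑ i, ω.1 i)) := by fun_prop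
  calc ∫⁻ ω, ENNReal.ofReal (Real.exp (a * |sampleMean ω.1|)) ∂(zeroLaw f S n)
      ≤ ∫⁻ ω, (ENNReal.ofReal (Real.exp (a / n * ∑ i, ω.1 i)) +
        ENNReal.ofReal (Real.exp (-(a / n) * ∑ i, ω.1 i))) ∂(zeroLaw f S n) := by
        refine lintegral_mono fun ω => ?_
        rw [← ENNReal.ofReal_add (Real.exp_pos _).le (Real.exp_pos _).le]
        refine ENNReal.ofReal_le_ofReal ?_
        have e1 : a / n * ∑ i, ω.1 i = a * sampleMean ω.1 := by rw [sampleMean]; ring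
        rw [neg_mul, e1]
        rcases abs_cases (sampleMean ω.1) with ⟨h, _⟩ | ⟨h, _⟩ <;> rw [h]
        · linarith [Real.exp_pos (-(a * sampleMean ω.1))]
        · rw [mul_neg]; linarith [Real.exp_pos (a * sampleMean ω.1)]
    _ ≤ ENNReal.ofReal (Real.exp (C / 4)) + ENNReal.ofReal (Real.exp (C / 4)) := by
        rw [lintegral_add_left hm]
        exact add_le_add (key _ (abs_of_nonneg (by positivity)))
          (key _ (by rw [abs_neg, abs_of_nonneg (by positivity)]))
    _ = _ := by rw [← ENNReal.ofReal_add (by positivity) (by positivity), two_mul]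

/-- The exponential of the distance to `m`, cut off at distance `s`. -/
def farExp (s m t : ℝ) : ℝ := if s < |t - m| then Real.exp |t - m| else 0

lemma farExp_nonneg (s m t : ℝ) : 0 ≤ farExp s m t := by
  unfold farExp; split_ifs <;> positivity

lemma measurable_farExp (s : ℝ) : Measurable fun p : ℝ × ℝ => farExp s p.1 p.2 := by
  unfold farExp
  refine Measurable.ite (measurableSet_lt measurable_const (by fun_prop)) (by fun_prop)
    measurable_const

/-- The posterior is concentrated at distance `s` from the sample mean, which is itself within `s`
of the state `0`. -/
def concentrated (f : ℝ → ℝ) (S : SideInfo) (n : ℕ) (s q : ℝ) : Set ((Fin n → ℝ) × ℝ) :=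
  {ω | |sampleMean ω.1| ≤ s ∧
    ∫⁻ t, ENNReal.ofReal (farExp s (sampleMean ω.1) t) ∂(posterior f S ω.1 ω.2) ≤
      ENNReal.ofReal q}

lemma measurable_lintegral_farExp (hf : WellBehaved f) (hS : S.IsProper) (s : ℝ) :
    Measurable fun ω : (Fin n → ℝ) × ℝ =>
      ∫⁻ t, ENNReal.ofReal (farExp s (sampleMean ω.1) t) ∂(posterior f S ω.1 ω.2) :=
  measurable_lintegral_posterior hf hS
    (g := fun ω t => ENNReal.ofReal (farExp s (sampleMean ω.1) t))
    ((measurable_farExp s).comp (f := fun p : ((Fin n → ℝ) × ℝ) × ℝ => (sampleMean p.1.1, p.2))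
      (by have := measurable_sampleMean (n := n); fun_prop)).ennreal_ofReal

lemma measurableSet_concentrated (hf : WellBehaved f) (hS : S.IsProper) (s q : ℝ) :
    MeasurableSet (concentrated f S n s q) := by
  have h1 : Measurable fun ω : (Fin n → ℝ) × ℝ => |sampleMean ω.1| :=
    (measurable_sampleMean.comp measurable_fst).abs
  exact (measurableSet_le h1 measurable_const).inter
    (measurableSet_le (measurable_lintegral_farExp hf hS s) measurable_const)

lemma WellBehaved.exists_measure_compl_concentrated_le (hf : WellBehaved f) :
    ∃ C : ℝ, 0 < C ∧ ∀ (S : SideInfo) (n : ℕ) (L : ℝ), S.IsProper → 1 ≤ n → 2 ≤ L →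
      (n : ℝ) = L ^ 12 →
      zeroLaw f S n (concentrated f S n (L ^ 5)⁻¹ (L ^ 24)⁻¹)ᶜ ≤
        ENNReal.ofReal (C * (L ^ 24 * Real.exp (-(L / 4)))) := by
  obtain ⟨C, hC, hle⟩ := hf.exists_lintegral_exp_sampleMean_le
  refine ⟨2 * C, by positivity, fun S n L hS hn hL hnL => ?_⟩
  have := hS.isProbabilityMeasure_zeroLaw (n := n) hf
  have hL0 : 0 < L := by linarith
  set s := (L ^ 5)⁻¹ with hs
  have hs0 : 0 < s := by positivity
  -- L ^ 6 / 2 = √n / 2 is the largest admissible exponent.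
  have hI := hle S n (L ^ 6 / 2) hS hn (by positivity) (by rw [hnL]; apply le_of_eq; ring)
  have hmean : Measurable fun ω : (Fin n → ℝ) × ℝ => sampleMean ω.1 :=
    measurable_sampleMean.comp measurable_fst
  -- expected mass of the far region
  have hfar : ∀ u : ℝ, farExp s u 0 ≤
      Real.exp (-(L / 4)) * Real.exp (L ^ 6 / 2 * |u|) := by
    intro u
    unfold farExp
    split_ifs with h
    · rw [zero_sub, abs_neg] at h ⊢
      rw [← Real.exp_add]
      refine Real.exp_le_exp.2 ?_
      -- Beyond s, half of the exponent L ^ 6 |u| / 2 pays for the factor exp(-L / 4), and the other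
      -- half dominates |u| because L ^ 6 / 4 ≥ 16.
      have h1 : L ^ 6 * s = L := by rw [hs]; field_simp
      have h2 : (64 : ℝ) ≤ L ^ 6 := by
        calc (64 : ℝ) = 2 ^ 6 := by norm_num
          _ ≤ L ^ 6 := by gcongr
      have h3 : L ^ 6 * s ≤ L ^ 6 * |u| := by gcongr
      nlinarith [abs_nonneg u]
    · positivity
  have hlint : ∫⁻ ω, ENNReal.ofReal (farExp s (sampleMean ω.1) 0) ∂(zeroLaw f S n) ≤
      ENNReal.ofReal (Real.exp (-(L / 4)) * C) := by
    calc _ ≤ ∫⁻ ω, ENNReal.ofReal (Real.exp (-(L / 4))) *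
          ENNReal.ofReal (Real.exp (L ^ 6 / 2 * |sampleMean ω.1|)) ∂(zeroLaw f S n) := by
          refine lintegral_mono fun ω => ?_
          rw [← ENNReal.ofReal_mul (Real.exp_pos _).le]
          exact ENNReal.ofReal_le_ofReal (hfar _)
      _ = ENNReal.ofReal (Real.exp (-(L / 4))) *
          ∫⁻ ω, ENNReal.ofReal (Real.exp (L ^ 6 / 2 * |sampleMean ω.1|)) ∂(zeroLaw f S n) :=
          lintegral_const_mul _ (by fun_prop)
      _ ≤ ENNReal.ofReal (Real.exp (-(L / 4))) * ENNReal.ofReal C := by gcongr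
      _ = _ := (ENNReal.ofReal_mul (Real.exp_pos _).le).symm
  -- The expected weighted posterior mass far from the sample mean equals the same weight evaluated
  -- at the true state. Concentration of the sample mean therefore gives posterior concentration by
  -- Markov's inequality, with no assumption on G.
  have hKI := lintegral_posterior_zeroLaw hf hS hn
    (h := fun x _ t => ENNReal.ofReal (farExp s (sampleMean x) t))
    ((measurable_farExp s).comp (f := fun p : ((Fin n → ℝ) × ℝ) × ℝ => (sampleMean p.1.1, p.2))
      (by have := measurable_sampleMean (n := n); fun_prop)).ennreal_ofReal
    (fun x y t δ => by simp [farExp, sampleMean_add hn]) (fun _ _ _ _ _ => rfl)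
  have hb1 : zeroLaw f S n {ω | s < |sampleMean ω.1|} ≤
      ENNReal.ofReal (Real.exp (-(L / 4)) * C) := by
    refine le_trans ?_ hlint
    rw [← lintegral_indicator_one (measurableSet_lt measurable_const hmean.abs)]
    refine lintegral_mono fun ω => ?_
    by_cases hω : s < |sampleMean ω.1|
    · simp only [Set.indicator_apply, Set.mem_ofPred_eq, farExp, zero_sub, abs_neg, hω, if_true,
        Pi.one_apply, ENNReal.one_le_ofReal]
      exact Real.one_le_exp (abs_nonneg _)
    · simp [hω]
  have hb2 : zeroLaw f S n {ω | ENNReal.ofReal (L ^ 24)⁻¹ ≤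
      ∫⁻ t, ENNReal.ofReal (farExp s (sampleMean ω.1) t) ∂(posterior f S ω.1 ω.2)} ≤
      ENNReal.ofReal (L ^ 24 * (Real.exp (-(L / 4)) * C)) := by
    refine (meas_ge_le_lintegral_div (measurable_lintegral_farExp hf hS s).aemeasurable
      (by simp; positivity) ENNReal.ofReal_ne_top).trans ?_
    rw [hKI, ENNReal.ofReal_inv_of_pos (by positivity), ENNReal.div_eq_inv_mul, inv_inv,
      ENNReal.ofReal_mul (by positivity)]
    gcongr
  calc _ ≤ zeroLaw f S n ({ω | s < |sampleMean ω.1|} ∪ {ω | ENNReal.ofReal (L ^ 24)⁻¹ ≤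
        ∫⁻ t, ENNReal.ofReal (farExp s (sampleMean ω.1) t) ∂(posterior f S ω.1 ω.2)}) := by
        refine measure_mono fun ω hω => ?_
        simp only [concentrated, Set.mem_compl_iff, Set.mem_ofPred_eq, not_and_or, not_le] at hω
        exact hω.imp id le_of_lt
    _ ≤ _ := (measure_union_le _ _).trans (add_le_add hb1 hb2)
    _ = ENNReal.ofReal (Real.exp (-(L / 4)) * C + L ^ 24 * (Real.exp (-(L / 4)) * C)) :=
        (ENNReal.ofReal_add (by positivity) (by positivity)).symm
    _ ≤ _ := by
        refine ENNReal.ofReal_le_ofReal ?_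
        have h1 : (1 : ℝ) ≤ L ^ 24 := one_le_pow₀ (by linarith)
        have h2 : 0 < Real.exp (-(L / 4)) * C := by positivity
        nlinarith

/-- A small exponential tilt hardly moves the mean of a concentrated distribution. -/
lemma abs_tilted_mean_sub_le {p : Measure ℝ} [IsProbabilityMeasure p] {m s a q : ℝ} {H : ℝ → ℝ}
    (hH : Measurable H) (ha : 0 ≤ a) (ha' : a ≤ 1 / 8) (hs : 0 ≤ s) (hs' : s ≤ 1)
    (hq : 0 ≤ q) (hq' : q ≤ 1 / 4) (hqs : q ≤ s)
    (hle : ∀ t, |H t| ≤ a * (1 + |t - m|))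
    (hfar : ∫⁻ t, ENNReal.ofReal (farExp s m t) ∂p ≤ ENNReal.ofReal q) :
    |(∫ t, t * Real.exp (H t) ∂p) / (∫ t, Real.exp (H t) ∂p) - ∫ t, t ∂p| ≤
      48 * s * a + 80 * q ∧ |∫ t, t ∂p - m| ≤ 2 * s := by
  have mfar : Measurable (farExp s m) := (measurable_farExp s).comp measurable_prodMk_left
  have ifar : Integrable (farExp s m) p := by
    refine ⟨mfar.aestronglyMeasurable, ?_⟩
    rw [hasFiniteIntegral_iff_ofReal (ae_of_all _ (farExp_nonneg s m))]
    exact hfar.trans_lt ENNReal.ofReal_lt_top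
  have vfar : ∫ t, farExp s m t ∂p ≤ q := by
    rw [integral_eq_lintegral_of_nonneg_ae (ae_of_all _ (farExp_nonneg s m))
      mfar.aestronglyMeasurable]
    exact ENNReal.toReal_le_of_le_ofReal hq hfar
  -- All integrability claims below follow from this bound: near m the exponential is below e since
  -- s ≤ 1, elsewhere it is the far weight.
  have dom : ∀ t, Real.exp |t - m| ≤ 3 + farExp s m t := by
    intro t
    unfold farExp
    split_ifs with h
    · linarith
    · have h1 : Real.exp |t - m| ≤ Real.exp 1 := Real.exp_le_exp.2 (by linarith)
      linarith [Real.exp_one_lt_d9]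
  have idom : ∀ {g : ℝ → ℝ} (K : ℝ), Measurable g → (∀ t, |g t| ≤ K * Real.exp |t - m|) →
      Integrable g p := by
    intro g K hg hgle
    have hK : 0 ≤ K := by
      have := (abs_nonneg _).trans (hgle m)
      simpa using this
    refine (((integrable_const 3).add ifar).const_mul K).mono' hg.aestronglyMeasurable
      (ae_of_all _ fun t => (hgle t).trans ?_)
    exact mul_le_mul_of_nonneg_left (dom t) hK
  have iabs : Integrable (fun t => |t - m|) p := idom 1 (by fun_prop) fun t => by
    rw [abs_abs, one_mul]; linarith [Real.add_one_le_exp |t - m|]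
  have isub : Integrable (fun t => t - m) p := idom 1 (by fun_prop) fun t => by
    rw [one_mul]; linarith [Real.add_one_le_exp |t - m|]
  have iid : Integrable (fun t : ℝ => t) p := by
    exact (isub.add (integrable_const m)).congr (ae_of_all _ fun t => by simp)
  have hexp8 : Real.exp (1 / 8) ≤ 6 / 5 := by
    have := Real.exp_bound_div_one_sub_of_interval (x := 1 / 8) (by norm_num) (by norm_num)
    refine this.trans (by norm_num)
  have hHexp : ∀ t, Real.exp (H t) ≤ 2 * Real.exp (1 / 2 * |t - m|) := by
    intro t
    have h1 : H t ≤ 1 / 8 + 1 / 2 * |t - m| := by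
      have := (le_abs_self _).trans (hle t)
      nlinarith [abs_nonneg (t - m)]
    calc Real.exp (H t) ≤ Real.exp (1 / 8 + 1 / 2 * |t - m|) := Real.exp_le_exp.2 h1
      _ = Real.exp (1 / 8) * Real.exp (1 / 2 * |t - m|) := Real.exp_add _ _
      _ ≤ _ := by gcongr; linarith
  have habs2 : ∀ t, |t - m| ≤ 2 * Real.exp (1 / 2 * |t - m|) := fun t => by
    linarith [Real.add_one_le_exp (1 / 2 * |t - m|)]
  have hhalf : ∀ t, Real.exp (1 / 2 * |t - m|) * Real.exp (1 / 2 * |t - m|) =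
      Real.exp |t - m| := fun t => by rw [← Real.exp_add]; ring_nf
  have hhalf1 : ∀ t, 1 ≤ Real.exp (1 / 2 * |t - m|) := fun t => Real.one_le_exp (by positivity)
  have iexp : Integrable (fun t => Real.exp (H t)) p := idom 2 (by fun_prop) fun t => by
    rw [Real.abs_exp, ← hhalf]
    nlinarith [hHexp t, hhalf1 t]
  have isubexp : Integrable (fun t => (t - m) * Real.exp (H t)) p :=
    idom 4 (by fun_prop) fun t => by
      rw [abs_mul, Real.abs_exp, ← hhalf]
      calc _ ≤ (2 * Real.exp (1 / 2 * |t - m|)) * (2 * Real.exp (1 / 2 * |t - m|)) :=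
            mul_le_mul (habs2 t) (hHexp t) (Real.exp_pos _).le (by positivity)
        _ = _ := by ring
  have iidexp : Integrable (fun t => t * Real.exp (H t)) p := by
    have := isubexp.add (iexp.const_mul m)
    refine this.congr (ae_of_all _ fun t => ?_)
    simp only [Pi.add_apply]; ring
  set T := ∫ t, t ∂p with hT
  have hTm : |T - m| ≤ 2 * s := by
    have h1 : T - m = ∫ t, (t - m) ∂p := by
      rw [integral_sub iid (integrable_const m)]; simp [hT]
    rw [h1]
    calc |∫ t, (t - m) ∂p| ≤ ∫ t, |t - m| ∂p := abs_integral_le_integral_abs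
      _ ≤ ∫ t, (s + farExp s m t) ∂p := by
          refine integral_mono iabs ((integrable_const s).add ifar) fun t => ?_
          simp only [farExp]
          split_ifs with h
          · linarith [Real.add_one_le_exp |t - m|]
          · linarith
      _ ≤ 2 * s := by
          rw [integral_add (integrable_const s) ifar]; simp; linarith
  refine ⟨?_, hTm⟩
  -- Near m the tilt satisfies |H| ≤ 1/4, so exp H ≥ 3/4. The far region costs at most q ≤ 1/4.
  have hZ : 1 / 2 ≤ ∫ t, Real.exp (H t) ∂p := by
    have h1 : ∫ t, (3 / 4 - farExp s m t) ∂p ≤ ∫ t, Real.exp (H t) ∂p := by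
      refine integral_mono ((integrable_const _).sub ifar) iexp fun t => ?_
      simp only [farExp]
      split_ifs with h
      · have := Real.one_le_exp (abs_nonneg (t - m))
        linarith [Real.exp_pos (H t)]
      · push Not at h
        have h2 := neg_abs_le (H t)
        have h3 : |H t| ≤ 1 / 4 := (hle t).trans (by nlinarith [abs_nonneg (t - m)])
        linarith [Real.add_one_le_exp (H t)]
    rw [integral_sub (integrable_const _) ifar] at h1
    simp only [integral_const, probReal_univ, smul_eq_mul, one_mul] at h1
    linarith
  have hZ0 : 0 < ∫ t, Real.exp (H t) ∂p := by linarith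
  have inum : Integrable (fun t => (t - T) * (Real.exp (H t) - 1)) p := by
    have : (fun t => (t - T) * (Real.exp (H t) - 1)) =
        fun t => (t * Real.exp (H t) - T * Real.exp (H t)) - (t - T) := by ext t; ring
    rw [this]
    exact (iidexp.sub (iexp.const_mul T)).sub (iid.sub (integrable_const T))
  -- The shift of the mean is a covariance of t with exp H - 1. Near m this gains both small
  -- factors, |t - T| ≤ 3s and |exp H - 1| ≤ 4a; far from m it is controlled by the far weight.
  have hnum : (∫ t, t * Real.exp (H t) ∂p) / (∫ t, Real.exp (H t) ∂p) - T =
      (∫ t, (t - T) * (Real.exp (H t) - 1) ∂p) / ∫ t, Real.exp (H t) ∂p := by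
    have h1 : ∫ t, (t - T) * (Real.exp (H t) - 1) ∂p =
        ∫ t, t * Real.exp (H t) ∂p - T * ∫ t, Real.exp (H t) ∂p := by
      have e : (fun t => (t - T) * (Real.exp (H t) - 1)) =
        fun t => (t * Real.exp (H t) - T * Real.exp (H t)) - (t - T) := by ext t; ring
      have i1 : Integrable (fun t => t * Real.exp (H t) - T * Real.exp (H t)) p :=
        iidexp.sub (iexp.const_mul T)
      have i2 : Integrable (fun t => t - T) p := iid.sub (integrable_const T)
      rw [e, integral_sub i1 i2,
        integral_sub iidexp (iexp.const_mul T), integral_const_mul,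
        integral_sub iid (integrable_const T)]
      simp [← hT]
    rw [h1]; field_simp
  have hbound : |∫ t, (t - T) * (Real.exp (H t) - 1) ∂p| ≤ 12 * s * a + 36 * q := by
    calc _ ≤ ∫ t, |(t - T) * (Real.exp (H t) - 1)| ∂p := abs_integral_le_integral_abs
      _ ≤ ∫ t, (12 * s * a + 36 * farExp s m t) ∂p := by
          refine integral_mono inum.abs ((integrable_const _).add (ifar.const_mul _)) fun t => ?_
          have h0 : |t - T| ≤ |t - m| + 2 * s := by
            have := abs_sub_le t m T
            rw [abs_sub_comm m T] at this
            linarith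
          simp only [abs_mul, farExp]
          split_ifs with h
          · have h1 : |t - T| ≤ 3 * |t - m| := by linarith
            have h2 : |Real.exp (H t) - 1| ≤ 3 * Real.exp (1 / 2 * |t - m|) := by
              rw [abs_le]
              constructor <;> linarith [hHexp t, hhalf1 t, Real.exp_pos (H t)]
            calc |t - T| * |Real.exp (H t) - 1|
                ≤ (3 * (2 * Real.exp (1 / 2 * |t - m|))) * (3 * Real.exp (1 / 2 * |t - m|)) := by
                  refine mul_le_mul (h1.trans ?_) h2 (abs_nonneg _) (by positivity)
                  linarith [habs2 t]
              _ = 18 * Real.exp |t - m| := by rw [← hhalf]; ring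
              _ ≤ _ := by
                  have : 0 ≤ 12 * s * a := by positivity
                  linarith [Real.exp_pos |t - m|]
          · push Not at h
            have h1 : |t - T| ≤ 3 * s := by linarith
            have h3 : |H t| ≤ 2 * a := (hle t).trans (by nlinarith [abs_nonneg (t - m)])
            have h2 : |Real.exp (H t) - 1| ≤ 4 * a := by
              have := Real.abs_exp_sub_one_le (x := H t) (by linarith)
              linarith
            calc _ ≤ (3 * s) * (4 * a) := mul_le_mul h1 h2 (abs_nonneg _) (by positivity)
              _ = _ := by ring
      _ ≤ _ := by
          rw [integral_add (integrable_const _) (ifar.const_mul _), integral_const_mul (36 : ℝ)]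
          simp only [integral_const, probReal_univ, smul_eq_mul, one_mul]
          linarith
  rw [hnum, abs_div, abs_of_pos hZ0, div_le_iff₀ hZ0]
  have : 0 ≤ 48 * s * a + 80 * q := by positivity
  nlinarith [mul_nonneg hs ha]

end Concentration

/-! ### Insensitivity of the posterior mean, and resampling inside a cell. -/

section Resampling

variable {f : ℝ → ℝ} {S : SideInfo} {n : ℕ}

open Classical in
/-- The number of anecdotes in `C`. -/
def cellCount (C : Set ℝ) {n : ℕ} (x : Fin n → ℝ) : ℕ := (Finset.univ.filter fun i => x i ∈ C).card

open Classical in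
/-- Replace the anecdotes in `C` by those of `x'`. -/
def replaceIn (C : Set ℝ) {n : ℕ} (x x' : Fin n → ℝ) (i : Fin n) : ℝ :=
  if x i ∈ C then x' i else x i

lemma log_likelihood (hf : WellBehaved f) (x : Fin n → ℝ) (t : ℝ) :
    Real.log (likelihood f x t) = ∑ i, Real.log (f (x i - t)) :=
  Real.log_prod fun _ _ => (hf.pos _).ne'

/-- The posterior given x' is an exponential tilt of the posterior given x by the difference of
log-likelihoods, so the tilting estimate applies to changes of the sample. -/
lemma posteriorMean_eq_tilted (hf : WellBehaved f) (hS : S.IsProper) (hn : 1 ≤ n)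
    (x x' : Fin n → ℝ) (y : ℝ) :
    posteriorMean f S x' y =
      (∫ t, t * Real.exp (Real.log (likelihood f x' t) - Real.log (likelihood f x t))
        ∂(posterior f S x y)) /
      ∫ t, Real.exp (Real.log (likelihood f x' t) - Real.log (likelihood f x t))
        ∂(posterior f S x y) := by
  have hZ := (integral_likelihood_pos hf hS hn x y).ne'
  have h : ∀ t, Real.exp (Real.log (likelihood f x' t) - Real.log (likelihood f x t)) *
      likelihood f x t = likelihood f x' t := fun t => by
    rw [Real.exp_sub, Real.exp_log (likelihood_pos hf x' t), Real.exp_log (likelihood_pos hf x t),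
      div_mul_cancel₀ _ (likelihood_pos hf x t).ne']
  rw [integral_posterior hf, integral_posterior hf, div_div_div_cancel_right₀ hZ]
  simp only [mul_assoc, h]
  rfl

/-- Only anecdotes in the cell contribute, each moving by at most 2H. The Lipschitz constant of log
f grows linearly, hence the factor linear in |t - m|, the growth permitted in
`abs_tilted_mean_sub_le`. -/
lemma abs_log_likelihood_sub_le (hf : WellBehaved f) {A : ℝ} (hA : 0 < A)
    (hlip : ∀ x y B : ℝ, |x| ≤ B → |y| ≤ B →
      |Real.log (f x) - Real.log (f y)| ≤ A * (1 + B) * |x - y|)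
    {c H m t : ℝ} {x x' : Fin n → ℝ} (hH : 0 ≤ H)
    (hx : ∀ i, x i ∉ Set.Icc (c - H) (c + H) → x' i = x i)
    (hx' : ∀ i, x i ∈ Set.Icc (c - H) (c + H) → x' i ∈ Set.Icc (c - H) (c + H)) :
    |Real.log (likelihood f x' t) - Real.log (likelihood f x t)| ≤
      cellCount (Set.Icc (c - H) (c + H)) x * (A * (1 + (|c| + H + |m| + |t - m|)) * (2 * H)) := by
  classical
  rw [log_likelihood hf, log_likelihood hf, ← Finset.sum_sub_distrib, cellCount,
    ← nsmul_eq_mul, ← Finset.sum_const, Finset.sum_filter]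
  refine (Finset.abs_sum_le_sum_abs _ _).trans (Finset.sum_le_sum fun i _ => ?_)
  have hb : ∀ z ∈ Set.Icc (c - H) (c + H), |z - t| ≤ |c| + H + |m| + |t - m| := by
    intro z hz
    have h1 : |z - c| ≤ H := abs_le.2 ⟨by linarith [hz.1], by linarith [hz.2]⟩
    have h2 : z - t = (z - c) + c + (-m) + (-(t - m)) := by ring
    rw [h2]
    have h3 := abs_add_le ((z - c) + c + (-m)) (-(t - m))
    have h4 := abs_add_le ((z - c) + c) (-m)
    have h5 := abs_add_le (z - c) c
    rw [abs_neg] at h3 h4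
    linarith
  split_ifs with h
  · refine (hlip _ _ _ (hb _ (hx' i h)) (hb _ h)).trans ?_
    have h1 : |x' i - t - (x i - t)| ≤ 2 * H := by
      have h2 := hx' i h
      rw [abs_le]
      constructor <;> linarith [h2.1, h2.2, h.1, h.2]
    have : 0 ≤ A * (1 + (|c| + H + |m| + |t - m|)) := by positivity
    gcongr
  · rw [hx i h]; simp

/-- Moving the anecdotes inside a small cell hardly moves a concentrated posterior mean. -/
lemma WellBehaved.exists_abs_posteriorMean_sub_le (hf : WellBehaved f) :
    ∃ K L₀ : ℝ, 0 < K ∧ 2 ≤ L₀ ∧ ∀ (S : SideInfo) (n : ℕ) (L : ℝ), S.IsProper → 1 ≤ n → L₀ ≤ L →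
      ∀ ω ∈ concentrated f S n (L ^ 5)⁻¹ (L ^ 24)⁻¹, ∀ c : ℝ, |c| ≤ 2 * L →
      ∀ C : Set ℝ, C = Set.Icc (c - (L ^ 11)⁻¹) (c + (L ^ 11)⁻¹) →
      (cellCount C ω.1 : ℝ) ≤ 4 * f 0 * L →
      ∀ x' : Fin n → ℝ, (∀ i, ω.1 i ∉ C → x' i = ω.1 i) → (∀ i, ω.1 i ∈ C → x' i ∈ C) →
      |posteriorMean f S x' ω.2 - posteriorMean f S ω.1 ω.2| ≤ K * (L ^ 14)⁻¹ ∧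
      |posteriorMean f S ω.1 ω.2| ≤ 3 * (L ^ 5)⁻¹ := by
  obtain ⟨A, hA, hlip⟩ := hf.exists_log_lipschitz
  have hf0 := hf.pos 0
  -- With s = L^-5 and a = 40 f(0) A L^-9, the tilting bound 48 s a + 80 q is at most (1920 f(0) A +
  -- 80) L^-14. The threshold 320 f(0) A for L ensures a ≤ 1/8.
  refine ⟨1920 * f 0 * A + 80, max 2 (320 * f 0 * A), by positivity, le_max_left _ _, ?_⟩
  intro S n L hS hn hL ω hω c hc C hC hcount x' hx hx'
  have hL2 : 2 ≤ L := (le_max_left _ _).trans hL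
  have hLA : 320 * f 0 * A ≤ L := (le_max_right _ _).trans hL
  have hL0 : 0 < L := by linarith
  have hp : ∀ k : ℕ, (1 : ℝ) ≤ L ^ k := fun k => one_le_pow₀ (by linarith)
  have hpi : ∀ k : ℕ, (L ^ k)⁻¹ ≤ 1 := fun k => inv_le_one_of_one_le₀ (hp k)
  have := isProbabilityMeasure_posterior hf hS hn ω.1 ω.2
  set m := sampleMean ω.1
  set s := (L ^ 5)⁻¹ with hs
  -- Product of the count 4 f(0) L, the Lipschitz constant 5 A L and the displacement 2 L^-11.
  set a := 40 * f 0 * A * (L ^ 9)⁻¹ with ha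
  have hle : ∀ t, |Real.log (likelihood f x' t) - Real.log (likelihood f ω.1 t)| ≤
      a * (1 + |t - m|) := by
    intro t
    subst hC
    refine (abs_log_likelihood_sub_le hf hA hlip (m := m) (inv_nonneg.2 (by positivity))
      hx hx').trans ?_
    have h1 : 1 + (|c| + (L ^ 11)⁻¹ + |m| + |t - m|) ≤ 5 * L * (1 + |t - m|) := by
      have h2 : |m| ≤ 1 := hω.1.trans (hpi 5)
      nlinarith [abs_nonneg (t - m), hpi 11]
    calc _ ≤ (4 * f 0 * L) * (A * (5 * L * (1 + |t - m|)) * (2 * (L ^ 11)⁻¹)) := by gcongr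
      _ = a * (1 + |t - m|) := by rw [ha]; field_simp; ring
  have ha8 : a ≤ 1 / 8 := by
    rw [ha, ← div_eq_mul_inv, div_le_iff₀ (by positivity)]
    have : L ≤ L ^ 9 := le_self_pow₀ (by linarith) (by norm_num)
    linarith
  have hqs : (L ^ 24)⁻¹ ≤ s := by
    rw [hs]; gcongr
    · linarith
    · norm_num
  have hq4 : (L ^ 24)⁻¹ ≤ 1 / 4 := by
    rw [one_div]; gcongr
    calc (4 : ℝ) ≤ 2 ^ 24 := by norm_num
      _ ≤ L ^ 24 := by gcongr
  have hH : Measurable fun t => Real.log (likelihood f x' t) - Real.log (likelihood f ω.1 t) :=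
    (Real.measurable_log.comp (continuous_likelihood hf x').measurable).sub
      (Real.measurable_log.comp (continuous_likelihood hf ω.1).measurable)
  have key := abs_tilted_mean_sub_le hH (p := posterior f S ω.1 ω.2) (by positivity) ha8
    (by positivity) (hpi 5) (by positivity) hq4 hqs hle hω.2
  rw [← posteriorMean_eq_tilted hf hS hn, ← posteriorMean_eq hf] at key
  refine ⟨key.1.trans ?_, ?_⟩
  · have h14 : (L ^ 24)⁻¹ ≤ (L ^ 14)⁻¹ := by
      gcongr
      · linarith
      · norm_num
    have e : 48 * s * a = 1920 * f 0 * A * (L ^ 14)⁻¹ := by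
      rw [hs, ha]; field_simp; ring
    rw [e, add_mul]
    linarith
  · have h1 := abs_sub_abs_le_abs_sub (posteriorMean f S ω.1 ω.2) m
    linarith [key.2, hω.1]

/-- Redrawing a point of C from the conditional law on C gives ν(C) ν(· | C) plus the part of ν
outside C, that is, ν again. -/
lemma measurePreserving_ite_cond {ν : Measure ℝ} [IsProbabilityMeasure ν] {C : Set ℝ}
    (hC : MeasurableSet C) (h0 : ν C ≠ 0) [DecidablePred (· ∈ C)] :
    MeasurePreserving (fun p : ℝ × ℝ => if p.1 ∈ C then p.2 else p.1) (ν.prod (ν[|C])) ν := by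
  have := cond_isProbabilityMeasure h0
  have hm : Measurable fun p : ℝ × ℝ => if p.1 ∈ C then p.2 else p.1 :=
    Measurable.ite (measurable_fst hC) measurable_snd measurable_fst
  refine ⟨hm, Measure.ext fun s hs => ?_⟩
  rw [Measure.map_apply hm hs]
  have hd : (fun p : ℝ × ℝ => if p.1 ∈ C then p.2 else p.1) ⁻¹' s =
      (C ×ˢ s) ∪ ((s \ C) ×ˢ Set.univ) := by
    ext p
    by_cases h : p.1 ∈ C <;> simp [h]
  have hdisj : Disjoint (C ×ˢ s) ((s \ C) ×ˢ (Set.univ : Set ℝ)) :=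
    Set.disjoint_prod.2 (Or.inl Set.disjoint_sdiff_right)
  rw [hd, measure_union hdisj ((hs.diff hC).prod MeasurableSet.univ), Measure.prod_prod,
    Measure.prod_prod, measure_univ, mul_one, cond_apply hC, ← mul_assoc,
    ENNReal.mul_inv_cancel h0 (measure_ne_top _ _), one_mul, Set.inter_comm,
    measure_inter_add_sdiff _ hC]

/-- Resampling the anecdotes inside `C` preserves the law of the data. -/
lemma measurePreserving_replaceIn (hf : WellBehaved f) (hS : S.IsProper) {C : Set ℝ}
    (hC : MeasurableSet C) (h0 : noise f C ≠ 0) :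
    MeasurePreserving (fun p : ((Fin n → ℝ) × ℝ) × (Fin n → ℝ) =>
      (replaceIn C p.1.1 p.2, p.1.2))
      ((zeroLaw f S n).prod (Measure.pi fun _ : Fin n => (noise f)[|C])) (zeroLaw f S n) := by
  classical
  have := hf.isProbabilityMeasure
  have := hS.isProbabilityMeasure_law 0
  have := cond_isProbabilityMeasure h0
  set ν := noise f
  set ν' := ν[|C]
  have h1 : MeasurePreserving (fun p : (Fin n → ℝ) × (Fin n → ℝ) => replaceIn C p.1 p.2)
      ((Measure.pi fun _ : Fin n => ν).prod (Measure.pi fun _ : Fin n => ν'))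
      (Measure.pi fun _ : Fin n => ν) := by
    have e1 := (measurePreserving_arrowProdEquivProdArrow ℝ ℝ (Fin n) (fun _ => ν)
      (fun _ => ν')).symm
    have e2 := measurePreserving_pi (fun _ : Fin n => ν.prod ν') (fun _ => ν)
      (f := fun _ p => if p.1 ∈ C then p.2 else p.1) (fun _ => measurePreserving_ite_cond hC h0)
    have e3 := e2.comp e1
    convert e3 using 1
    ext p i
    simp [replaceIn, MeasurableEquiv.arrowProdEquivProdArrow, Equiv.arrowProdEquivProdArrow]
  have h2 : MeasurePreserving (fun p : ((Fin n → ℝ) × ℝ) × (Fin n → ℝ) => ((p.1.1, p.2), p.1.2))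
      (((Measure.pi fun _ : Fin n => ν).prod (S.law 0)).prod (Measure.pi fun _ : Fin n => ν'))
      (((Measure.pi fun _ : Fin n => ν).prod (Measure.pi fun _ : Fin n => ν')).prod (S.law 0)) := by
    have a1 := measurePreserving_prodAssoc (Measure.pi fun _ : Fin n => ν) (S.law 0)
      (Measure.pi fun _ : Fin n => ν')
    have a2 := (MeasurePreserving.id (Measure.pi fun _ : Fin n => ν)).prod
      (Measure.measurePreserving_swap (μ := S.law 0) (ν := Measure.pi fun _ : Fin n => ν'))
    have a3 := (measurePreserving_prodAssoc (Measure.pi fun _ : Fin n => ν)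
      (Measure.pi fun _ : Fin n => ν') (S.law 0)).symm
    exact (a3.comp a2).comp a1
  exact (h1.prod (MeasurePreserving.id (S.law 0))).comp h2

/-- Bounding the probability of an event by resampling. -/
lemma measure_le_of_resample {Ω Ω' : Type*} [MeasurableSpace Ω] [MeasurableSpace Ω']
    {μ : Measure Ω} {μ' : Measure Ω'} [IsProbabilityMeasure μ] [IsProbabilityMeasure μ']
    {R : Ω × Ω' → Ω} (hR : MeasurePreserving R (μ.prod μ') μ) {A G A' D : Set Ω} {F : Set (Ω × Ω')}
    {κ : ENNReal} (hA : MeasurableSet A) (hG : MeasurableSet G) (hA' : MeasurableSet A')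
    (hD : MeasurableSet D) (hF : MeasurableSet F)
    (h1 : ∀ᵐ p ∂(μ.prod μ'), R p ∈ A → p.1 ∈ D ∧ p ∈ F)
    (h2 : ∀ ω ∈ D, μ' (Prod.mk ω ⁻¹' F) ≤ κ)
    (h3 : ∀ᵐ p ∂(μ.prod μ'), p.1 ∈ D → R p ∈ G → R p ∈ A') :
    μ A ≤ κ * (μ Gᶜ + μ A') := by
  have hDF : MeasurableSet ((Prod.fst ⁻¹' D) ∩ F) := (measurable_fst hD).inter hF
  calc μ A = (μ.prod μ') (R ⁻¹' A) := (hR.measure_preimage hA.nullMeasurableSet).symm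
    -- D concerns only the data before resampling, so Fubini extracts the factor κ. Afterwards D is
    -- carried back through R to A', at the price of the complement of G.
    _ ≤ (μ.prod μ') ((Prod.fst ⁻¹' D) ∩ F) := measure_mono_ae (by
        filter_upwards [h1] with p hp h using hp h)
    _ = ∫⁻ ω, μ' (Prod.mk ω ⁻¹' ((Prod.fst ⁻¹' D) ∩ F)) ∂μ := Measure.prod_apply hDF
    _ ≤ ∫⁻ ω, D.indicator (fun _ => κ) ω ∂μ := by
        refine lintegral_mono fun ω => ?_
        by_cases hω : ω ∈ D
        · rw [Set.indicator_of_mem hω]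
          refine le_trans (measure_mono fun x hx => ?_) (h2 ω hω)
          exact hx.2
        · rw [Set.indicator_of_notMem hω]
          refine le_of_eq (measure_mono_null (t := ∅) (fun x hx => hω hx.1) measure_empty)
    _ = κ * μ D := by rw [lintegral_indicator hD, setLIntegral_const]
    _ ≤ κ * (μ Gᶜ + μ A') := by
        gcongr
        calc μ D = (μ.prod μ') (Prod.fst ⁻¹' D) :=
              (measurePreserving_fst.measure_preimage hD.nullMeasurableSet).symm
          _ ≤ (μ.prod μ') (R ⁻¹' Gᶜ ∪ R ⁻¹' A') := measure_mono_ae (by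
              filter_upwards [h3] with p hp h
              by_cases hg : R p ∈ G
              · exact Or.inr (hp h hg)
              · exact Or.inl hg)
          _ ≤ _ := (measure_union_le _ _).trans (add_le_add
              (hR.measure_preimage hG.compl.nullMeasurableSet).le
              (hR.measure_preimage hA'.nullMeasurableSet).le)

end Resampling

/-! ### Cell counts, averaging over centers, and flatness of the density. -/

section Cells

variable {f : ℝ → ℝ} {S : SideInfo} {n : ℕ}

lemma measurable_cellCount {C : Set ℝ} (hC : MeasurableSet C) :
    Measurable fun x : Fin n → ℝ => (cellCount C x : ℝ) := by
  classical
  have h : (fun x : Fin n → ℝ => (cellCount C x : ℝ)) =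
      fun x => ∑ i, C.indicator (1 : ℝ → ℝ) (x i) := by
    ext x
    simp [cellCount, Set.indicator_apply, Finset.sum_boole]
  rw [h]
  exact Finset.measurable_sum _ fun i _ =>
    (measurable_one.indicator hC).comp (measurable_pi_apply i)

lemma lintegral_exp_cellCount_le (hf : WellBehaved f) (hS : S.IsProper) {C : Set ℝ}
    (hC : MeasurableSet C) {l : ℝ} (hl : |l| ≤ 1) :
    ∫⁻ ω, ENNReal.ofReal (Real.exp (l * cellCount C ω.1)) ∂(zeroLaw f S n) ≤
      ENNReal.ofReal (Real.exp (n * (noise f).real C * (l + l ^ 2))) := by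
  classical
  have := hf.isProbabilityMeasure
  have := hS.isProbabilityMeasure_law 0
  set ν := noise f
  set g : ℝ → ℝ := fun x => 1 + C.indicator (fun _ => Real.exp l - 1) x with hg
  have hgm : Measurable g := measurable_const.add (measurable_const.indicator hC)
  have hg0 : ∀ x, 0 ≤ g x := fun x => by
    by_cases hx : x ∈ C <;> simp [hg, hx, (Real.exp_pos l).le]
  have hgi : Integrable g ν := (integrable_const 1).add ((integrable_const _).indicator hC)
  have hgval : ∫ x, g x ∂ν = 1 + ν.real C * (Real.exp l - 1) := by
    rw [hg, integral_add (integrable_const 1) ((integrable_const _).indicator hC),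
      integral_indicator hC]
    simp
  have hexp : ∀ x : Fin n → ℝ, Real.exp (l * cellCount C x) = ∏ i, g (x i) := by
    intro x
    have h1 : ∀ i, g (x i) = Real.exp (l * if x i ∈ C then 1 else 0) := fun i => by
      by_cases hx : x i ∈ C <;> simp [hg, hx]
    simp_rw [h1]
    rw [← Real.exp_sum, ← Finset.mul_sum, Finset.sum_boole, cellCount]
  have hm : Measurable fun x : Fin n → ℝ => ENNReal.ofReal (Real.exp (l * cellCount C x)) :=
    ((measurable_cellCount hC).const_mul l).exp.ennreal_ofReal
  have h1 : ∫⁻ ω, ENNReal.ofReal (Real.exp (l * cellCount C ω.1)) ∂(zeroLaw f S n) =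
      ∫⁻ x, ENNReal.ofReal (Real.exp (l * cellCount C x)) ∂(Measure.pi fun _ : Fin n => ν) :=
    measurePreserving_fst.lintegral_comp hm
  rw [h1]
  simp_rw [hexp]
  rw [← ofReal_integral_eq_lintegral_ofReal (Integrable.fintype_prod (f := fun _ => g) fun _ => hgi)
    (ae_of_all _ fun x => Finset.prod_nonneg fun i _ => hg0 _),
    integral_fintype_prod_eq_prod (fun _ => g)]
  refine ENNReal.ofReal_le_ofReal ?_
  rw [Finset.prod_const, Finset.card_univ, Fintype.card_fin, mul_assoc, Real.exp_nat_mul]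
  refine pow_le_pow_left₀ (integral_nonneg hg0) ?_ n
  rw [hgval]
  have h2 : Real.exp l - 1 ≤ l + l ^ 2 := by
    have := Real.abs_exp_sub_one_sub_id_le hl
    linarith [le_abs_self (Real.exp l - 1 - l)]
  have h3 : ν.real C * (Real.exp l - 1) ≤ ν.real C * (l + l ^ 2) := by gcongr
  linarith [Real.add_one_le_exp (ν.real C * (l + l ^ 2))]

/-- Exponential Markov inequality for both tails at once: positive l bounds the upper tail, negative
l the lower one. -/
lemma measure_cellCount_tail_le (hf : WellBehaved f) (hS : S.IsProper) {C : Set ℝ}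
    (hC : MeasurableSet C) {l k : ℝ} (hl : |l| ≤ 1) :
    zeroLaw f S n {ω | l * k ≤ l * cellCount C ω.1} ≤
      ENNReal.ofReal (Real.exp (n * (noise f).real C * (l + l ^ 2) - l * k)) := by
  have hm : Measurable fun ω : (Fin n → ℝ) × ℝ =>
      ENNReal.ofReal (Real.exp (l * cellCount C ω.1)) :=
    (((measurable_cellCount hC).comp measurable_fst).const_mul l).exp.ennreal_ofReal
  calc _ ≤ zeroLaw f S n {ω | ENNReal.ofReal (Real.exp (l * k)) ≤
        ENNReal.ofReal (Real.exp (l * cellCount C ω.1))} := by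
        refine measure_mono fun ω hω => ?_
        exact ENNReal.ofReal_le_ofReal (Real.exp_le_exp.2 hω)
    _ ≤ _ := meas_ge_le_lintegral_div hm.aemeasurable (by simp [Real.exp_pos])
        ENNReal.ofReal_ne_top
    _ ≤ ENNReal.ofReal (Real.exp (n * (noise f).real C * (l + l ^ 2))) /
        ENNReal.ofReal (Real.exp (l * k)) := by
        gcongr; exact lintegral_exp_cellCount_le hf hS hC hl
    _ = _ := by rw [← ENNReal.ofReal_div_of_pos (Real.exp_pos _), Real.exp_sub]

/-- Chernoff bound for too many anecdotes in a cell. -/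
lemma measure_lt_cellCount_le (hf : WellBehaved f) (hS : S.IsProper) {C : Set ℝ}
    (hC : MeasurableSet C) {Λ ε : ℝ} (hε : 0 < ε) (hε' : ε ≤ 1) (hΛ : n * (noise f).real C ≤ Λ) :
    zeroLaw f S n {ω | (1 + ε) * Λ < cellCount C ω.1} ≤
      ENNReal.ofReal (Real.exp (-(ε ^ 2 / 4 * Λ))) := by
  have hsub : {ω : (Fin n → ℝ) × ℝ | (1 + ε) * Λ < cellCount C ω.1} ⊆
      {ω | ε / 2 * ((1 + ε) * Λ) ≤ ε / 2 * cellCount C ω.1} := by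
    intro ω (hω : (1 + ε) * Λ < cellCount C ω.1)
    exact mul_le_mul_of_nonneg_left hω.le (by positivity : 0 ≤ ε / 2)
  calc _ ≤ zeroLaw f S n {ω | ε / 2 * ((1 + ε) * Λ) ≤ ε / 2 * cellCount C ω.1} :=
        measure_mono hsub
    _ ≤ _ := measure_cellCount_tail_le hf hS hC (by rw [abs_le]; constructor <;> linarith)
    _ ≤ _ := by
        refine ENNReal.ofReal_le_ofReal (Real.exp_le_exp.2 ?_)
        have := mul_le_mul_of_nonneg_right hΛ (by positivity : 0 ≤ ε / 2 + (ε / 2) ^ 2)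
        nlinarith

/-- Chernoff bound for too few anecdotes in a cell. -/
lemma measure_cellCount_lt_le (hf : WellBehaved f) (hS : S.IsProper) {C : Set ℝ}
    (hC : MeasurableSet C) {Λ ε : ℝ} (hε : 0 < ε) (hε' : ε ≤ 1) (hΛ : Λ ≤ n * (noise f).real C) :
    zeroLaw f S n {ω | (cellCount C ω.1 : ℝ) < (1 - ε) * Λ} ≤
      ENNReal.ofReal (Real.exp (-(ε ^ 2 / 4 * Λ))) := by
  have hsub : {ω : (Fin n → ℝ) × ℝ | (cellCount C ω.1 : ℝ) < (1 - ε) * Λ} ⊆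
      {ω | -(ε / 2) * ((1 - ε) * Λ) ≤ -(ε / 2) * cellCount C ω.1} := by
    intro ω (hω : (cellCount C ω.1 : ℝ) < (1 - ε) * Λ)
    exact mul_le_mul_of_nonpos_left hω.le (by linarith : -(ε / 2) ≤ 0)
  calc _ ≤ zeroLaw f S n {ω | -(ε / 2) * ((1 - ε) * Λ) ≤ -(ε / 2) * cellCount C ω.1} :=
        measure_mono hsub
    _ ≤ _ := measure_cellCount_tail_le hf hS hC (by rw [abs_le]; constructor <;> linarith)
    _ ≤ _ := by
        refine ENNReal.ofReal_le_ofReal (Real.exp_le_exp.2 ?_)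
        have h : -(ε / 2) + (-(ε / 2)) ^ 2 ≤ 0 := by nlinarith
        have := mul_le_mul_of_nonpos_right hΛ h
        nlinarith

/-- Averaging a local estimate over the center of the window. -/
lemma measure_le_of_forall_center {Ω : Type*} [MeasurableSpace Ω] {μ : Measure Ω}
    [IsProbabilityMeasure μ] {X : Ω → ℝ} (hX : Measurable X) {E : Set Ω} (hE : MeasurableSet E)
    {β d w w' : ℝ} (hw : 0 < w) {κ b e : ENNReal}
    (hEd : ∀ ω ∈ E, |X ω - β| ≤ d - w)
    (h : ∀ c, |c - β| ≤ d → μ (E ∩ {ω | |X ω - c| ≤ w}) ≤ κ * (b + μ {ω | |X ω - c| ≤ w'}) + e) :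
    μ E ≤ ENNReal.ofReal (d / w) * (κ * b + e) + κ * ENNReal.ofReal (w' / w) := by
  set I := Set.Icc (β - d) (β + d) with hI
  have hset : ∀ v, MeasurableSet {p : Ω × ℝ | |X p.1 - p.2| ≤ v} := fun v =>
    measurableSet_le ((hX.comp measurable_fst).sub measurable_snd).abs measurable_const
  have hset1 : MeasurableSet ((Prod.fst ⁻¹' E) ∩ {p : Ω × ℝ | |X p.1 - p.2| ≤ w}) :=
    (measurable_fst hE).inter (hset w)
  have hball : ∀ (x v : ℝ), {c : ℝ | |x - c| ≤ v} = Set.Icc (x - v) (x + v) := fun x v => by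
    ext c
    simp only [Set.mem_ofPred_eq, Set.mem_Icc, abs_le]
    constructor <;> rintro ⟨h1, h2⟩ <;> constructor <;> linarith
  -- Each outcome in E is counted for all centers within w of its X, a set of length 2w that lies
  -- inside I.
  have hl : ENNReal.ofReal (2 * w) * μ E ≤ ∫⁻ c in I, μ (E ∩ {ω | |X ω - c| ≤ w}) := by
    have e1 := Measure.prod_apply (μ := μ) (ν := volume.restrict I) hset1
    have e2 := Measure.prod_apply_symm (μ := μ) (ν := volume.restrict I) hset1
    have e3 : ∫⁻ c in I, μ (E ∩ {ω | |X ω - c| ≤ w}) =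
        (μ.prod (volume.restrict I)) ((Prod.fst ⁻¹' E) ∩ {p : Ω × ℝ | |X p.1 - p.2| ≤ w}) :=
      e2.symm
    rw [e3, e1, ← setLIntegral_const, ← lintegral_indicator hE]
    refine lintegral_mono fun ω => ?_
    by_cases hω : ω ∈ E
    · rw [Set.indicator_of_mem hω]
      have e4 : Prod.mk ω ⁻¹' ((Prod.fst ⁻¹' E) ∩ {p : Ω × ℝ | |X p.1 - p.2| ≤ w}) =
          Set.Icc (X ω - w) (X ω + w) := by
        rw [← hball]; ext c; simp [hω]
      rw [e4, Measure.restrict_apply measurableSet_Icc, Set.inter_eq_left.2, Real.volume_Icc]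
      · refine le_of_eq ?_; ring_nf
      · have := abs_le.1 (hEd ω hω)
        exact Set.Icc_subset_Icc (by linarith) (by linarith)
    · rw [Set.indicator_of_notMem hω]; exact zero_le
  -- Conversely, each outcome is counted for centers in an interval of length at most 2w'. The ratio
  -- w' / w is the only loss in the main term.
  have hr : ∫⁻ c in I, μ {ω | |X ω - c| ≤ w'} ≤ ENNReal.ofReal (2 * w') := by
    have e1 := Measure.prod_apply (μ := μ) (ν := volume.restrict I) (hset w')
    have e2 := Measure.prod_apply_symm (μ := μ) (ν := volume.restrict I) (hset w')
    have e3 : ∫⁻ c in I, μ {ω | |X ω - c| ≤ w'} =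
        (μ.prod (volume.restrict I)) {p : Ω × ℝ | |X p.1 - p.2| ≤ w'} := e2.symm
    rw [e3, e1]
    calc _ ≤ ∫⁻ _, ENNReal.ofReal (2 * w') ∂μ := by
          refine lintegral_mono fun ω => (Measure.restrict_apply_le _ _).trans ?_
          have e4 : Prod.mk ω ⁻¹' {p : Ω × ℝ | |X p.1 - p.2| ≤ w'} =
              Set.Icc (X ω - w') (X ω + w') := hball (X ω) w'
          rw [e4, Real.volume_Icc]
          refine le_of_eq ?_; ring_nf
      _ = _ := by simp
  have hmeas : Measurable fun c => μ {ω | |X ω - c| ≤ w'} :=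
    measurable_measure_prodMk_right (hset w')
  have hmain : ENNReal.ofReal (2 * w) * μ E ≤
      ENNReal.ofReal (2 * d) * (κ * b + e) + κ * ENNReal.ofReal (2 * w') := by
    calc _ ≤ ∫⁻ c in I, μ (E ∩ {ω | |X ω - c| ≤ w}) := hl
      _ ≤ ∫⁻ c in I, ((κ * b + e) + κ * μ {ω | |X ω - c| ≤ w'}) := by
          refine setLIntegral_mono' measurableSet_Icc fun c hc => ?_
          refine (h c (abs_le.2 ⟨by linarith [hc.1], by linarith [hc.2]⟩)).trans (le_of_eq ?_)
          ring
      _ = (κ * b + e) * volume I + κ * ∫⁻ c in I, μ {ω | |X ω - c| ≤ w'} := by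
          rw [lintegral_add_left measurable_const, setLIntegral_const, lintegral_const_mul _ hmeas]
      _ ≤ _ := by
          rw [hI, Real.volume_Icc, mul_comm (κ * b + e)]
          have : β + d - (β - d) = 2 * d := by ring
          rw [this]
          gcongr
  have hw2 : ENNReal.ofReal (2 * w) ≠ 0 := by simp [hw]
  calc μ E = (ENNReal.ofReal (2 * w))⁻¹ * (ENNReal.ofReal (2 * w) * μ E) := by
        rw [← mul_assoc, ENNReal.inv_mul_cancel hw2 ENNReal.ofReal_ne_top, one_mul]
    _ ≤ (ENNReal.ofReal (2 * w))⁻¹ *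
        (ENNReal.ofReal (2 * d) * (κ * b + e) + κ * ENNReal.ofReal (2 * w')) := by gcongr
    _ = _ := by
        have e1 : ∀ v : ℝ, ENNReal.ofReal (v / w) =
            (ENNReal.ofReal (2 * w))⁻¹ * ENNReal.ofReal (2 * v) := fun v => by
          rw [← ENNReal.ofReal_inv_of_pos (by positivity), ← ENNReal.ofReal_mul (by positivity)]
          congr 1; field_simp
        rw [e1, e1]; ring

/-- The density is nearly constant on small cells. -/
lemma WellBehaved.exists_flat (hf : WellBehaved f) :
    ∃ K : ℝ, 0 < K ∧ ∀ L c : ℝ, 1 ≤ L → |c| ≤ 2 * L →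
      ∀ u ∈ Set.Icc (c - (L ^ 11)⁻¹) (c + (L ^ 11)⁻¹),
        f u ≤ Real.exp (K * (L ^ 10)⁻¹) * f c ∧ Real.exp (-(K * (L ^ 10)⁻¹)) * f c ≤ f u := by
  obtain ⟨A, hA, hlip⟩ := hf.exists_log_lipschitz
  refine ⟨4 * A, by positivity, fun L c hL hc u hu => ?_⟩
  have hL0 : 0 < L := by linarith
  have hH : (L ^ 11)⁻¹ ≤ 1 := inv_le_one_of_one_le₀ (one_le_pow₀ hL)
  have huc : |u - c| ≤ (L ^ 11)⁻¹ := abs_le.2 ⟨by linarith [hu.1], by linarith [hu.2]⟩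
  have hu' : |u| ≤ 2 * L + 1 := by
    have := abs_sub_abs_le_abs_sub u c
    linarith
  -- Within distance 2L + 1 of 0 the log-density has slope O(L), and the cell has half-width L^-11.
  have h1 : |Real.log (f u) - Real.log (f c)| ≤ 4 * A * (L ^ 10)⁻¹ := by
    calc _ ≤ A * (1 + (2 * L + 1)) * |u - c| := hlip u c _ hu' (by linarith)
      _ ≤ A * (4 * L) * (L ^ 11)⁻¹ := by gcongr; linarith
      _ = _ := by field_simp
  obtain ⟨h2, h3⟩ := abs_le.1 h1
  constructor
  · conv_lhs => rw [← Real.exp_log (hf.pos u)]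
    conv_rhs => rw [← Real.exp_log (hf.pos c), ← Real.exp_add]
    exact Real.exp_le_exp.2 (by linarith)
  · conv_rhs => rw [← Real.exp_log (hf.pos u)]
    conv_lhs => rw [← Real.exp_log (hf.pos c), ← Real.exp_add]
    exact Real.exp_le_exp.2 (by linarith)

lemma noise_real_Icc_bounds (hf : WellBehaved f) {a b lo hi : ℝ} (hab : a ≤ b)
    (h : ∀ u ∈ Set.Icc a b, f u ≤ hi ∧ lo ≤ f u) :
    (b - a) * lo ≤ (noise f).real (Set.Icc a b) ∧ (noise f).real (Set.Icc a b) ≤ (b - a) * hi := by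
  rw [noise_real_apply hf measurableSet_Icc]
  have hc : ∀ k : ℝ, ∫ _ in Set.Icc a b, k = (b - a) * k := fun k => by
    simp [hab]
  rw [← hc, ← hc]
  exact ⟨setIntegral_mono_on (by simp) hf.integrable.integrableOn measurableSet_Icc
      fun u hu => (h u hu).2,
    setIntegral_mono_on hf.integrable.integrableOn (by simp) measurableSet_Icc
      fun u hu => (h u hu).1⟩

/-- Probabilities in a small cell, relative to the density at its center. -/
lemma cell_bounds (hf : WellBehaved f) {K : ℝ}
    (hK : ∀ L c : ℝ, 1 ≤ L → |c| ≤ 2 * L →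
      ∀ u ∈ Set.Icc (c - (L ^ 11)⁻¹) (c + (L ^ 11)⁻¹),
        f u ≤ Real.exp (K * (L ^ 10)⁻¹) * f c ∧ Real.exp (-(K * (L ^ 10)⁻¹)) * f c ≤ f u)
    {L c : ℝ} (hL : 1 ≤ L) (hc : |c| ≤ 2 * L) (hnL : (n : ℝ) = L ^ 12) {C : Set ℝ}
    (hC : C = Set.Icc (c - (L ^ 11)⁻¹) (c + (L ^ 11)⁻¹)) {η : ℝ} (hη : η = K * (L ^ 10)⁻¹) :
    (Real.exp (-η) * (2 * L * f c) ≤ n * (noise f).real C ∧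
      n * (noise f).real C ≤ Real.exp η * (2 * L * f c)) ∧
    noise f C ≠ 0 ∧
    ∀ a b, a ≤ b → Set.Icc a b ⊆ C →
      Real.exp (-(2 * η)) * ((b - a) * L ^ 11 / 2) ≤ ((noise f)[|C]).real (Set.Icc a b) ∧
      ((noise f)[|C]).real (Set.Icc a b) ≤ Real.exp (2 * η) * ((b - a) * L ^ 11 / 2) := by
  have hprob := hf.isProbabilityMeasure
  have hL0 : 0 < L := by linarith
  have hfc := hf.pos c
  have hflat := hK L c hL hc
  rw [← hη, ← hC] at hflat
  have hCb := noise_real_Icc_bounds hf (a := c - (L ^ 11)⁻¹) (b := c + (L ^ 11)⁻¹)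
    (lo := Real.exp (-η) * f c) (hi := Real.exp η * f c)
    (by linarith [inv_pos.2 (pow_pos hL0 11)]) (by rw [← hC]; exact hflat)
  rw [← hC] at hCb
  have hlen : c + (L ^ 11)⁻¹ - (c - (L ^ 11)⁻¹) = 2 * (L ^ 11)⁻¹ := by ring
  rw [hlen] at hCb
  have hCpos : 0 < (noise f).real C := lt_of_lt_of_le (by positivity) hCb.1
  have hCm : MeasurableSet C := by rw [hC]; exact measurableSet_Icc
  refine ⟨⟨?_, ?_⟩, ?_, ?_⟩
  · calc _ = L ^ 12 * (2 * (L ^ 11)⁻¹ * (Real.exp (-η) * f c)) := by field_simp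
      _ ≤ _ := by rw [hnL]; gcongr; exact hCb.1
  · calc _ ≤ L ^ 12 * (2 * (L ^ 11)⁻¹ * (Real.exp η * f c)) := by
          rw [hnL]; gcongr; exact hCb.2
      _ = _ := by field_simp
  · intro h0
    rw [Measure.real, h0] at hCpos
    simp at hCpos
  -- A conditional probability is a ratio of two masses, so the flatness error enters twice, as
  -- exp(±2η).
  · intro a b hab hJ
    have hJb := noise_real_Icc_bounds hf hab fun u hu => hflat u (hJ hu)
    rw [Measure.real, cond_apply hCm, ENNReal.toReal_mul, ENNReal.toReal_inv]
    change _ ≤ ((noise f).real C)⁻¹ * (noise f).real _ ∧ ((noise f).real C)⁻¹ * (noise f).real _ ≤ _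
    rw [Set.inter_eq_right.2 hJ, ← div_eq_inv_mul]
    have e1 : Real.exp (2 * η) = Real.exp η * Real.exp η := by rw [← Real.exp_add]; ring_nf
    have e2 : Real.exp (-(2 * η)) = Real.exp (-η) * Real.exp (-η) := by
      rw [← Real.exp_add]; ring_nf
    have e3 : Real.exp η * Real.exp (-η) = 1 := by rw [← Real.exp_add]; simp
    have hba : 0 ≤ b - a := by linarith
    have e4 : L ^ 11 * (L ^ 11)⁻¹ = 1 := mul_inv_cancel₀ (by positivity)
    constructor
    · rw [le_div_iff₀ hCpos]
      calc _ ≤ Real.exp (-(2 * η)) * ((b - a) * L ^ 11 / 2) *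
            (2 * (L ^ 11)⁻¹ * (Real.exp η * f c)) := by gcongr; exact hCb.2
        _ = (b - a) * (Real.exp (-η) * f c) * (Real.exp η * Real.exp (-η)) *
            (L ^ 11 * (L ^ 11)⁻¹) := by rw [e2]; ring
        _ ≤ _ := by rw [e3, e4, mul_one, mul_one]; exact hJb.1
    · rw [div_le_iff₀ hCpos]
      calc _ ≤ (b - a) * (Real.exp η * f c) := hJb.2
        _ = (b - a) * (Real.exp η * f c) * (Real.exp η * Real.exp (-η)) *
            (L ^ 11 * (L ^ 11)⁻¹) := by rw [e3, e4, mul_one, mul_one]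
        _ = Real.exp (2 * η) * ((b - a) * L ^ 11 / 2) *
            (2 * (L ^ 11)⁻¹ * (Real.exp (-η) * f c)) := by rw [e1]; ring
        _ ≤ _ := by gcongr; exact hCb.1

/-- The probability that none of the resampled anecdotes hits `J`. -/
lemma pi_real_avoid {ν : Measure ℝ} [IsProbabilityMeasure ν] (C : Set ℝ) {J : Set ℝ}
    (hJ : MeasurableSet J) (x : Fin n → ℝ) :
    (Measure.pi fun _ : Fin n => ν).real {x' | ∀ i, x i ∈ C → x' i ∉ J} =
      (1 - ν.real J) ^ cellCount C x := by
  classical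
  have h1 : {x' : Fin n → ℝ | ∀ i, x i ∈ C → x' i ∉ J} =
      Set.univ.pi fun i => if x i ∈ C then Jᶜ else Set.univ := by
    ext x'
    simp only [Set.mem_ofPred_eq, Set.mem_pi, Set.mem_univ, true_implies]
    refine forall_congr' fun i => ?_
    by_cases h : x i ∈ C <;> simp [h]
  rw [h1, Measure.real, Measure.pi_pi, ENNReal.toReal_prod, cellCount, ← Finset.prod_const,
    Finset.prod_filter]
  refine Finset.prod_congr rfl fun i _ => ?_
  by_cases h : x i ∈ C
  · simp only [h, if_true]
    exact probReal_compl_eq_one_sub hJ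
  · simp [h]

end Cells

/-! ### Local estimates from resampling around one center. -/

section LocalEstimates

variable {f : ℝ → ℝ} {S : SideInfo} {n : ℕ}

lemma replaceIn_mem_iff {C : Set ℝ} {x x' : Fin n → ℝ} (h : ∀ i, x' i ∈ C) (i : Fin n) :
    replaceIn C x x' i ∈ C ↔ x i ∈ C := by
  unfold replaceIn
  by_cases hi : x i ∈ C <;> simp [hi, h i]

lemma cellCount_replaceIn {C : Set ℝ} {x x' : Fin n → ℝ} (h : ∀ i, x' i ∈ C) :
    cellCount C (replaceIn C x x') = cellCount C x := by
  classical
  simp only [cellCount, replaceIn_mem_iff h]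

lemma measurable_replaceIn_const {C : Set ℝ} (hC : MeasurableSet C) (c : ℝ) :
    Measurable fun x : Fin n → ℝ => replaceIn C x fun _ => c := by
  classical
  refine measurable_pi_lambda _ fun i => ?_
  exact Measurable.ite (hC.preimage (measurable_pi_apply i)) measurable_const (measurable_pi_apply i)

/-- The posterior mean after moving all anecdotes in `C` to `c`. -/
def pinnedMean (f : ℝ → ℝ) (S : SideInfo) (C : Set ℝ) (c : ℝ) {n : ℕ}
    (ω : (Fin n → ℝ) × ℝ) : ℝ :=
  posteriorMean f S (replaceIn C ω.1 fun _ => c) ω.2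

lemma measurable_pinnedMean (hf : WellBehaved f) (hS : S.IsProper) {C : Set ℝ}
    (hC : MeasurableSet C) (c : ℝ) : Measurable (pinnedMean f S C c (n := n)) :=
  (measurable_posteriorMean hf hS).comp
    (((measurable_replaceIn_const hC c).comp measurable_fst).prodMk measurable_snd)

/-- Conditional probabilities given everything but the positions inside the cell `C` control the
probability of an event near the center `c`. -/
lemma measure_inter_near_le (hf : WellBehaved f) (hS : S.IsProper) {C : Set ℝ}
    (hC : MeasurableSet C) (h0 : noise f C ≠ 0) {c β w e₀ lo hi : ℝ} (hcC : c ∈ C)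
    {E G : Set ((Fin n → ℝ) × ℝ)} (hE : MeasurableSet E) (hG : MeasurableSet G)
    {F : Set (((Fin n → ℝ) × ℝ) × (Fin n → ℝ))} (hFm : MeasurableSet F) {κ : ENNReal}
    (hsens : ∀ ω ∈ G, (cellCount C ω.1 : ℝ) ≤ hi → ∀ x' : Fin n → ℝ,
      (∀ i, ω.1 i ∉ C → x' i = ω.1 i) → (∀ i, ω.1 i ∈ C → x' i ∈ C) →
      |posteriorMean f S x' ω.2 - posteriorMean f S ω.1 ω.2| ≤ e₀)
    (hF : ∀ (x x' : Fin n → ℝ) (y : ℝ), (∀ i, x' i ∈ C) → (replaceIn C x x', y) ∈ E →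
      |posteriorMean f S (replaceIn C x x') y + β - c| ≤ w →
      |pinnedMean f S C c (x, y) - posteriorMean f S (replaceIn C x x') y| ≤ e₀ →
      ((x, y), x') ∈ F)
    (hκ : ∀ ω : (Fin n → ℝ) × ℝ, lo ≤ cellCount C ω.1 → (cellCount C ω.1 : ℝ) ≤ hi →
      |pinnedMean f S C c ω + β - c| ≤ w + e₀ →
      (Measure.pi fun _ : Fin n => (noise f)[|C]) (Prod.mk ω ⁻¹' F) ≤ κ) :
    zeroLaw f S n ((E ∩ G) ∩ {ω | |posteriorMean f S ω.1 ω.2 + β - c| ≤ w}) ≤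
      κ * (zeroLaw f S n Gᶜ +
        zeroLaw f S n {ω | |posteriorMean f S ω.1 ω.2 + β - c| ≤ w + 2 * e₀}) +
      (zeroLaw f S n {ω | (cellCount C ω.1 : ℝ) < lo} +
        zeroLaw f S n {ω | hi < cellCount C ω.1}) := by
  have := hS.isProbabilityMeasure_zeroLaw (n := n) hf
  have := hf.isProbabilityMeasure
  have := cond_isProbabilityMeasure h0
  set μ := zeroLaw f S n
  set μ' := Measure.pi fun _ : Fin n => (noise f)[|C]
  have mT := measurable_posteriorMean (n := n) hf hS
  have mτ := measurable_pinnedMean (n := n) hf hS hC c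
  have mN : Measurable fun ω : (Fin n → ℝ) × ℝ => (cellCount C ω.1 : ℝ) :=
    (measurable_cellCount hC).comp measurable_fst
  have hnear : ∀ v, MeasurableSet {ω : (Fin n → ℝ) × ℝ | |posteriorMean f S ω.1 ω.2 + β - c| ≤ v} :=
    fun v => measurableSet_le ((mT.add_const β).sub_const c).abs measurable_const
  set N : Set ((Fin n → ℝ) × ℝ) := {ω | lo ≤ cellCount C ω.1 ∧ (cellCount C ω.1 : ℝ) ≤ hi} with hN
  have hNm : MeasurableSet N :=
    (measurableSet_le measurable_const mN).inter (measurableSet_le mN measurable_const)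
  set A := ((E ∩ G) ∩ {ω | |posteriorMean f S ω.1 ω.2 + β - c| ≤ w}) ∩ N with hA
  set D : Set ((Fin n → ℝ) × ℝ) := N ∩ {ω | |pinnedMean f S C c ω + β - c| ≤ w + e₀} with hD
  have hDm : MeasurableSet D :=
    hNm.inter (measurableSet_le ((mτ.add_const β).sub_const c).abs measurable_const)
  have hae : ∀ᵐ p ∂(μ.prod μ'), ∀ i, p.2 i ∈ C := by
    have h1 : ∀ᵐ x' ∂μ', ∀ i, x' i ∈ C := ae_all_iff.2 fun i =>
      (measurePreserving_eval (fun _ : Fin n => (noise f)[|C]) i).quasiMeasurePreserving.ae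
        (ae_cond_mem hC)
    exact measurePreserving_snd.quasiMeasurePreserving.ae h1
  -- The good event G is imposed on the resampled data, and sensitivity compares it with the sample
  -- pinned at c. The pinned mean is fixed before the new positions are drawn and can serve as a
  -- deterministic target.
  have hclose : ∀ (x x' : Fin n → ℝ) (y : ℝ), (∀ i, x' i ∈ C) → (x, y) ∈ N →
      (replaceIn C x x', y) ∈ G →
      |pinnedMean f S C c (x, y) - posteriorMean f S (replaceIn C x x') y| ≤ e₀ := by
    intro x x' y hx' hxN hg
    refine hsens _ hg (by rw [cellCount_replaceIn hx']; exact hxN.2) _ (fun i hi => ?_)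
      (fun i hi => ?_)
    · rw [replaceIn_mem_iff hx'] at hi
      simp [replaceIn, hi]
    · rw [replaceIn_mem_iff hx'] at hi
      simpa [replaceIn, hi] using hcC
  -- Passing from the actual to the pinned mean widens the window by e₀, and passing back widens it
  -- by e₀ again, hence w + 2 e₀.
  have key : μ A ≤ κ * (μ Gᶜ + μ {ω | |posteriorMean f S ω.1 ω.2 + β - c| ≤ w + 2 * e₀}) := by
    refine measure_le_of_resample (measurePreserving_replaceIn hf hS hC h0)
      (((hE.inter hG).inter (hnear w)).inter hNm) hG (hnear _) hDm hFm ?_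
      (fun ω hω => hκ ω hω.1.1 hω.1.2 hω.2) ?_
    · filter_upwards [hae] with p hp hpA
      obtain ⟨⟨⟨hpE, hpG⟩, hpw⟩, hpN⟩ := hpA
      have hpN' : (p.1.1, p.1.2) ∈ N := by
        have := hpN
        simp only [hN, Set.mem_ofPred_eq, cellCount_replaceIn hp] at this
        exact this
      have hcl := hclose p.1.1 p.2 p.1.2 hp hpN' hpG
      refine ⟨⟨hpN', ?_⟩, hF p.1.1 p.2 p.1.2 hp hpE hpw hcl⟩
      have hpw' : |posteriorMean f S (replaceIn C p.1.1 p.2) p.1.2 + β - c| ≤ w := hpw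
      change |pinnedMean f S C c p.1 + β - c| ≤ w + e₀
      have h2 : pinnedMean f S C c p.1 + β - c =
        (posteriorMean f S (replaceIn C p.1.1 p.2) p.1.2 + β - c) +
        (pinnedMean f S C c p.1 - posteriorMean f S (replaceIn C p.1.1 p.2) p.1.2) := by ring
      rw [h2]
      exact (abs_add_le _ _).trans (add_le_add hpw' hcl)
    · filter_upwards [hae] with p hp hpD hpG
      have hcl := hclose p.1.1 p.2 p.1.2 hp hpD.1 hpG
      have hpw : |pinnedMean f S C c p.1 + β - c| ≤ w + e₀ := hpD.2
      change |posteriorMean f S (replaceIn C p.1.1 p.2) p.1.2 + β - c| ≤ w + 2 * e₀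
      have h2 : posteriorMean f S (replaceIn C p.1.1 p.2) p.1.2 + β - c =
        (pinnedMean f S C c p.1 + β - c) -
        (pinnedMean f S C c p.1 - posteriorMean f S (replaceIn C p.1.1 p.2) p.1.2) := by ring
      rw [h2]
      refine (abs_sub _ _).trans ?_
      have hcl' : |pinnedMean f S C c p.1 - posteriorMean f S (replaceIn C p.1.1 p.2) p.1.2| ≤ e₀ :=
        hcl
      linarith
  calc _ ≤ μ (A ∪ ({ω | (cellCount C ω.1 : ℝ) < lo} ∪ {ω | hi < cellCount C ω.1})) := by
        refine measure_mono fun ω hω => ?_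
        by_cases h1 : (cellCount C ω.1 : ℝ) < lo
        · exact Or.inr (Or.inl h1)
        by_cases h2 : hi < cellCount C ω.1
        · exact Or.inr (Or.inr h2)
        · exact Or.inl ⟨hω, not_lt.1 h1, not_lt.1 h2⟩
    _ ≤ _ := (measure_union_le _ _).trans (add_le_add key (measure_union_le _ _))

/-- None of the resampled anecdotes is within `ρ` of the target. -/
def avoidSet (f : ℝ → ℝ) (S : SideInfo) (C : Set ℝ) (c β ρ : ℝ) (n : ℕ) :
    Set (((Fin n → ℝ) × ℝ) × (Fin n → ℝ)) :=
  {p | ∀ i, p.1.1 i ∈ C →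
    p.2 i ∉ Set.Icc (pinnedMean f S C c p.1 + β - ρ) (pinnedMean f S C c p.1 + β + ρ)}

lemma measurableSet_avoidSet (hf : WellBehaved f) (hS : S.IsProper) {C : Set ℝ}
    (hC : MeasurableSet C) (c β ρ : ℝ) : MeasurableSet (avoidSet f S C c β ρ n) := by
  have mτ : Measurable fun p : ((Fin n → ℝ) × ℝ) × (Fin n → ℝ) => pinnedMean f S C c p.1 :=
    (measurable_pinnedMean hf hS hC c).comp measurable_fst
  have m2 : ∀ i, Measurable fun p : ((Fin n → ℝ) × ℝ) × (Fin n → ℝ) => p.2 i := fun i => by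
    fun_prop
  have m1 : ∀ i, Measurable fun p : ((Fin n → ℝ) × ℝ) × (Fin n → ℝ) => p.1.1 i := fun i => by
    fun_prop
  have h : avoidSet f S C c β ρ n = ⋂ i, ({p | p.1.1 i ∈ C}ᶜ ∪
      ({p | pinnedMean f S C c p.1 + β - ρ ≤ p.2 i} ∩
        {p | p.2 i ≤ pinnedMean f S C c p.1 + β + ρ})ᶜ) := by
    ext p
    simp only [avoidSet, Set.mem_ofPred_eq, Set.mem_iInter, Set.mem_union, Set.mem_compl_iff,
      Set.mem_inter_iff, Set.mem_Icc, imp_iff_not_or]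
  rw [h]
  exact MeasurableSet.iInter fun i => ((m1 i hC).compl).union
    ((measurableSet_le ((mτ.add_const _).sub_const _) (m2 i)).inter
      (measurableSet_le (m2 i) ((mτ.add_const _).add_const _))).compl

lemma tendsto_pow_mul_exp_neg_mul (k : ℕ) {b : ℝ} (hb : 0 < b) :
    Tendsto (fun L : ℝ => L ^ k * Real.exp (-(b * L))) atTop (𝓝 0) := by
  have h := (Real.tendsto_pow_mul_exp_neg_atTop_nhds_zero k).comp (tendsto_id.const_mul_atTop hb)
  have h2 := h.const_mul (b⁻¹ ^ k)
  rw [mul_zero] at h2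
  refine h2.congr fun L => ?_
  simp only [Function.comp, id]
  rw [← mul_assoc, ← mul_pow, ← mul_assoc, inv_mul_cancel₀ hb.ne', one_mul]

lemma tendsto_inv_pow_zero {k : ℕ} (hk : k ≠ 0) :
    Tendsto (fun L : ℝ => (L ^ k)⁻¹) atTop (𝓝 0) :=
  (tendsto_pow_atTop hk).inv_tendsto_atTop

/-- Since log z ≥ 1 - 1/z, one has log (1 - q) ≥ -q / (1 - q). This is the reverse of 1 - q ≤ exp
(-q), needed to bound hitting probabilities from above. -/
lemma one_sub_pow_ge_exp {q M : ℝ} (hq : 0 ≤ q) (hq1 : q < 1) {m : ℕ} (hm : (m : ℝ) ≤ M) :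
    Real.exp (-(M * (q / (1 - q)))) ≤ (1 - q) ^ m := by
  have h1 : 0 < 1 - q := by linarith
  rw [← Real.exp_log (pow_pos h1 m), Real.log_pow]
  refine Real.exp_le_exp.2 ?_
  have h2 := Real.one_sub_inv_le_log_of_pos h1
  have h3 : 1 - (1 - q)⁻¹ = -(q / (1 - q)) := by field_simp; ring
  rw [h3] at h2
  have h4 : 0 ≤ q / (1 - q) := by positivity
  have h5 : (m : ℝ) * -(q / (1 - q)) ≤ m * Real.log (1 - q) := by gcongr
  nlinarith

end LocalEstimates

/-! ### From conditional estimates near a center to unconditional ones. -/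

section WindowAveraging

variable {f : ℝ → ℝ} {S : SideInfo} {n : ℕ}

/-- The tilting estimate with zero tilt places θ_S within 2 L^-5 of the sample mean, which is itself
within L^-5 of 0. -/
lemma abs_posteriorMean_le_of_mem_concentrated (hf : WellBehaved f) (hS : S.IsProper) (hn : 1 ≤ n)
    {L : ℝ} (hL : 2 ≤ L) {ω : (Fin n → ℝ) × ℝ}
    (hω : ω ∈ concentrated f S n (L ^ 5)⁻¹ (L ^ 24)⁻¹) :
    |posteriorMean f S ω.1 ω.2| ≤ 3 * (L ^ 5)⁻¹ := by
  have := isProbabilityMeasure_posterior hf hS hn ω.1 ω.2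
  have hq4 : (L ^ 24)⁻¹ ≤ 1 / 4 := by
    rw [one_div]; gcongr
    calc (4 : ℝ) ≤ 2 ^ 24 := by norm_num
      _ ≤ L ^ 24 := by gcongr
  have hqs : (L ^ 24)⁻¹ ≤ (L ^ 5)⁻¹ := by
    gcongr
    · linarith
    · norm_num
  have key := (abs_tilted_mean_sub_le (p := posterior f S ω.1 ω.2) (H := fun _ => 0)
    (m := sampleMean ω.1) (s := (L ^ 5)⁻¹) (a := 0) (q := (L ^ 24)⁻¹) measurable_const le_rfl
    (by norm_num) (by positivity) (inv_le_one_of_one_le₀ (one_le_pow₀ (by linarith)))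
    (by positivity) hq4 hqs (fun t => by simp) hω.2).2
  rw [← posteriorMean_eq hf] at key
  have h1 := abs_sub_abs_le_abs_sub (posteriorMean f S ω.1 ω.2) (sampleMean ω.1)
  linarith [hω.1]

/-- An event that, near every possible value `c` of the target, forces a resampling event of
probability at most `κ`, has itself probability at most about `κ`. -/
lemma WellBehaved.exists_window_le (hf : WellBehaved f) :
    ∃ K D L₀ : ℝ, 0 < K ∧ 0 < D ∧ 2 ≤ L₀ ∧ ∀ (S : SideInfo) (n : ℕ) (L : ℝ), S.IsProper → 1 ≤ n →
      L₀ ≤ L → (n : ℝ) = L ^ 12 → ∀ β d lo hi κ δ : ℝ, |β| ≤ L → 4 * (L ^ 5)⁻¹ ≤ d → d ≤ 1 →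
      hi ≤ 4 * f 0 * L → 0 ≤ κ → 0 ≤ δ → ∀ E : Set ((Fin n → ℝ) × ℝ), MeasurableSet E →
      ∀ F : ℝ → Set (((Fin n → ℝ) × ℝ) × (Fin n → ℝ)), (∀ c, MeasurableSet (F c)) →
      (∀ c C, |c - β| ≤ d → C = Set.Icc (c - (L ^ 11)⁻¹) (c + (L ^ 11)⁻¹) →
        (∀ (x x' : Fin n → ℝ) (y : ℝ), (∀ i, x' i ∈ C) → (replaceIn C x x', y) ∈ E →
          |posteriorMean f S (replaceIn C x x') y + β - c| ≤ 1 / 2 * (L ^ 12)⁻¹ →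
          |pinnedMean f S C c (x, y) - posteriorMean f S (replaceIn C x x') y| ≤ K * (L ^ 14)⁻¹ →
          ((x, y), x') ∈ F c) ∧
        (∀ ω : (Fin n → ℝ) × ℝ, lo ≤ cellCount C ω.1 → (cellCount C ω.1 : ℝ) ≤ hi →
          |pinnedMean f S C c ω + β - c| ≤ 1 / 2 * (L ^ 12)⁻¹ + K * (L ^ 14)⁻¹ →
          (Measure.pi fun _ : Fin n => (noise f)[|C]) (Prod.mk ω ⁻¹' F c) ≤ ENNReal.ofReal κ) ∧
        zeroLaw f S n {ω | (cellCount C ω.1 : ℝ) < lo} +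
          zeroLaw f S n {ω | hi < cellCount C ω.1} ≤ ENNReal.ofReal δ) →
      zeroLaw f S n E ≤ ENNReal.ofReal (κ * (1 + 4 * K * (L ^ 2)⁻¹) +
        (2 * L ^ 12 * (D * (L ^ 24 * Real.exp (-(L / 4))) + δ) +
          D * (L ^ 24 * Real.exp (-(L / 4))))) := by
  obtain ⟨K, L₀, hK, hL₀, hsens⟩ := hf.exists_abs_posteriorMean_sub_le
  obtain ⟨D, hD, hconc⟩ := hf.exists_measure_compl_concentrated_le
  obtain ⟨K', -, hflat⟩ := hf.exists_flat
  refine ⟨K, D, L₀, hK, hD, hL₀, ?_⟩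
  intro S n L hS hn hL hnL β d lo hi κ δ hβ hd hd1 hhi hκ0 hδ0 E hE F hFm hloc
  have hL2 : 2 ≤ L := hL₀.trans hL
  have hL0 : 0 < L := by linarith
  have := hS.isProbabilityMeasure_zeroLaw (n := n) hf
  have hprob := hf.isProbabilityMeasure
  set μ := zeroLaw f S n
  set G := concentrated f S n (L ^ 5)⁻¹ (L ^ 24)⁻¹ with hG
  have hGm : MeasurableSet G := measurableSet_concentrated hf hS _ _
  set g := D * (L ^ 24 * Real.exp (-(L / 4))) with hg
  have hg0 : 0 ≤ g := by positivity
  have hGc : μ Gᶜ ≤ ENNReal.ofReal g := hconc S n L hS hn hL2 hnL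
  have hX : Measurable fun ω : (Fin n → ℝ) × ℝ => posteriorMean f S ω.1 ω.2 + β :=
    (measurable_posteriorMean hf hS).add_const β
  -- The window has the scale 1/n of the spacing, so the sensitivity K L^-14 widens it only by a
  -- relative O(L^-2), while averaging multiplies the exceptional probabilities by only O(L^12).
  set w := 1 / 2 * (L ^ 12)⁻¹ with hw
  have hw0 : 0 < w := by positivity
  -- No upper bound on κ is assumed. Capping it at 1, which is always a valid bound for a
  -- probability, keeps it from amplifying the error terms.
  set κ' := min 1 κ with hκ'
  have hκ'0 : 0 ≤ κ' := le_min zero_le_one hκ0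
  have hmain := measure_le_of_forall_center (μ := μ) hX (hE.inter hGm) (β := β) (d := d) (w := w)
    (w' := w + 2 * (K * (L ^ 14)⁻¹)) hw0 (κ := ENNReal.ofReal κ') (b := μ Gᶜ)
    (e := ENNReal.ofReal δ) ?_ ?_
  · have hrat : (w + 2 * (K * (L ^ 14)⁻¹)) / w = 1 + 4 * K * (L ^ 2)⁻¹ := by
      rw [hw]; field_simp; ring
    have hdw : d / w ≤ 2 * L ^ 12 := by
      rw [hw, div_le_iff₀ (by positivity)]
      have : 2 * L ^ 12 * (1 / 2 * (L ^ 12)⁻¹) = 1 := by field_simp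
      rw [this]; exact hd1
    rw [hrat] at hmain
    have h4 : (0 : ℝ) ≤ 1 + 4 * K * (L ^ 2)⁻¹ := by positivity
    calc μ E ≤ μ (E ∩ G) + μ Gᶜ := by
          refine (measure_mono fun ω hω => ?_).trans (measure_union_le _ _)
          by_cases h : ω ∈ G
          · exact Or.inl ⟨hω, h⟩
          · exact Or.inr h
      _ ≤ (ENNReal.ofReal (2 * L ^ 12) * (ENNReal.ofReal 1 * ENNReal.ofReal g + ENNReal.ofReal δ) +
            ENNReal.ofReal κ * ENNReal.ofReal (1 + 4 * K * (L ^ 2)⁻¹)) + ENNReal.ofReal g := by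
          refine add_le_add (hmain.trans ?_) hGc
          gcongr
          · exact min_le_left _ _
          · exact min_le_right _ _
      _ = _ := by
          rw [← ENNReal.ofReal_mul zero_le_one, ← ENNReal.ofReal_add (by positivity) hδ0,
            ← ENNReal.ofReal_mul (by positivity), ← ENNReal.ofReal_mul hκ0,
            ← ENNReal.ofReal_add (by positivity) (by positivity),
            ← ENNReal.ofReal_add (by positivity) hg0]
          congr 1; ring
  · intro ω hω
    have h1 := abs_posteriorMean_le_of_mem_concentrated hf hS hn hL2 hω.2
    have h2 : w ≤ (L ^ 5)⁻¹ := by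
      have : (L ^ 12)⁻¹ ≤ (L ^ 5)⁻¹ := by
        gcongr
        · linarith
        · norm_num
      have h0 : 0 < (L ^ 12)⁻¹ := by positivity
      rw [hw]; linarith
    simp only [add_sub_cancel_right]
    linarith
  · intro c hc
    set C := Set.Icc (c - (L ^ 11)⁻¹) (c + (L ^ 11)⁻¹) with hC
    obtain ⟨h1, h2, h3⟩ := hloc c C hc hC
    have hc2 : |c| ≤ 2 * L := by
      have := abs_sub_abs_le_abs_sub c β
      linarith
    have hcC : c ∈ C := by
      have : 0 < (L ^ 11)⁻¹ := by positivity
      exact ⟨by linarith, by linarith⟩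
    obtain ⟨-, h0, -⟩ := cell_bounds hf hflat (by linarith) hc2 hnL hC rfl
    refine (measure_inter_near_le hf hS measurableSet_Icc h0 hcC hE hGm (hFm c)
      (e₀ := K * (L ^ 14)⁻¹) (lo := lo) (hi := hi) (κ := ENNReal.ofReal κ') ?_ h1 ?_).trans ?_
    · intro ω hω hcount x' hx hx'
      exact (hsens S n L hS hn hL ω hω c hc2 C hC (hcount.trans hhi) x' hx hx').1
    · intro ω hlo hhi' hpin
      have := cond_isProbabilityMeasure h0
      rw [hκ', ENNReal.ofReal_min]
      exact le_min (by rw [ENNReal.ofReal_one]; exact prob_le_one) (h2 ω hlo hhi' hpin)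
    · exact add_le_add le_rfl h3

end WindowAveraging

/-! ### Upper bound on the chance of missing the posterior mean. -/

section Spacing

variable {f : ℝ → ℝ} {S : SideInfo} {n : ℕ}

/-- The collected error terms of the window averaging are negligible. -/
lemma eventually_window_error_le {D b : ℝ} (hb : 0 < b) (A : ℝ) (k : ℕ) :
    ∀ᶠ L : ℝ in atTop, 2 * L ^ 12 * (D * (L ^ 24 * Real.exp (-(L / 4))) +
      A * Real.exp (-(b * L))) + D * (L ^ 24 * Real.exp (-(L / 4))) ≤ (L ^ k)⁻¹ := by
  have h1 := tendsto_pow_mul_exp_neg_mul (36 + k) (b := 1 / 4) (by norm_num)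
  have h2 := tendsto_pow_mul_exp_neg_mul (12 + k) hb
  have h3 := tendsto_pow_mul_exp_neg_mul (24 + k) (b := 1 / 4) (by norm_num)
  have h := (((h1.const_mul (2 * D)).add (h2.const_mul (2 * A))).add (h3.const_mul D))
  simp only [mul_zero, add_zero] at h
  filter_upwards [h.eventually_le_const zero_lt_one, eventually_gt_atTop 0] with L hL hL0
  have e : L / 4 = 1 / 4 * L := by ring
  rw [← one_div, le_div_iff₀ (pow_pos hL0 k), e]
  refine le_of_eq_of_le ?_ hL
  ring

lemma tendsto_mul_inv_pow_zero (A : ℝ) {k : ℕ} (hk : k ≠ 0) :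
    Tendsto (fun L : ℝ => A * (L ^ k)⁻¹) atTop (𝓝 0) := by
  simpa using (tendsto_inv_pow_zero hk).const_mul A

lemma pi_avoid_le {ν : Measure ℝ} [IsProbabilityMeasure ν] (C : Set ℝ) {J : Set ℝ}
    (hJ : MeasurableSet J) (x : Fin n → ℝ) {lo q : ℝ} (hc : lo ≤ cellCount C x)
    (hq0 : 0 ≤ q) (hq : q ≤ ν.real J) :
    (Measure.pi fun _ : Fin n => ν) {x' | ∀ i, x i ∈ C → x' i ∉ J} ≤
      ENNReal.ofReal (Real.exp (-(lo * q))) := by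
  rw [ENNReal.le_ofReal_iff_toReal_le (measure_ne_top _ _) (Real.exp_pos _).le]
  change (Measure.pi fun _ : Fin n => ν).real _ ≤ _
  rw [pi_real_avoid C hJ]
  have h1 : 0 ≤ 1 - ν.real J := by linarith [measureReal_le_one (μ := ν) (s := J)]
  calc (1 - ν.real J) ^ cellCount C x ≤ Real.exp (-ν.real J) ^ cellCount C x :=
        pow_le_pow_left₀ h1 (Real.one_sub_le_exp_neg _) _
    _ = Real.exp (-(cellCount C x * ν.real J)) := by rw [← Real.exp_nat_mul]; ring_nf
    _ ≤ _ := by gcongr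

lemma pi_compl_avoid_le {ν : Measure ℝ} [IsProbabilityMeasure ν] (C : Set ℝ)
    {J : Set ℝ} (hJ : MeasurableSet J) (x : Fin n → ℝ) {hi q : ℝ} (hc : (cellCount C x : ℝ) ≤ hi)
    (hq : ν.real J ≤ q) (hq1 : q < 1) :
    (Measure.pi fun _ : Fin n => ν) {x' | ∀ i, x i ∈ C → x' i ∉ J}ᶜ ≤
      ENNReal.ofReal (1 - Real.exp (-(hi * (q / (1 - q))))) := by
  have hm : MeasurableSet {x' : Fin n → ℝ | ∀ i, x i ∈ C → x' i ∉ J} := by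
    simp only [Set.ofPred_forall]
    exact MeasurableSet.iInter fun i => MeasurableSet.iInter fun _ =>
      (hJ.preimage (measurable_pi_apply i)).compl
  have hq0 : 0 ≤ ν.real J := measureReal_nonneg
  have h1 : Real.exp (-(hi * (q / (1 - q)))) ≤ (1 - q) ^ cellCount C x :=
    one_sub_pow_ge_exp (hq0.trans hq) hq1 hc
  have h2 : (1 - q) ^ cellCount C x ≤ (1 - ν.real J) ^ cellCount C x :=
    pow_le_pow_left₀ (by linarith) (by linarith) _
  rw [← ofReal_measureReal (measure_ne_top _ _), probReal_compl_eq_one_sub hm, pi_real_avoid C hJ]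
  exact ENNReal.ofReal_le_ofReal (by linarith)

set_option maxHeartbeats 800000 in
/-- The chance that no anecdote lies within `r / n` of the posterior mean. -/
lemma WellBehaved.exists_miss_le (hf : WellBehaved f) {l ε : ℝ} (hl : 0 < l) (hl' : l < f 0)
    (hε : 0 < ε) :
    ∃ L₁ : ℝ, ∀ (S : SideInfo) (n : ℕ) (L : ℝ), S.IsProper → 1 ≤ n → L₁ ≤ L → (n : ℝ) = L ^ 12 →
      ∀ r : ℝ, 0 ≤ r → r ≤ L / 2 →
        zeroLaw f S n {ω | ∀ i, r / L ^ 12 < |ω.1 i - posteriorMean f S ω.1 ω.2|} ≤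
          ENNReal.ofReal ((1 + ε) * Real.exp (-(2 * l * r)) + (L ^ 100)⁻¹) := by
  obtain ⟨K, D, L₀, hK, hD, hL₀, hwin⟩ := hf.exists_window_le
  obtain ⟨K', hK', hflat⟩ := hf.exists_flat
  have hf0 := hf.pos 0
  -- Half of the gap f(0) - l is reserved for the variation of f near 0 and a further quarter for
  -- count fluctuations. The remaining quarter absorbs the factor exp(-3η) for large L.
  set l' := (l + f 0) / 2 with hl'_def
  have hl'0 : 0 < l' := by positivity
  set ε₂ := (f 0 - l) / (4 * f 0) with hε₂
  have hε₂0 : 0 < ε₂ := div_pos (by linarith) (by positivity)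
  have hε₂f : ε₂ * f 0 = (f 0 - l) / 4 := by rw [hε₂]; field_simp
  have hε₂1 : ε₂ ≤ 1 / 4 := by rw [hε₂, div_le_iff₀ (by positivity)]; linarith
  have hll : l < (1 - ε₂) * l' := by
    have : ε₂ * l' ≤ ε₂ * f 0 := by gcongr; linarith
    linarith
  obtain ⟨d₀, hd₀, hd₀f⟩ : ∃ d₀ > 0, ∀ c, |c| ≤ d₀ → l' ≤ f c := by
    have h1 : ∀ᶠ c in 𝓝 (0 : ℝ), l' < f c :=
      hf.continuous.continuousAt.eventually (lt_mem_nhds (by linarith))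
    obtain ⟨d, hd, h⟩ := Metric.eventually_nhds_iff.1 h1
    refine ⟨d / 2, by positivity, fun c hc => (h ?_).le⟩
    rw [Real.dist_eq, sub_zero]; linarith
  set d := min d₀ 1 with hd
  have hd0 : 0 < d := lt_min hd₀ one_pos
  set b := min (ε₂ ^ 2 / 4 * l') (f 0 / 8) with hb
  have hb0 : 0 < b := lt_min (by positivity) (by positivity)
  have tη := tendsto_mul_inv_pow_zero K' (k := 10) (by norm_num)
  have c1 : ∀ᶠ L : ℝ in atTop, l ≤ (1 - ε₂) * Real.exp (-(3 * (K' * (L ^ 10)⁻¹))) * l' := by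
    have h := (((Real.continuous_exp.tendsto _).comp (tη.const_mul 3).neg).const_mul
      (1 - ε₂)).mul_const l'
    simp only [mul_zero, neg_zero, Real.exp_zero, mul_one] at h
    exact h.eventually_const_le hll
  have c2 : ∀ᶠ L : ℝ in atTop, Real.exp (K' * (L ^ 10)⁻¹) ≤ 4 / 3 := by
    have h := (Real.continuous_exp.tendsto _).comp tη
    rw [Real.exp_zero] at h
    exact h.eventually_le_const (by norm_num)
  have c3 : ∀ᶠ L : ℝ in atTop,
      Real.exp (2 * l * K * (L ^ 2)⁻¹) * (1 + 4 * K * (L ^ 2)⁻¹) ≤ 1 + ε := by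
    have h1 := (Real.continuous_exp.tendsto _).comp
      (tendsto_mul_inv_pow_zero (2 * l * K) (k := 2) (by norm_num))
    have h2 := (tendsto_mul_inv_pow_zero (4 * K) (k := 2) (by norm_num)).const_add 1
    have h := h1.mul h2
    rw [Real.exp_zero, add_zero, mul_one] at h
    exact h.eventually_le_const (by linarith)
  have c4 := eventually_window_error_le (D := D) hb0 2 100
  have c5 : ∀ᶠ L : ℝ in atTop, 4 * (L ^ 5)⁻¹ ≤ d :=
    (tendsto_mul_inv_pow_zero 4 (by norm_num)).eventually_le_const hd0
  obtain ⟨L₁, hL₁⟩ := eventually_atTop.1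
    (c1.and <| c2.and <| c3.and <| c4.and <| c5.and <| eventually_ge_atTop L₀)
  refine ⟨L₁, fun S n L hS hn hL hnL r hr0 hr => ?_⟩
  obtain ⟨c1, c2, c3, c4, c5, c6⟩ := hL₁ L hL
  have hL2 : 2 ≤ L := hL₀.trans c6
  have hL0 : 0 < L := by linarith
  have hprob := hf.isProbabilityMeasure
  set η := K' * (L ^ 10)⁻¹ with hη
  have hη0 : 0 < η := by positivity
  have c2' : 1 / 2 ≤ Real.exp (-η) := by
    rw [Real.exp_neg, one_div]; gcongr; linarith
  set lo := (1 - ε₂) * (Real.exp (-η) * (2 * L * l')) with hlo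
  -- The radius shrinks by the sensitivity: a point within ρ of the pinned mean is within r/n of the
  -- actual posterior mean.
  set ρ := r / L ^ 12 - K * (L ^ 14)⁻¹ with hρ
  have hρL : ρ * L ^ 12 = r - K * (L ^ 2)⁻¹ := by rw [hρ]; field_simp
  have mT := measurable_posteriorMean (n := n) hf hS
  have hEm : MeasurableSet {ω : (Fin n → ℝ) × ℝ |
      ∀ i, r / L ^ 12 < |ω.1 i - posteriorMean f S ω.1 ω.2|} := by
    rw [Set.ofPred_forall]
    exact MeasurableSet.iInter fun i => measurableSet_lt measurable_const
      ((((measurable_pi_apply i).comp measurable_fst).sub mT).abs)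
  have hmain := hwin S n L hS hn c6 hnL 0 d lo (4 * f 0 * L)
    (Real.exp (-(2 * l * (r - K * (L ^ 2)⁻¹)))) (2 * Real.exp (-(b * L))) (by simp [hL0.le])
    c5 (min_le_right _ _) le_rfl (by positivity) (by positivity) _ hEm
    (fun c => avoidSet f S (Set.Icc (c - (L ^ 11)⁻¹) (c + (L ^ 11)⁻¹)) c 0 ρ n)
    (fun c => measurableSet_avoidSet hf hS measurableSet_Icc c 0 ρ) ?_
  · refine hmain.trans (ENNReal.ofReal_le_ofReal (add_le_add ?_ c4))
    have e : Real.exp (-(2 * l * (r - K * (L ^ 2)⁻¹))) =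
        Real.exp (2 * l * K * (L ^ 2)⁻¹) * Real.exp (-(2 * l * r)) := by
      rw [← Real.exp_add]; ring_nf
    rw [e, mul_right_comm]
    gcongr
  · intro c C hc hC
    rw [sub_zero] at hc
    have hfc : l' ≤ f c := hd₀f c (hc.trans (min_le_left _ _))
    have hc2 : |c| ≤ 2 * L := by linarith [hc.trans (min_le_right _ _)]
    obtain ⟨⟨hΛ1, hΛ2⟩, h0, hq⟩ := cell_bounds (n := n) hf hflat (by linarith) hc2 hnL hC hη
    have hCm : MeasurableSet C := by rw [hC]; exact measurableSet_Icc
    have := cond_isProbabilityMeasure h0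
    rw [← hC]
    refine ⟨fun x x' y hx' hE _ hpin i hi => ?_, fun ω hlo' _ hpin => ?_, ?_⟩
    · have hEi := hE i
      have e : replaceIn C x x' i = x' i := by
        have hi' : x i ∈ C := hi
        simp [replaceIn, hi']
      simp only [e] at hEi
      rw [add_zero, Set.mem_Icc, not_and_or, not_le, not_le]
      by_contra! hcon
      have h1 : |x' i - pinnedMean f S C c (x, y)| ≤ ρ :=
        abs_le.2 ⟨by linarith [hcon.1], by linarith [hcon.2]⟩
      have h2 := abs_add_le (x' i - pinnedMean f S C c (x, y))
        (pinnedMean f S C c (x, y) - posteriorMean f S (replaceIn C x x') y)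
      rw [sub_add_sub_cancel] at h2
      linarith
    · rw [add_zero] at hpin
      -- For negative ρ the claimed bound exceeds 1 and there is nothing to prove.
      rcases lt_or_ge ρ 0 with hρ0 | hρ0
      · refine prob_le_one.trans ?_
        rw [← ENNReal.ofReal_one]
        refine ENNReal.ofReal_le_ofReal (Real.one_le_exp ?_)
        have h1 : r - K * (L ^ 2)⁻¹ ≤ 0 := by
          rw [← hρL]; exact mul_nonpos_of_nonpos_of_nonneg hρ0.le (by positivity)
        nlinarith
      set τ := pinnedMean f S C c ω with hτ
      have hJC : Set.Icc (τ + 0 - ρ) (τ + 0 + ρ) ⊆ C := by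
        rw [hC]
        have h1 := abs_le.1 hpin
        -- The restriction r ≤ L / 2 keeps the avoided interval inside the cell, of half-width L^-11
        -- = L / n.
        have h2 : 1 / 2 * (L ^ 12)⁻¹ + r / L ^ 12 ≤ (L ^ 11)⁻¹ := by
          have e : (L ^ 11)⁻¹ = L / L ^ 12 := by field_simp
          rw [e, ← div_eq_mul_inv, ← add_div]
          gcongr
          linarith
        exact Set.Icc_subset_Icc (by linarith [h1.1]) (by linarith [h1.2])
      obtain ⟨hq1, -⟩ := hq _ _ (by linarith) hJC
      refine (pi_avoid_le C measurableSet_Icc ω.1 hlo' (by positivity)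
        (le_of_eq_of_le (by ring : Real.exp (-(2 * η)) * (ρ * L ^ 11) = _) hq1)).trans
        (ENNReal.ofReal_le_ofReal (Real.exp_le_exp.2 (neg_le_neg ?_)))
      have h2 : 0 ≤ ρ * L ^ 12 := by positivity
      calc 2 * l * (r - K * (L ^ 2)⁻¹) = 2 * l * (ρ * L ^ 12) := by rw [hρL]
        _ ≤ 2 * ((1 - ε₂) * Real.exp (-(3 * η)) * l') * (ρ * L ^ 12) := by gcongr
        _ = lo * (Real.exp (-(2 * η)) * (ρ * L ^ 11)) := by
            have e : Real.exp (-(3 * η)) = Real.exp (-η) * Real.exp (-(2 * η)) := by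
              rw [← Real.exp_add]; ring_nf
            rw [hlo, e]; ring
    · have h1 : Real.exp (-η) * (2 * L * l') ≤ n * (noise f).real C := by
        refine le_trans ?_ hΛ1; gcongr
      have h2 : n * (noise f).real C ≤ Real.exp η * (2 * L * f 0) := by
        refine hΛ2.trans ?_; gcongr; exact hf.le_zero c
      have h3 := measure_cellCount_lt_le hf hS hCm hε₂0 (by linarith) h1
      have h4 := measure_lt_cellCount_le hf hS hCm (ε := 1 / 2) (by norm_num) (by norm_num) h2
      -- (1 + 1/2) · 4/3 · 2 = 4, which is why the count cap is 4 f(0) L.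
      have hsub : {ω : (Fin n → ℝ) × ℝ | 4 * f 0 * L < cellCount C ω.1} ⊆
          {ω | (1 + 1 / 2) * (Real.exp η * (2 * L * f 0)) < cellCount C ω.1} := by
        intro ω (hω : 4 * f 0 * L < cellCount C ω.1)
        refine lt_of_le_of_lt ?_ hω
        calc _ ≤ (1 + 1 / 2) * (4 / 3 * (2 * L * f 0)) := by gcongr
          _ = _ := by ring
      calc _ ≤ ENNReal.ofReal (Real.exp (-(b * L))) + ENNReal.ofReal (Real.exp (-(b * L))) := by
            refine add_le_add (h3.trans (ENNReal.ofReal_le_ofReal (Real.exp_le_exp.2 ?_)))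
              (((measure_mono hsub).trans h4).trans
                (ENNReal.ofReal_le_ofReal (Real.exp_le_exp.2 ?_)))
            · have hb1 : b ≤ ε₂ ^ 2 / 4 * l' := min_le_left _ _
              have : b * L ≤ ε₂ ^ 2 / 4 * (1 / 2 * (2 * L * l')) := by
                calc _ ≤ ε₂ ^ 2 / 4 * l' * L := by gcongr
                  _ = _ := by ring
              refine neg_le_neg (this.trans ?_)
              gcongr
            · have hb1 : b ≤ f 0 / 8 := min_le_right _ _
              have h1e : 1 ≤ Real.exp η := Real.one_le_exp hη0.le
              have : b * L ≤ (1 / 2) ^ 2 / 4 * (1 * (2 * L * f 0)) := by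
                calc _ ≤ f 0 / 8 * L := by gcongr
                  _ = _ := by ring
              refine neg_le_neg (this.trans ?_)
              gcongr
        _ = _ := by rw [← ENNReal.ofReal_add (by positivity) (by positivity)]; ring_nf

end Spacing

/-! ### Upper bound on the chance of hitting a biased target. -/

section Hitting

variable {f : ℝ → ℝ} {S : SideInfo} {n : ℕ}

lemma measurableSet_exists_abs_sub_le (hf : WellBehaved f) (hS : S.IsProper) (β r : ℝ) :
    MeasurableSet {ω : (Fin n → ℝ) × ℝ |
      ∃ i, |ω.1 i - (posteriorMean f S ω.1 ω.2 + β)| ≤ r} := by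
  rw [Set.ofPred_exists]
  exact MeasurableSet.iUnion fun i => measurableSet_le
    ((((measurable_pi_apply i).comp measurable_fst).sub
      ((measurable_posteriorMean (n := n) hf hS).add_const β)).abs) measurable_const

/-- Absorbs into an additive error both the shift k of the exponent caused by sensitivity and the
factor 1 + u caused by averaging. -/
lemma one_sub_exp_mul_le {a k u : ℝ} (ha : 0 ≤ a) (hk : 0 ≤ k) (hu : 0 ≤ u) :
    (1 - Real.exp (-(a + k))) * (1 + u) ≤ 1 - Real.exp (-a) + (u + k) := by
  have h1 : Real.exp (-a) ≤ 1 := Real.exp_le_one_iff.2 (by linarith)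
  have h2 := Real.add_one_le_exp (-k)
  have h3 : Real.exp (-(a + k)) = Real.exp (-a) * Real.exp (-k) := by
    rw [← Real.exp_add]; ring_nf
  have h4 : Real.exp (-a) * (-k + 1) ≤ Real.exp (-(a + k)) := by rw [h3]; gcongr
  have h5 : 0 ≤ Real.exp (-(a + k)) * u := by positivity
  have h6 : Real.exp (-a) * k ≤ 1 * k := by gcongr
  linarith

set_option maxHeartbeats 800000 in
-- Counterpart of `WellBehaved.exists_miss_le`: a hit forces a resampled anecdote into a slightly
-- enlarged interval around the pinned target. The cap |β| ≤ L is needed because the flatness of f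
-- on a cell is controlled only for centers of size O(L).
lemma WellBehaved.exists_hit_le_of_abs_le (hf : WellBehaved f) {l ε η₀ R : ℝ} (hη₀ : 0 < η₀)
    (hl : f η₀ < l) (hε : 0 < ε) :
    ∃ L₁ : ℝ, ∀ (S : SideInfo) (n : ℕ) (L : ℝ), S.IsProper → 1 ≤ n → L₁ ≤ L → (n : ℝ) = L ^ 12 →
      ∀ β : ℝ, η₀ ≤ |β| → |β| ≤ L → ∀ r : ℝ, 0 ≤ r → r ≤ R →
        zeroLaw f S n {ω | ∃ i, |ω.1 i - (posteriorMean f S ω.1 ω.2 + β)| ≤ r / L ^ 12} ≤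
          ENNReal.ofReal (1 - Real.exp (-(2 * l * r)) + ε) := by
  obtain ⟨K, D, L₀, hK, hD, hL₀, hwin⟩ := hf.exists_window_le
  obtain ⟨K', hK', hflat⟩ := hf.exists_flat
  have hf0 := hf.pos 0
  have hl0 : 0 < l := (hf.pos _).trans hl
  -- Centers within d of β have absolute value at least η₀ - d, so by monotonicity the density there
  -- is at most f(η₀ - d) < l, uniformly in β.
  obtain ⟨d, hd0, hd1, hdη, hdl⟩ : ∃ d > 0, d ≤ 1 ∧ d ≤ η₀ ∧ f (η₀ - d) < l := by
    have h1 : ∀ᶠ c in 𝓝 η₀, f c < l := hf.continuous.continuousAt.eventually (gt_mem_nhds hl)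
    obtain ⟨d, hd, h⟩ := Metric.eventually_nhds_iff.1 h1
    refine ⟨min (d / 2) (min 1 η₀), lt_min (by positivity) (lt_min one_pos hη₀),
      (min_le_right _ _).trans (min_le_left _ _), (min_le_right _ _).trans (min_le_right _ _),
      h ?_⟩
    rw [Real.dist_eq, sub_sub_cancel_left, abs_neg, abs_of_pos
      (lt_min (by positivity) (lt_min one_pos hη₀))]
    linarith [min_le_left (d / 2) (min 1 η₀)]
  set l' := f (η₀ - d) with hl'
  have hl'0 : 0 < l' := hf.pos _
  set ε₂ := min (1 / 2) ((l - l') / (2 * l')) with hε₂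
  have hε₂0 : 0 < ε₂ := lt_min (by norm_num) (div_pos (by linarith) (by positivity))
  have hε₂1 : ε₂ ≤ 1 / 2 := min_le_left _ _
  have hll : (1 + ε₂) * l' < l := by
    have : ε₂ * l' ≤ (l - l') / (2 * l') * l' := by gcongr; exact min_le_right _ _
    have e : (l - l') / (2 * l') * l' = (l - l') / 2 := by field_simp
    linarith
  set b := ε₂ ^ 2 / 2 * l' with hb
  have hb0 : 0 < b := by positivity
  have tη := tendsto_mul_inv_pow_zero K' (k := 10) (by norm_num)
  have texp : ∀ A : ℝ, Tendsto (fun L : ℝ => Real.exp (A * (K' * (L ^ 10)⁻¹))) atTop (𝓝 1) := by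
    intro A
    have h := (Real.continuous_exp.tendsto _).comp (tη.const_mul A)
    rw [mul_zero, Real.exp_zero] at h
    exact h
  have tq : Tendsto (fun L : ℝ => Real.exp (2 * (K' * (L ^ 10)⁻¹)) * ((R + K) * (L ^ 1)⁻¹)) atTop
      (𝓝 0) := by
    simpa using (texp 2).mul (tendsto_mul_inv_pow_zero (R + K) one_ne_zero)
  have c1 : ∀ᶠ L : ℝ in atTop, (1 + ε₂) * Real.exp (3 * (K' * (L ^ 10)⁻¹)) * l' *
      (1 - Real.exp (2 * (K' * (L ^ 10)⁻¹)) * ((R + K) * (L ^ 1)⁻¹))⁻¹ ≤ l := by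
    have h := (((texp 3).const_mul (1 + ε₂)).mul_const l').mul ((tq.const_sub 1).inv₀ (by simp))
    simp only [mul_one, sub_zero, inv_one] at h
    exact h.eventually_le_const hll
  have c1' := tq.eventually_lt_const (zero_lt_one (α := ℝ))
  have c2 : ∀ᶠ L : ℝ in atTop, Real.exp (1 * (K' * (L ^ 10)⁻¹)) ≤ 4 / 3 :=
    (texp 1).eventually_le_const (by norm_num)
  have c3 : ∀ᶠ L : ℝ in atTop, (4 * K + 2 * l * K) * (L ^ 2)⁻¹ ≤ ε / 2 :=
    (tendsto_mul_inv_pow_zero _ (by norm_num)).eventually_le_const (by positivity)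
  have c4 := eventually_window_error_le (D := D) hb0 1 1
  have c4' : ∀ᶠ L : ℝ in atTop, (L ^ 1)⁻¹ ≤ ε / 2 :=
    (tendsto_inv_pow_zero one_ne_zero).eventually_le_const (by positivity)
  have c5 : ∀ᶠ L : ℝ in atTop, 4 * (L ^ 5)⁻¹ ≤ d :=
    (tendsto_mul_inv_pow_zero 4 (by norm_num)).eventually_le_const hd0
  obtain ⟨L₁, hL₁⟩ := eventually_atTop.1
    (c1.and <| c1'.and <| c2.and <| c3.and <| c4.and <| c4'.and <| c5.and <|
      (eventually_ge_atTop L₀).and (eventually_ge_atTop (R + 2 * K + 1)))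
  refine ⟨L₁, fun S n L hS hn hL hnL β hβ hβL r hr0 hr => ?_⟩
  obtain ⟨c1, c1', c2, c3, c4, c4', c5, c6, c7⟩ := hL₁ L hL
  have hL2 : 2 ≤ L := hL₀.trans c6
  have hL0 : 0 < L := by linarith
  have hprob := hf.isProbabilityMeasure
  set η := K' * (L ^ 10)⁻¹ with hη
  have hη0 : 0 < η := by positivity
  rw [one_mul] at c2
  have h2i : (L ^ 2)⁻¹ ≤ 1 := inv_le_one_of_one_le₀ (one_le_pow₀ (by linarith))
  set hi := (1 + ε₂) * (Real.exp η * (2 * L * l')) with hhi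
  have hl'f : l' ≤ f 0 := hf.le_zero _
  have hhi4 : hi ≤ 4 * f 0 * L := by
    calc hi ≤ (1 + 1 / 2) * (4 / 3 * (2 * L * f 0)) := by rw [hhi]; gcongr
      _ = _ := by ring
  set ρ := r / L ^ 12 + K * (L ^ 14)⁻¹ with hρ
  have hρ0 : 0 ≤ ρ := by positivity
  have hρL : ρ * L ^ 12 = r + K * (L ^ 2)⁻¹ := by rw [hρ]; field_simp
  have hwid : ρ + (1 / 2 * (L ^ 12)⁻¹ + K * (L ^ 14)⁻¹) ≤ (L ^ 11)⁻¹ := by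
    have e1 : (L ^ 11)⁻¹ = L * (L ^ 12)⁻¹ := by field_simp
    have e2 : ρ + (1 / 2 * (L ^ 12)⁻¹ + K * (L ^ 14)⁻¹) =
        (r + 2 * (K * (L ^ 2)⁻¹) + 1 / 2) * (L ^ 12)⁻¹ := by rw [hρ]; field_simp; ring
    rw [e1, e2]
    gcongr
    have : K * (L ^ 2)⁻¹ ≤ K * 1 := by gcongr
    linarith
  set x₀ := 2 * l * (r + K * (L ^ 2)⁻¹) with hx₀
  have hx₀0 : 0 ≤ x₀ := by positivity
  -- Only an upper bound on the count matters for hitting, so the lower threshold is 0 and its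
  -- exceptional event is empty.
  have hmain := hwin S n L hS hn c6 hnL β d 0 hi (1 - Real.exp (-x₀)) (1 * Real.exp (-(b * L))) hβL
    c5 hd1 hhi4 (by simpa using hx₀0) (by positivity) _
    (measurableSet_exists_abs_sub_le hf hS β (r / L ^ 12))
    (fun c => (avoidSet f S (Set.Icc (c - (L ^ 11)⁻¹) (c + (L ^ 11)⁻¹)) c β ρ n)ᶜ)
    (fun c => (measurableSet_avoidSet hf hS measurableSet_Icc c β ρ).compl) ?_
  · refine hmain.trans (ENNReal.ofReal_le_ofReal ?_)
    have h1 := one_sub_exp_mul_le (a := 2 * l * r) (k := 2 * l * K * (L ^ 2)⁻¹)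
      (u := 4 * K * (L ^ 2)⁻¹) (by positivity) (by positivity) (by positivity)
    have e : 2 * l * r + 2 * l * K * (L ^ 2)⁻¹ = x₀ := by rw [hx₀]; ring
    rw [e] at h1
    linarith
  · intro c C hc hC
    have hfc : f c ≤ l' := by
      refine hf.le_of_abs_le ?_
      have := abs_sub_abs_le_abs_sub β c
      rw [abs_sub_comm] at this
      rw [abs_of_nonneg (by linarith)]
      linarith
    have hc2 : |c| ≤ 2 * L := by
      have := abs_sub_abs_le_abs_sub c β
      linarith
    obtain ⟨⟨hΛ1, hΛ2⟩, h0, hq⟩ := cell_bounds (n := n) hf hflat (by linarith) hc2 hnL hC hη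
    have hCm : MeasurableSet C := by rw [hC]; exact measurableSet_Icc
    have := cond_isProbabilityMeasure h0
    rw [← hC]
    refine ⟨fun x x' y hx' hE hT hpin => ?_, fun ω _ hhi' hpin => ?_, ?_⟩
    · obtain ⟨i, hE⟩ := hE
      have hE' : |replaceIn C x x' i - (posteriorMean f S (replaceIn C x x') y + β)| ≤
        r / L ^ 12 := hE
      have hE1 := abs_le.1 hE'
      have hT1 := abs_le.1 hT
      have hpin1 := abs_le.1 hpin
      have hK0 : 0 ≤ K * (L ^ 14)⁻¹ := by positivity
      have hC' : ∀ v, c - (L ^ 11)⁻¹ ≤ v → v ≤ c + (L ^ 11)⁻¹ → v ∈ C := fun v h1 h2 => by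
        rw [hC]; exact ⟨h1, h2⟩
      have hmem : replaceIn C x x' i ∈ C := hC' _ (by linarith) (by linarith)
      have hi' : x i ∈ C := (replaceIn_mem_iff hx' i).1 hmem
      have e : replaceIn C x x' i = x' i := by simp [replaceIn, hi']
      rw [e] at hE1
      intro hav
      refine hav i hi' ⟨?_, ?_⟩ <;> linarith
    · set τ := pinnedMean f S C c ω with hτ
      have hJC : Set.Icc (τ + β - ρ) (τ + β + ρ) ⊆ C := by
        rw [hC]
        have h1 := abs_le.1 hpin
        exact Set.Icc_subset_Icc (by linarith [h1.1]) (by linarith [h1.2])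
      obtain ⟨-, hq1⟩ := hq _ _ (by linarith) hJC
      set q := Real.exp (2 * η) * ((r + K * (L ^ 2)⁻¹) * (L ^ 1)⁻¹) with hqd
      have hqq : q ≤ Real.exp (2 * η) * ((R + K) * (L ^ 1)⁻¹) := by
        rw [hqd]
        gcongr
        exact mul_le_of_le_one_right hK.le h2i
      have hq1' : q < 1 := hqq.trans_lt c1'
      refine (pi_compl_avoid_le C measurableSet_Icc ω.1 hhi' (hq1.trans_eq ?_) hq1').trans
        (ENNReal.ofReal_le_ofReal (sub_le_sub_left (Real.exp_le_exp.2 (neg_le_neg ?_)) _))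
      · rw [hqd, ← hρL]
        have e : ρ * L ^ 12 * (L ^ 1)⁻¹ = ρ * L ^ 11 := by field_simp
        rw [e]; ring
      · have hinv : (1 - q)⁻¹ ≤ (1 - Real.exp (2 * η) * ((R + K) * (L ^ 1)⁻¹))⁻¹ :=
          inv_anti₀ (by linarith) (by linarith)
        have hinv0 : 0 ≤ (1 - q)⁻¹ := inv_nonneg.2 (by linarith)
        have e : hi * (q / (1 - q)) =
            2 * ((1 + ε₂) * Real.exp (3 * η) * l' * (1 - q)⁻¹) * (r + K * (L ^ 2)⁻¹) := by
          have e3 : Real.exp (3 * η) = Real.exp η * Real.exp (2 * η) := by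
            rw [← Real.exp_add]; ring_nf
          have e4 : L * (L ^ 1)⁻¹ = 1 := by field_simp
          calc hi * (q / (1 - q)) = 2 * ((1 + ε₂) * (Real.exp η * Real.exp (2 * η)) * l' *
                (1 - q)⁻¹) * (r + K * (L ^ 2)⁻¹) * (L * (L ^ 1)⁻¹) := by
                rw [hhi, div_eq_mul_inv]; nth_rewrite 1 [hqd]; ring
            _ = _ := by rw [e3, e4, mul_one]
        rw [e, hx₀]
        gcongr
        refine le_trans ?_ c1
        gcongr
    · have h2 : n * (noise f).real C ≤ Real.exp η * (2 * L * l') := by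
        refine hΛ2.trans ?_; gcongr
      have h4 := measure_lt_cellCount_le hf hS hCm hε₂0 (by linarith) h2
      have h3 : {ω : (Fin n → ℝ) × ℝ | (cellCount C ω.1 : ℝ) < 0} = ∅ := by
        ext ω; simp
      rw [h3, measure_empty, zero_add, one_mul]
      refine h4.trans (ENNReal.ofReal_le_ofReal (Real.exp_le_exp.2 (neg_le_neg ?_)))
      have h1e : 1 ≤ Real.exp η := Real.one_le_exp hη0.le
      calc b * L = ε₂ ^ 2 / 4 * (1 * (2 * L * l')) := by rw [hb]; ring
        _ ≤ _ := by gcongr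

/-- No anecdote is far out in the tails. -/
lemma WellBehaved.exists_far_le (hf : WellBehaved f) :
    ∃ D : ℝ, 0 < D ∧ ∀ (S : SideInfo) (n : ℕ) (a : ℝ), S.IsProper →
      zeroLaw f S n {ω | ∃ i, a ≤ |ω.1 i|} ≤ ENNReal.ofReal (n * (D * Real.exp (-(a / 2)))) := by
  have hprob := hf.isProbabilityMeasure
  have hgm : Measurable fun x : ℝ => Real.exp (1 / 2 * |x|) := by fun_prop
  have hint : Integrable (fun x : ℝ => Real.exp (1 / 2 * |x|)) (noise f) :=
    hf.integrable_noise_of_le (b := 1 / 2) (K := 1) (by norm_num) hgm fun x => by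
      rw [abs_of_pos (Real.exp_pos _), one_mul]
  refine ⟨∫ x, Real.exp (1 / 2 * |x|) ∂(noise f), integral_exp_pos hint, fun S n a hS => ?_⟩
  have htail : noise f {x | a ≤ |x|} ≤
      ENNReal.ofReal ((∫ x, Real.exp (1 / 2 * |x|) ∂(noise f)) * Real.exp (-(a / 2))) := by
    have h1 : {x : ℝ | a ≤ |x|} ⊆ {x | ENNReal.ofReal (Real.exp (a / 2)) ≤
        ENNReal.ofReal (Real.exp (1 / 2 * |x|))} := by
      intro x (hx : a ≤ |x|)
      exact ENNReal.ofReal_le_ofReal (Real.exp_le_exp.2 (by linarith))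
    refine (measure_mono h1).trans ((meas_ge_le_lintegral_div hgm.ennreal_ofReal.aemeasurable
      (by simp [Real.exp_pos]) ENNReal.ofReal_ne_top).trans ?_)
    rw [← ofReal_integral_eq_lintegral_ofReal hint (ae_of_all _ fun x => (Real.exp_pos _).le),
      ← ENNReal.ofReal_div_of_pos (Real.exp_pos _), Real.exp_neg, div_eq_mul_inv]
  have hm : MeasurableSet {x : ℝ | a ≤ |x|} := measurableSet_le measurable_const (by fun_prop)
  rw [Set.ofPred_exists]
  refine (measure_iUnion_le _).trans ?_
  rw [tsum_fintype]
  refine (Finset.sum_le_sum (g := fun _ => ENNReal.ofReal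
    ((∫ x, Real.exp (1 / 2 * |x|) ∂(noise f)) * Real.exp (-(a / 2)))) fun i _ => ?_).trans ?_
  · exact ((measurePreserving_apply hf hS i).measure_preimage hm.nullMeasurableSet).trans_le htail
  · rw [Finset.sum_const, Finset.card_univ, Fintype.card_fin, ← ENNReal.ofReal_nsmul, nsmul_eq_mul]

/-- The chance that some anecdote lies within `r / n` of the biased target. -/
lemma WellBehaved.exists_hit_le (hf : WellBehaved f) {l ε η₀ R : ℝ} (hη₀ : 0 < η₀)
    (hl : f η₀ < l) (hε : 0 < ε) :
    ∃ L₁ : ℝ, ∀ (S : SideInfo) (n : ℕ) (L : ℝ), S.IsProper → 1 ≤ n → L₁ ≤ L → (n : ℝ) = L ^ 12 →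
      ∀ β : ℝ, η₀ ≤ |β| → ∀ r : ℝ, 0 ≤ r → r ≤ R →
        zeroLaw f S n {ω | ∃ i, |ω.1 i - (posteriorMean f S ω.1 ω.2 + β)| ≤ r / L ^ 12} ≤
          ENNReal.ofReal (1 - Real.exp (-(2 * l * r)) + ε) := by
  obtain ⟨L₁, hL₁⟩ := hf.exists_hit_le_of_abs_le (R := R) hη₀ hl hε
  obtain ⟨D, hD, hfar⟩ := hf.exists_far_le
  obtain ⟨D', hD', hconc⟩ := hf.exists_measure_compl_concentrated_le
  have hl0 : 0 < l := (hf.pos _).trans hl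
  have c1 : ∀ᶠ L : ℝ in atTop, L ^ 12 * (D * Real.exp (-((L - 2) / 2))) +
      D' * (L ^ 24 * Real.exp (-(L / 4))) ≤ ε := by
    have h1 := (tendsto_pow_mul_exp_neg_mul 12 (b := 1 / 2) (by norm_num)).const_mul
      (D * Real.exp 1)
    have h2 := (tendsto_pow_mul_exp_neg_mul 24 (b := 1 / 4) (by norm_num)).const_mul D'
    have h := h1.add h2
    rw [mul_zero, mul_zero, add_zero] at h
    filter_upwards [h.eventually_le_const hε] with L hL
    refine le_of_eq_of_le ?_ hL
    have e : -((L - 2) / 2) = 1 + -(1 / 2 * L) := by ring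
    have e' : -(L / 4) = -(1 / 4 * L) := by ring
    rw [e, e', Real.exp_add]; ring
  obtain ⟨L₂, hL₂⟩ := eventually_atTop.1
    (c1.and <| (eventually_ge_atTop (max L₁ 2)).and (eventually_ge_atTop R))
  refine ⟨L₂, fun S n L hS hn hL hnL β hβ r hr0 hr => ?_⟩
  obtain ⟨c1, c2, c3⟩ := hL₂ L hL
  have hL2 : 2 ≤ L := (le_max_right _ _).trans c2
  rcases le_or_gt |β| L with hβL | hβL
  · exact hL₁ S n L hS hn ((le_max_left _ _).trans c2) hnL β hβ hβL r hr0 hr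
  -- When |β| > L, the posterior mean is near 0 and a hit needs an anecdote beyond L - 2.
  -- Exponential tails beat the factor n = L^12.
  have hsub : {ω : (Fin n → ℝ) × ℝ |
      ∃ i, |ω.1 i - (posteriorMean f S ω.1 ω.2 + β)| ≤ r / L ^ 12} ⊆
      {ω | ∃ i, L - 2 ≤ |ω.1 i|} ∪ (concentrated f S n (L ^ 5)⁻¹ (L ^ 24)⁻¹)ᶜ := by
    rintro ω ⟨i, hi⟩
    by_cases hω : ω ∈ concentrated f S n (L ^ 5)⁻¹ (L ^ 24)⁻¹
    swap
    · exact Or.inr hω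
    refine Or.inl ⟨i, ?_⟩
    have h1 := abs_posteriorMean_le_of_mem_concentrated hf hS hn hL2 hω
    have h2 : r / L ^ 12 ≤ 1 := by
      rw [div_le_one (by positivity)]
      exact (hr.trans c3).trans (le_self_pow₀ (by linarith) (by norm_num))
    have h3 : 3 * (L ^ 5)⁻¹ ≤ 1 := by
      rw [← div_eq_mul_inv, div_le_one (by positivity)]
      calc (3 : ℝ) ≤ 2 ^ 5 := by norm_num
        _ ≤ L ^ 5 := by gcongr
    have h4 : |β| ≤ |ω.1 i| + |posteriorMean f S ω.1 ω.2| +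
        |ω.1 i - (posteriorMean f S ω.1 ω.2 + β)| := by
      have e : β = ω.1 i - posteriorMean f S ω.1 ω.2 -
        (ω.1 i - (posteriorMean f S ω.1 ω.2 + β)) := by ring
      conv_lhs => rw [e]
      exact (abs_sub _ _).trans (add_le_add (abs_sub _ _) le_rfl)
    linarith
  calc _ ≤ _ := measure_mono hsub
    _ ≤ _ := measure_union_le _ _
    _ ≤ _ := add_le_add (hfar S n (L - 2) hS) (hconc S n L hS hn hL2 hnL)
    _ ≤ ENNReal.ofReal ε := by
        rw [← ENNReal.ofReal_add (by positivity) (by positivity), hnL]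
        exact ENNReal.ofReal_le_ofReal c1
    _ ≤ _ := by
        refine ENNReal.ofReal_le_ofReal ?_
        have : Real.exp (-(2 * l * r)) ≤ 1 := Real.exp_le_one_iff.2 (by
          have : 0 ≤ 2 * l * r := by positivity
          linarith)
        linarith

end Hitting

/-! ### Layer cake integration and a uniform fourth moment. -/

section Moments

variable {f : ℝ → ℝ} {S : SideInfo} {n : ℕ}

/-- Layer cake formula for the truncated second moment. -/
lemma integral_min_sq_eq {Ω : Type*} [MeasurableSpace Ω] {μ : Measure Ω} [IsProbabilityMeasure μ]
    {X : Ω → ℝ} (hX : Measurable X) (hX0 : ∀ ω, 0 ≤ X ω) {R : ℝ} (hR : 0 ≤ R) :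
    ∫ ω, min (X ω) R ^ 2 ∂μ = ∫ t in 0..R, 2 * t * μ.real {ω | t < X ω} := by
  have hmin0 : ∀ ω, 0 ≤ min (X ω) R := fun ω => le_min (hX0 ω) hR
  have hg : ∀ a : ℝ, ∫ t in 0..a, 2 * t = a ^ 2 := fun a => by
    rw [intervalIntegral.integral_const_mul, integral_id]; ring
  have h := lintegral_comp_eq_lintegral_meas_lt_mul μ (f := fun ω => min (X ω) R)
    (g := fun t => 2 * t) (ae_of_all _ hmin0) (hX.min measurable_const).aemeasurable
    (fun t _ => (by fun_prop : Continuous fun t : ℝ => 2 * t).intervalIntegrable _ _)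
    ((ae_restrict_iff' measurableSet_Ioi).2 (ae_of_all _ fun t (ht : 0 < t) => by positivity))
  simp_rw [hg] at h
  have hm : Measurable fun t => μ.real {ω | t < X ω} := by
    have : Antitone fun t => μ.real {ω | t < X ω} := fun s t hst =>
      measureReal_mono (fun ω (hω : t < X ω) => lt_of_le_of_lt hst hω) (measure_ne_top _ _)
    exact this.measurable
  have h2 : ∫⁻ t in Set.Ioi 0, μ {ω | t < min (X ω) R} * ENNReal.ofReal (2 * t) =
      ∫⁻ t in Set.Ioo 0 R, ENNReal.ofReal (2 * t * μ.real {ω | t < X ω}) := by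
    rw [← lintegral_indicator measurableSet_Ioi, ← lintegral_indicator measurableSet_Ioo]
    refine lintegral_congr fun t => ?_
    by_cases h0 : 0 < t
    · by_cases h1 : t < R
      · rw [Set.indicator_of_mem (show t ∈ Set.Ioi 0 from h0),
          Set.indicator_of_mem (show t ∈ Set.Ioo 0 R from ⟨h0, h1⟩),
          ENNReal.ofReal_mul (p := 2 * t) (by positivity), ofReal_measureReal (measure_ne_top _ _),
          mul_comm]
        simp [h1]
      · rw [Set.indicator_of_mem (show t ∈ Set.Ioi 0 from h0),
          Set.indicator_of_notMem (fun h => h1 h.2)]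
        simp [h1]
    · rw [Set.indicator_of_notMem (show t ∉ Set.Ioi 0 from h0),
        Set.indicator_of_notMem (fun h => h0 h.1)]
  rw [integral_eq_lintegral_of_nonneg_ae (ae_of_all _ fun ω => sq_nonneg _)
    ((hX.min measurable_const).pow_const 2).aestronglyMeasurable, h, h2,
    intervalIntegral.integral_of_le hR, integral_Ioc_eq_integral_Ioo,
    integral_eq_lintegral_of_nonneg_ae]
  · refine (ae_restrict_iff' measurableSet_Ioo).2 (ae_of_all _ fun t ht => ?_)
    have := ht.1
    have : 0 ≤ μ.real {ω | t < X ω} := measureReal_nonneg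
    positivity
  · exact ((measurable_id.const_mul 2).mul hm).aestronglyMeasurable

lemma intervalIntegrable_mul_measureReal_lt {Ω : Type*} [MeasurableSpace Ω] {μ : Measure Ω}
    [IsProbabilityMeasure μ] (X : Ω → ℝ) (a b : ℝ) :
    IntervalIntegrable (fun t => 2 * t * μ.real {ω | t < X ω}) volume a b := by
  have : Antitone fun t => μ.real {ω | t < X ω} := fun s t hst =>
    measureReal_mono (fun ω (hω : t < X ω) => lt_of_le_of_lt hst hω) (measure_ne_top _ _)
  exact this.intervalIntegrable.continuousOn_mul (by fun_prop)

/-- The leading term 2 / b² is the second moment of the exponential law of rate b; it is used with b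
= 2l. -/
lemma integral_two_mul_mul_exp_neg {b : ℝ} (hb : 0 < b) (A B R : ℝ) :
    ∫ t in 0..R, 2 * t * (A * Real.exp (-(b * t)) + B) =
      A * (2 / b ^ 2 - Real.exp (-(b * R)) * (2 * R / b + 2 / b ^ 2)) + B * R ^ 2 := by
  have hd : ∀ t ∈ Set.uIcc 0 R, HasDerivAt
      (fun t => -A * (Real.exp (-(b * t)) * (2 * t / b + 2 / b ^ 2)) + B * t ^ 2)
      (2 * t * (A * Real.exp (-(b * t)) + B)) t := fun t _ => by
    have h1 : HasDerivAt (fun t => Real.exp (-(b * t))) (Real.exp (-(b * t)) * -(b * 1)) t :=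
      (((hasDerivAt_id t).const_mul b).neg).exp
    have h2 : HasDerivAt (fun t => 2 * t / b + 2 / b ^ 2) (2 * 1 / b) t :=
      (((hasDerivAt_id t).const_mul 2).div_const b).add_const _
    have h3 := ((h1.mul h2).const_mul (-A)).add ((hasDerivAt_pow 2 t).const_mul B)
    refine h3.congr_deriv ?_
    field_simp
    ring
  rw [intervalIntegral.integral_eq_sub_of_hasDerivAt hd
    ((by fun_prop : Continuous fun t : ℝ => 2 * t * (A * Real.exp (-(b * t)) + B)).intervalIntegrable
      _ _)]
  simp
  ring

/-- The distance of an anecdote to the posterior mean has a bounded fourth moment. -/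
lemma WellBehaved.exists_fourth_moment_le (hf : WellBehaved f) :
    ∃ D : ℝ, 0 ≤ D ∧ ∀ (S : SideInfo) (n : ℕ), S.IsProper → ∀ (hn : 1 ≤ n),
      Integrable (fun ω => (ω.1 ⟨0, hn⟩ - posteriorMean f S ω.1 ω.2) ^ 4) (zeroLaw f S n) ∧
      ∫ ω, (ω.1 ⟨0, hn⟩ - posteriorMean f S ω.1 ω.2) ^ 4 ∂(zeroLaw f S n) ≤ D := by
  have h4 : ∀ x : ℝ, |x ^ 4| ≤ 1024 * Real.exp (1 / 2 * |x|) := fun x => by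
    have h1 := sq_le_exp_quarter x
    have h2 : x ^ 4 = (x ^ 2) ^ 2 := by ring
    have h3 : Real.exp (1 / 2 * |x|) = Real.exp (1 / 4 * |x|) ^ 2 := by
      rw [← Real.exp_nat_mul]; ring_nf
    rw [h2, abs_of_nonneg (sq_nonneg _), h3]
    calc (x ^ 2) ^ 2 ≤ (32 * Real.exp (1 / 4 * |x|)) ^ 2 := by gcongr
      _ = _ := by ring
  have hint : Integrable (fun x : ℝ => x ^ 4) (noise f) :=
    hf.integrable_noise_of_le (b := 1 / 2) (by norm_num) (by fun_prop) h4
  refine ⟨∫ x, x ^ 4 ∂(noise f), integral_nonneg fun x => by positivity, fun S n hS hn => ?_⟩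
  set i₀ : Fin n := ⟨0, hn⟩
  have mT := measurable_posteriorMean (n := n) hf hS
  have mY : Measurable fun ω : (Fin n → ℝ) × ℝ => (ω.1 i₀ - posteriorMean f S ω.1 ω.2) ^ 4 :=
    (((measurable_pi_apply i₀).comp measurable_fst).sub mT).pow_const 4
  have hle : ∫⁻ ω, ENNReal.ofReal ((ω.1 i₀ - posteriorMean f S ω.1 ω.2) ^ 4) ∂(zeroLaw f S n) ≤
      ENNReal.ofReal (∫ x, x ^ 4 ∂(noise f)) := by
    have hm : Measurable fun p : ((Fin n → ℝ) × ℝ) × ℝ =>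
        ENNReal.ofReal ((p.1.1 i₀ - p.2) ^ 4) := by fun_prop
    -- The expected posterior fourth moment around an anecdote equals the fourth moment of its
    -- noise, whatever n and G are. Jensen's inequality then replaces the posterior draw by the
    -- posterior mean.
    have key := lintegral_posterior_zeroLaw hf hS hn
      (h := fun x _ t => ENNReal.ofReal ((x i₀ - t) ^ 4)) hm
      (fun x y t δ => by simp only [add_sub_add_right_eq_sub]) (fun _ _ _ _ _ => rfl)
    simp only [sub_zero] at key
    have hm4 : Measurable fun x : ℝ => ENNReal.ofReal (x ^ 4) := by fun_prop
    have e : ∫⁻ ω, ENNReal.ofReal (ω.1 i₀ ^ 4) ∂(zeroLaw f S n) =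
        ∫⁻ x, ENNReal.ofReal (x ^ 4) ∂(noise f) :=
      (measurePreserving_apply hf hS i₀).lintegral_comp hm4
    rw [ofReal_integral_eq_lintegral_ofReal hint (ae_of_all _ fun x => by positivity), ← e, ← key]
    refine lintegral_mono fun ω => ?_
    have := isProbabilityMeasure_posterior hf hS hn ω.1 ω.2
    have i1 := integrable_id_posterior hf hS hn ω.1 ω.2
    have i4 : Integrable (fun t => (ω.1 i₀ - t) ^ 4) (posterior f S ω.1 ω.2) := by
      refine integrable_posterior_of_le hf hS hn ω.1 ω.2 (b := 1 / 2)
        (K := 1024 * Real.exp (1 / 2 * |ω.1 i₀|)) (by norm_num) (by fun_prop) fun t => ?_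
      refine (h4 _).trans ?_
      rw [mul_assoc, ← Real.exp_add, ← mul_add]
      gcongr
      exact abs_sub _ _
    have hj := (Even.convexOn_pow (n := 4) (𝕜 := ℝ) (by decide)).map_integral_le
      (μ := posterior f S ω.1 ω.2) (f := fun t => ω.1 i₀ - t) (by fun_prop) isClosed_univ
      (ae_of_all _ fun _ => Set.mem_univ _) ((integrable_const _).sub i1) i4
    rw [integral_sub (integrable_const _) i1, ← posteriorMean_eq hf] at hj
    simp only [integral_const, probReal_univ, smul_eq_mul, one_mul] at hj
    rw [← ofReal_integral_eq_lintegral_ofReal i4 (ae_of_all _ fun t => by positivity)]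
    exact ENNReal.ofReal_le_ofReal hj
  have h0 : 0 ≤ᵐ[zeroLaw f S n] fun ω => (ω.1 i₀ - posteriorMean f S ω.1 ω.2) ^ 4 :=
    ae_of_all _ fun ω => by positivity
  refine ⟨⟨mY.aestronglyMeasurable, ?_⟩, ?_⟩
  · rw [hasFiniteIntegral_iff_ofReal h0]
    exact hle.trans_lt ENNReal.ofReal_lt_top
  · rw [integral_eq_lintegral_of_nonneg_ae h0 mY.aestronglyMeasurable]
    exact ENNReal.toReal_le_of_le_ofReal (integral_nonneg fun x => by positivity) hle

end Moments

/-! ### Second moments at scale 1/n and strict dominance. -/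

section Comparison

variable {f : ℝ → ℝ} {S : SideInfo} {n : ℕ}

/-- Upper bound on the scaled mean squared distance between the closest anecdote and the posterior
mean. -/
lemma WellBehaved.exists_sq_targeting_le (hf : WellBehaved f) {l v : ℝ} (hl : 0 < l)
    (hl' : l < f 0) (hv : 2 / (2 * l) ^ 2 < v) :
    ∃ L₁ : ℝ, ∀ (S : SideInfo) (n : ℕ) (L : ℝ), S.IsProper → 1 ≤ n → L₁ ≤ L → (n : ℝ) = L ^ 12 →
      ∀ π₀ : (Fin n → ℝ) → ℝ → ℝ, IsScheme S π₀ → IsTranslationInvariant π₀ →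
        IsTargeting f S 0 π₀ →
        (L ^ 12) ^ 2 * ∫ ω, (π₀ ω.1 ω.2 - posteriorMean f S ω.1 ω.2) ^ 2 ∂(zeroLaw f S n) ≤ v := by
  set J := 2 / (2 * l) ^ 2 with hJ
  have hJ0 : 0 < J := by positivity
  -- The factor 1 + ε uses half of the slack v - J; the other half absorbs the remainder terms.
  set ε := (v - J) / (2 * J) with hε
  have hε0 : 0 < ε := div_pos (by linarith) (by positivity)
  have hεJ : (1 + ε) * J = J + (v - J) / 2 := by rw [hε]; field_simp
  obtain ⟨L₀, hmiss⟩ := hf.exists_miss_le hl hl' hε0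
  obtain ⟨D, hD, hfour⟩ := hf.exists_fourth_moment_le
  have c1 : ∀ᶠ L : ℝ in atTop, (L ^ 98)⁻¹ + (D * (L ^ 12)⁻¹ +
      ((1 + ε) * (L ^ 60 * Real.exp (-(l * L))) + (L ^ 40)⁻¹)) ≤ (v - J) / 2 := by
    have h := (tendsto_inv_pow_zero (k := 98) (by norm_num)).add
      ((tendsto_mul_inv_pow_zero D (k := 12) (by norm_num)).add
      (((tendsto_pow_mul_exp_neg_mul 60 hl).const_mul (1 + ε)).add
      (tendsto_inv_pow_zero (k := 40) (by norm_num))))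
    simp only [mul_zero, add_zero] at h
    exact h.eventually_le_const (by linarith)
  obtain ⟨L₁, hL₁⟩ := eventually_atTop.1 (c1.and <| eventually_ge_atTop (max L₀ 1))
  refine ⟨L₁, fun S n L hS hn hL hnL π₀ hπ₀ ht₀ hc => ?_⟩
  obtain ⟨c1, c2⟩ := hL₁ L hL
  have hL1 : 1 ≤ L := (le_max_right _ _).trans c2
  have hL0 : 0 < L := by linarith
  have := hS.isProbabilityMeasure_zeroLaw (n := n) hf
  set μ := zeroLaw f S n
  have mT := measurable_posteriorMean (n := n) hf hS
  set X : (Fin n → ℝ) × ℝ → ℝ := fun ω => L ^ 12 * |π₀ ω.1 ω.2 - posteriorMean f S ω.1 ω.2| with hX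
  have mX : Measurable X := ((hπ₀.measurable.sub mT).abs).const_mul _
  have hX0 : ∀ ω, 0 ≤ X ω := fun ω => by positivity
  have hXsq : ∀ ω, X ω ^ 2 = (L ^ 12) ^ 2 * (π₀ ω.1 ω.2 - posteriorMean f S ω.1 ω.2) ^ 2 :=
    fun ω => by rw [hX, mul_pow, sq_abs]
  have hmiss' : ∀ t, 0 ≤ t → t ≤ L / 2 →
      μ.real {ω | t < X ω} ≤ (1 + ε) * Real.exp (-(2 * l * t)) + (L ^ 100)⁻¹ := by
    intro t ht0 ht
    refine ENNReal.toReal_le_of_le_ofReal (by positivity) ?_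
    refine le_trans (measure_mono ?_)
      (hmiss S n L hS hn ((le_max_left _ _).trans c2) hnL t ht0 ht)
    intro ω (hω : t < L ^ 12 * |π₀ ω.1 ω.2 - posteriorMean f S ω.1 ω.2|) i
    obtain ⟨j, hj, hle⟩ := hc ω.1 ω.2
    simp only [add_zero] at hle
    rw [div_lt_iff₀ (by positivity), mul_comm]
    refine hω.trans_le ?_
    rw [hj]
    exact mul_le_mul_of_nonneg_left (hle i) (by positivity)
  have hmin : ∫ ω, min (X ω) (L / 2) ^ 2 ∂μ ≤ (1 + ε) * J + (L ^ 98)⁻¹ := by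
    rw [integral_min_sq_eq mX hX0 (by positivity)]
    calc _ ≤ ∫ t in 0..L / 2, 2 * t * ((1 + ε) * Real.exp (-(2 * l * t)) + (L ^ 100)⁻¹) := by
          refine intervalIntegral.integral_mono_on (by positivity)
            (intervalIntegrable_mul_measureReal_lt X _ _)
            ((by fun_prop : Continuous _).intervalIntegrable _ _) fun t ht => ?_
          have := ht.1
          exact mul_le_mul_of_nonneg_left (hmiss' t ht.1 ht.2) (by positivity)
      _ = _ := integral_two_mul_mul_exp_neg (by positivity) _ _ _
      _ ≤ _ := by
          have h1 : 0 ≤ Real.exp (-(2 * l * (L / 2))) *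
            (2 * (L / 2) / (2 * l) + 2 / (2 * l) ^ 2) := by positivity
          have h2 : (L ^ 100)⁻¹ * (L / 2) ^ 2 ≤ (L ^ 98)⁻¹ := by
            have e : (L ^ 100)⁻¹ * (L / 2) ^ 2 = (L ^ 98)⁻¹ / 4 := by field_simp; norm_num
            have : 0 < (L ^ 98)⁻¹ := by positivity
            rw [e]; linarith
          gcongr
          linarith
  obtain ⟨i4, hfour'⟩ := hfour S n hS hn
  set A := {ω | L / 2 < X ω} with hA
  have mA : MeasurableSet A := measurableSet_lt measurable_const mX
  have iA : Integrable (A.indicator fun _ => (1 : ℝ)) μ := (integrable_const _).indicator mA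
  have imin : Integrable (fun ω => min (X ω) (L / 2) ^ 2) μ := by
    refine (integrable_const ((L / 2) ^ 2)).mono'
      ((mX.min measurable_const).pow_const 2).aestronglyMeasurable (ae_of_all _ fun ω => ?_)
    have h0 : 0 ≤ min (X ω) (L / 2) := le_min (hX0 ω) (by positivity)
    rw [Real.norm_eq_abs, abs_of_nonneg (sq_nonneg _)]
    gcongr
    exact min_le_right _ _
  -- Beyond the truncation the closest anecdote is no farther than the first one. Its fourth moment
  -- is bounded, and the event has probability O(exp(-l L) + L^-100), which compensates the weight L
  -- ^ 60.
  have hpt : ∀ ω, X ω ^ 2 ≤ min (X ω) (L / 2) ^ 2 +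
      ((L ^ 12)⁻¹ * (ω.1 ⟨0, hn⟩ - posteriorMean f S ω.1 ω.2) ^ 4 +
        L ^ 60 * A.indicator (fun _ => (1 : ℝ)) ω) := by
    intro ω
    by_cases hω : ω ∈ A
    · rw [Set.indicator_of_mem hω, mul_one]
      set Y := |ω.1 ⟨0, hn⟩ - posteriorMean f S ω.1 ω.2| with hY
      have hXY : X ω ≤ L ^ 12 * Y := by
        obtain ⟨j, hj, hle⟩ := hc ω.1 ω.2
        simp only [add_zero] at hle
        rw [hX]
        dsimp only
        rw [hj]
        gcongr
        exact hle _
      have hY4 : (ω.1 ⟨0, hn⟩ - posteriorMean f S ω.1 ω.2) ^ 4 = Y ^ 4 := by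
        rw [hY, ← abs_pow, abs_of_nonneg (by positivity)]
      rw [hY4]
      have h1 : X ω ^ 2 ≤ (L ^ 12 * Y) ^ 2 := pow_le_pow_left₀ (hX0 ω) hXY 2
      -- Weighted arithmetic-geometric mean inequality, with weights making both expectations vanish
      -- as L grows.
      have h2 : (L ^ 12 * Y) ^ 2 ≤ (L ^ 12)⁻¹ * Y ^ 4 + L ^ 60 := by
        have h3 : (L ^ 12)⁻¹ * Y ^ 4 + L ^ 60 - (L ^ 12 * Y) ^ 2 =
            (L ^ 12)⁻¹ * ((Y ^ 2 - L ^ 36 / 2) ^ 2 + 3 / 4 * (L ^ 36) ^ 2) := by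
          field_simp; ring
        have h4 : 0 ≤ (L ^ 12)⁻¹ * ((Y ^ 2 - L ^ 36 / 2) ^ 2 + 3 / 4 * (L ^ 36) ^ 2) := by
          positivity
        linarith
      linarith [sq_nonneg (min (X ω) (L / 2))]
    · rw [Set.indicator_of_notMem hω, min_eq_left (not_lt.1 hω)]
      have : 0 ≤ (L ^ 12)⁻¹ * (ω.1 ⟨0, hn⟩ - posteriorMean f S ω.1 ω.2) ^ 4 := by positivity
      linarith
  have hint : ∫ ω, (min (X ω) (L / 2) ^ 2 +
      ((L ^ 12)⁻¹ * (ω.1 ⟨0, hn⟩ - posteriorMean f S ω.1 ω.2) ^ 4 +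
        L ^ 60 * A.indicator (fun _ => (1 : ℝ)) ω)) ∂μ =
      ∫ ω, min (X ω) (L / 2) ^ 2 ∂μ +
      ((L ^ 12)⁻¹ * ∫ ω, (ω.1 ⟨0, hn⟩ - posteriorMean f S ω.1 ω.2) ^ 4 ∂μ +
        L ^ 60 * μ.real A) := by
    have i5 : Integrable (fun ω : (Fin n → ℝ) × ℝ =>
        (L ^ 12)⁻¹ * (ω.1 ⟨0, hn⟩ - posteriorMean f S ω.1 ω.2) ^ 4 +
          L ^ 60 * A.indicator (fun _ => (1 : ℝ)) ω) μ := (i4.const_mul _).add (iA.const_mul _)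
    rw [integral_add imin i5, integral_add (i4.const_mul _) (iA.const_mul _), integral_const_mul, integral_const_mul,
      integral_indicator_const _ mA, smul_eq_mul, mul_one]
  rw [← integral_const_mul]
  simp_rw [← hXsq]
  calc ∫ ω, X ω ^ 2 ∂μ ≤ _ := integral_mono_of_nonneg (ae_of_all _ fun ω => sq_nonneg _)
        (imin.add ((i4.const_mul _).add (iA.const_mul _))) (ae_of_all _ hpt)
    _ = _ := hint
    _ ≤ ((1 + ε) * J + (L ^ 98)⁻¹) + ((L ^ 12)⁻¹ * D +
        L ^ 60 * ((1 + ε) * Real.exp (-(2 * l * (L / 2))) + (L ^ 100)⁻¹)) := by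
        gcongr
        exact hmiss' _ (by positivity) le_rfl
    _ = (1 + ε) * J + ((L ^ 98)⁻¹ + (D * (L ^ 12)⁻¹ +
      ((1 + ε) * (L ^ 60 * Real.exp (-(l * L))) + (L ^ 40)⁻¹))) := by
        have e1 : 2 * l * (L / 2) = l * L := by ring
        have e2 : L ^ 60 * (L ^ 100)⁻¹ = (L ^ 40)⁻¹ := by field_simp
        rw [e1, ← e2]; ring
    _ ≤ v := by rw [hεJ]; linarith

/-- Lower bound on the scaled mean squared distance between any anecdote and a biased target. -/
lemma WellBehaved.exists_lt_sq_biased (hf : WellBehaved f) {l v η₀ : ℝ} (hη₀ : 0 < η₀)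
    (hl : f η₀ < l) (hv : v < 2 / (2 * l) ^ 2) :
    ∃ L₁ : ℝ, ∀ (S : SideInfo) (n : ℕ) (L : ℝ), S.IsProper → 1 ≤ n → L₁ ≤ L → (n : ℝ) = L ^ 12 →
      ∀ π : (Fin n → ℝ) → ℝ → ℝ, IsScheme S π → IsTranslationInvariant π →
        ∀ β : ℝ, η₀ ≤ |β| →
        v < (L ^ 12) ^ 2 *
          ∫ ω, (π ω.1 ω.2 - posteriorMean f S ω.1 ω.2 - β) ^ 2 ∂(zeroLaw f S n) := by
  have hl0 : 0 < l := (hf.pos _).trans hl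
  -- The truncated second moment of the exponential law tends to the full one, so a fixed R already
  -- exceeds v. A bounded range of radii thus suffices for the lower bound.
  obtain ⟨R, hRv, hR⟩ : ∃ R : ℝ, v < 2 / (2 * l) ^ 2 - Real.exp (-(2 * l * R)) *
      (2 * R / (2 * l) + 2 / (2 * l) ^ 2) ∧ 0 < R := by
    have h1 := ((tendsto_pow_mul_exp_neg_mul 1 (b := 2 * l) (by positivity)).const_mul
      (2 / (2 * l))).add ((tendsto_pow_mul_exp_neg_mul 0 (b := 2 * l) (by positivity)).const_mul
      (2 / (2 * l) ^ 2))
    have h2 := h1.const_sub (2 / (2 * l) ^ 2)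
    simp only [mul_zero, add_zero, sub_zero] at h2
    obtain ⟨R, hR⟩ := ((h2.eventually_const_lt hv).and (eventually_gt_atTop 0)).exists
    refine ⟨R, hR.1.trans_eq ?_, hR.2⟩
    ring
  set J := 2 / (2 * l) ^ 2 - Real.exp (-(2 * l * R)) * (2 * R / (2 * l) + 2 / (2 * l) ^ 2) with hJ
  -- An additive error ε in the tail costs ε R² after integration, half of the slack J - v.
  set ε := (J - v) / (2 * R ^ 2) with hε
  have hε0 : 0 < ε := div_pos (by linarith) (by positivity)
  have hεR : ε * R ^ 2 = (J - v) / 2 := by rw [hε]; field_simp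
  obtain ⟨L₀, hhit⟩ := hf.exists_hit_le (R := R) hη₀ hl hε0
  refine ⟨max L₀ 1, fun S n L hS hn hL hnL π hπ ht β hβ => ?_⟩
  have hL0 : 0 < L := zero_lt_one.trans_le ((le_max_right _ _).trans hL)
  have := hS.isProbabilityMeasure_zeroLaw (n := n) hf
  set μ := zeroLaw f S n
  have mT := measurable_posteriorMean (n := n) hf hS
  set X : (Fin n → ℝ) × ℝ → ℝ := fun ω =>
    L ^ 12 * |π ω.1 ω.2 - posteriorMean f S ω.1 ω.2 - β| with hX
  have mX : Measurable X := (((hπ.measurable.sub mT).sub_const β).abs).const_mul _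
  have hX0 : ∀ ω, 0 ≤ X ω := fun ω => by positivity
  have hXsq : ∀ ω, X ω ^ 2 = (L ^ 12) ^ 2 * (π ω.1 ω.2 - posteriorMean f S ω.1 ω.2 - β) ^ 2 :=
    fun ω => by rw [hX, mul_pow, sq_abs]
  have iX : Integrable (fun ω => X ω ^ 2) μ := by
    have h := (integrable_sq_sub_posteriorMean hf hS hn hπ ht (-β)).const_mul ((L ^ 12) ^ 2)
    refine h.congr (ae_of_all _ fun ω => ?_)
    simp only [hXsq]
    ring
  have hhit' : ∀ t, 0 ≤ t → t ≤ R →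
      1 * Real.exp (-(2 * l * t)) + -ε ≤ μ.real {ω | t < X ω} := by
    intro t ht0 htR
    have h1 : {ω | t < X ω}ᶜ ⊆
        {ω | ∃ i, |ω.1 i - (posteriorMean f S ω.1 ω.2 + β)| ≤ t / L ^ 12} := by
      intro ω hω
      have hω' : L ^ 12 * |π ω.1 ω.2 - posteriorMean f S ω.1 ω.2 - β| ≤ t := not_lt.1 hω
      obtain ⟨i, hi⟩ := hπ.selects ω.1 ω.2
      refine ⟨i, ?_⟩
      rw [le_div_iff₀ (by positivity), mul_comm, ← sub_sub, ← hi]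
      exact hω'
    have h2 : μ.real {ω | t < X ω}ᶜ ≤ 1 - Real.exp (-(2 * l * t)) + ε := by
      refine ENNReal.toReal_le_of_le_ofReal ?_ ((measure_mono h1).trans
        (hhit S n L hS hn ((le_max_left _ _).trans hL) hnL β hβ t ht0 htR))
      have : Real.exp (-(2 * l * t)) ≤ 1 := Real.exp_le_one_iff.2 (by
        have : 0 ≤ 2 * l * t := by positivity
        linarith)
      linarith
    rw [probReal_compl_eq_one_sub (measurableSet_lt measurable_const mX)] at h2
    linarith
  rw [← integral_const_mul]
  simp_rw [← hXsq]
  calc v < 1 * J + -ε * R ^ 2 := by linarith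
    _ = ∫ t in 0..R, 2 * t * (1 * Real.exp (-(2 * l * t)) + -ε) :=
        (integral_two_mul_mul_exp_neg (by positivity) _ _ _).symm
    _ ≤ ∫ t in 0..R, 2 * t * μ.real {ω | t < X ω} := by
        refine intervalIntegral.integral_mono_on hR.le
          ((by fun_prop : Continuous _).intervalIntegrable _ _)
          (intervalIntegrable_mul_measureReal_lt X _ _) fun t ht => ?_
        have := ht.1
        exact mul_le_mul_of_nonneg_left (hhit' t ht.1 ht.2) (by positivity)
    _ = ∫ ω, min (X ω) R ^ 2 ∂μ := (integral_min_sq_eq mX hX0 hR.le).symm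
    _ ≤ ∫ ω, X ω ^ 2 ∂μ := by
        refine integral_mono_of_nonneg (ae_of_all _ fun ω => sq_nonneg _) iX
          (ae_of_all _ fun ω => ?_)
        exact pow_le_pow_left₀ (le_min (hX0 ω) hR.le) (min_le_left _ _) 2

/-- For many anecdotes, targeting the posterior mean has a smaller signaling loss than any scheme
with a given amount of bias. -/
theorem WellBehaved.exists_signalingLoss_lt (hf : WellBehaved f) (hS : S.IsProper) {η : ℝ}
    (hη : 0 < η) :
    ∃ N : ℕ, 1 ≤ N ∧ ∀ n : ℕ, N ≤ n → ∀ π₀ π : (Fin n → ℝ) → ℝ → ℝ,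
      IsScheme S π₀ → IsTranslationInvariant π₀ → IsTargeting f S 0 π₀ →
      IsScheme S π → IsTranslationInvariant π →
      ∀ θ, η ≤ |bias f S π θ| → signalingLoss f S π₀ θ < signalingLoss f S π θ := by
  have hη' : f η < f 0 := hf.lt_of_abs_lt (by simpa using hη.ne')
  have hfη := hf.pos η
  -- Two levels strictly between f(η) and f(0) leave room for the errors of both estimates.
  set l₁ := (2 * f η + f 0) / 3 with hl₁
  set l₀ := (f η + 2 * f 0) / 3 with hl₀
  have hlt : l₁ < l₀ := by linarith
  have hl₁0 : 0 < l₁ := by linarith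
  have hl₀0 : 0 < l₀ := by linarith
  have hJ : 2 / (2 * l₀) ^ 2 < 2 / (2 * l₁) ^ 2 := by gcongr
  obtain ⟨v, hv1, hv2⟩ := exists_between hJ
  obtain ⟨L₁, h1⟩ := hf.exists_sq_targeting_le hl₀0 (by linarith) hv1
  obtain ⟨L₂, h2⟩ := hf.exists_lt_sq_biased hη (by linarith) hv2
  have hroot : Tendsto (fun n : ℕ => (n : ℝ) ^ (1 / 12 : ℝ)) atTop atTop :=
    (tendsto_rpow_atTop (by norm_num)).comp tendsto_natCast_atTop_atTop
  obtain ⟨N, hN⟩ := eventually_atTop.1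
    ((hroot.eventually_ge_atTop (max L₁ L₂)).and (eventually_ge_atTop 1))
  refine ⟨max N 1, le_max_right _ _, fun n hn π₀ π hπ₀ ht₀ hc hπ ht θ hb => ?_⟩
  obtain ⟨hL, hn1⟩ := hN n ((le_max_left _ _).trans hn)
  set L := (n : ℝ) ^ (1 / 12 : ℝ) with hLdef
  have hnL : (n : ℝ) = L ^ 12 := by
    rw [hLdef, ← Real.rpow_natCast, ← Real.rpow_mul (by positivity)]
    norm_num
  have hn0 : (0 : ℝ) < L ^ 12 := by rw [← hnL]; exact_mod_cast hn1
  have h1' := h1 S n L hS hn1 ((le_max_left _ _).trans hL) hnL π₀ hπ₀ ht₀ hc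
  have h2' := h2 S n L hS hn1 ((le_max_right _ _).trans hL) hnL π hπ ht _ hb
  rw [signalingLoss_eq_sub_sq hf hS hn1 hπ₀ ht₀, signalingLoss_eq hf hS hn1 hπ ht]
  -- The loss of π is its squared distance to θ_S + β. The loss of π₀ is at most its squared
  -- distance to θ_S, so its possible bias only helps.
  have h3 := lt_of_mul_lt_mul_left (h1'.trans_lt h2') (by positivity)
  linarith [sq_nonneg (bias f S π₀ θ)]

end Comparison

end Anecdote

/-! ### The main theorem. -/

theorem mainTheorem5 (f : ℝ → ℝ) (hf : Anecdote.WellBehaved f)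
    (S : Anecdote.SideInfo) (hS : S.IsProper) :
    -- the closest-anecdote scheme exists and is unbiased
    (∀ n : ℕ, 1 ≤ n →
      (∃ π₀ : (Fin n → ℝ) → ℝ → ℝ, Anecdote.IsScheme S π₀ ∧
        Anecdote.IsTranslationInvariant π₀ ∧ Anecdote.IsTargeting f S 0 π₀ ∧
        (S.IsSymmetric → ∀ θ, Anecdote.bias f S π₀ θ = 0)) ∧
      (∀ π₀ : (Fin n → ℝ) → ℝ → ℝ, Anecdote.IsScheme S π₀ →
        Anecdote.IsTranslationInvariant π₀ → Anecdote.IsTargeting f S 0 π₀ →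
        S.IsSymmetric → ∀ θ, Anecdote.NoTies f S n θ → Anecdote.bias f S π₀ θ = 0)) ∧
    -- it is optimal among all unbiased schemes
    (∀ n : ℕ, 1 ≤ n → ∀ π₀ π : (Fin n → ℝ) → ℝ → ℝ,
      Anecdote.IsScheme S π₀ → Anecdote.IsTranslationInvariant π₀ →
      Anecdote.IsTargeting f S 0 π₀ →
      Anecdote.IsScheme S π → Anecdote.IsTranslationInvariant π →
      ∀ θ, Anecdote.bias f S π θ = 0 →
        Anecdote.signalingLoss f S π₀ θ ≤ Anecdote.signalingLoss f S π θ ∧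
        ∀ (M_S M_R : ℝ) (α₀ α : ℝ → ℝ),
          Anecdote.IsBestResponse f S π₀ M_R α₀ → Anecdote.IsBestResponse f S π M_R α →
          Anecdote.senderUtility f S π M_S α θ ≤ Anecdote.senderUtility f S π₀ M_S α₀ θ) ∧
    -- for large `n` it strictly dominates all schemes with a given amount of bias
    (∀ η : ℝ, 0 < η → ∃ N : ℕ, ∀ n : ℕ, N ≤ n → ∀ π₀ π : (Fin n → ℝ) → ℝ → ℝ,
      Anecdote.IsScheme S π₀ → Anecdote.IsTranslationInvariant π₀ →
      Anecdote.IsTargeting f S 0 π₀ →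
      Anecdote.IsScheme S π → Anecdote.IsTranslationInvariant π →
      ∀ θ, η ≤ |Anecdote.bias f S π θ| →
        Anecdote.signalingLoss f S π₀ θ < Anecdote.signalingLoss f S π θ ∧
        ∀ (M_S M_R : ℝ) (α₀ α : ℝ → ℝ),
          Anecdote.IsBestResponse f S π₀ M_R α₀ → Anecdote.IsBestResponse f S π M_R α →
          Anecdote.senderUtility f S π M_S α θ < Anecdote.senderUtility f S π₀ M_S α₀ θ) := by
  refine ⟨fun n hn => ⟨⟨Anecdote.nearestScheme f S hn, Anecdote.isScheme_nearestScheme hf hS hn,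
    Anecdote.isTranslationInvariant_nearestScheme hf hS hn,
    Anecdote.isTargeting_nearestScheme f S hn, Anecdote.bias_nearestScheme hf hS hn⟩,
    fun π₀ _ _ hc hs θ h => Anecdote.bias_eq_zero_of_noTies hf hS hn hc hs θ h⟩,
    fun n hn π₀ π hπ₀ ht₀ hc hπ ht θ hb => ?_, fun η hη => ?_⟩
  · have h := Anecdote.signalingLoss_le_of_isTargeting hf hS hn hπ₀ ht₀ hc hπ ht θ hb
    refine ⟨h, fun M_S M_R α₀ α hα₀ hα => ?_⟩
    rw [Anecdote.senderUtility_eq hf hS hn hπ ht hα, Anecdote.senderUtility_eq hf hS hn hπ₀ ht₀ hα₀]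
    linarith
  · obtain ⟨N, hN1, hN⟩ := hf.exists_signalingLoss_lt hS hη
    refine ⟨N, fun n hn π₀ π hπ₀ ht₀ hc hπ ht θ hb => ?_⟩
    have h := hN n hn π₀ π hπ₀ ht₀ hc hπ ht θ hb
    refine ⟨h, fun M_S M_R α₀ α hα₀ hα => ?_⟩
    have hn1 := hN1.trans hn
    rw [Anecdote.senderUtility_eq hf hS hn1 hπ ht hα,
      Anecdote.senderUtility_eq hf hS hn1 hπ₀ ht₀ hα₀]
    linarith

end
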